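/- Let $n\ge 1$. **Quiver.** Let $\mathcal V=\{v_{ij}: 1\le j\le i\le n+1\}$ and $\mathcal V_-=\{v_{ij}: j<i\}$. The arrows $\mathcal A$ are the vertical ones $c_{ij}:v_{i+1,j}\to v_{ij}$ ($1\le j\le i\le n$) and the horizontal ones $d_{ij}:v_{ij}\to v_{i,j-1}$ ($2\le j\le i\le n+1$); $h_a,t_a$ are the head and tail of $a$. Givental's variety $\mathcal Z$ is the set of $\sigma\in(\mathbb C^*)^{\mathcal A}$ with $\sigma_d\sigma_c=\sigma_{c'}\sigma_{d'}$ for every square with top, right, left, bottom arrows $d,c,c',d'$; put $\tilde q_i=\sigma_{c_{ii}}\sigma_{d_{i+1,i+1}}$. Its universal cover is $\tilde{\mathcal Z}=\{(T_v)\in\mathbb C^{\mathcal V}:\sum_i T_{v_{ii}}=0\}$, with covering map $c(T)=(e^{T_{h_a}-T_{t_a}})_{a}$, and $\tilde{\mathcal Z}_{(T_1,\dots,T_{n+1})}\subset\tilde{\mathcal Z}$ is the fiber where $T_{v_{ii}}=T_i$ for all $i$ (for $\sum_i T_i=0$). **Lie theory.** Let $G^\vee=PSL_{n+1}(\mathbb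 C)$, with $B^\vee_-$ its lower triangular Borel subgroup, $B_+^\vee$ the upper triangular one, $U^\vee_\pm$ the unipotent radicals, and $\mathfrak h,\mathfrak h^\vee$ both identified with the traceless diagonal matrices and paired by $\langle h,h'\rangle=\sum_i h_ih'_i$. Let $x_i(t)=1+tE_{i,i+1}$, $y_i(t)=1+tE_{i+1,i}$, $\dot s_i=x_i(1)y_i(-1)x_i(1)$, and let $\dot w_0$ be the product of the $\dot s_i$ along the reduced word $(n,\dots,1,\,n,\dots,2,\,\dots,\,n)$ of the longest element $w_0$. Put $x_{\mathbf c}(\sigma)=\prod_{k=1}^{n}\prod_{j=n}^{k}x_j(\sigma_{c_{jk}})$, $x_{\mathbf d}(\sigma)=\prod_{k=n}^{1}\prod_{j=1}^{k}x_{n-j+1}(\sigma_{d_{k+1,j+1}})$ (factors in the indicated order), let $\tau(\sigma)$ be the class of $\mathrm{diag}(\tilde q_1\cdots\tilde q_n,\dots,\tilde q_n,1)$, and let $\beta(\sigma)=x_{\mathbf c}(\sigma)\,\tau(\sigma)\,\dot w_0^{-1}x_{\mathbf d}(-\sigma)^{-1}\in G^\vee$. Let $$\tilde Z_B^{\mathfrak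 h^\vee}=\{(h^\vee,b,h_R)\in\mathfrak h^\vee\times B^\vee_-\times\mathfrak h^\vee : b\in U^\vee_+\exp(h^\vee)\dot w_0^{-1}U^\vee_+,\ b\exp(-h_R)\in U^\vee_-\},$$ and let $\tilde Z_B^{h^\vee}$ be its fiber over $h^\vee$. Its complex structure is the one for which the covering $(h^\vee,b,h_R)\mapsto(h^\vee,b\dot w_0B_-^\vee)$ onto $\mathfrak h^\vee\times\mathcal R^\vee_{1,w_0}$ is locally biholomorphic, where $\mathcal R^\vee_{1,w_0}=(B^\vee_+B^\vee_-\cap B^\vee_-\dot w_0B^\vee_-)/B^\vee_-$. Let $V(\rho)$ be the irreducible representation of $SL_{n+1}(\mathbb C)$ whose highest weight $\rho$ is the sum of the fundamental weights, with lowest weight vector $v^-$ and highest weight vector $v^+=\dot w_0v^-$, and let $\langle v,v^-\rangle$ denote the coefficient of $v^-$ in the weight decomposition of $v$. With $f=\sum_iE_{i+1,i}$ and a lift $\tilde b\in SL_{n+1}(\mathbb C)$ of $b$, put $$\mathcal F_B(h^\vee,b,h_R)=\frac{\langle f\tilde b v^+,v^-\rangle+\langle\tilde b f v^+,v^-\rangle}{\langle\tilde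 b v^+,v^-\rangle},\qquad \tilde\phi(h^\vee,b,h_R;h)=e^{\langle h,h_R\rangle}.$$ Put $n_B=n(n+1)/2$. For a fixed reduced word $\mathbf i_0$ of $w_0$, let $\omega$ be the unique holomorphic $n_B$-form on $\mathcal R^\vee_{1,w_0}$ such that, for each reduced word $\mathbf i=(i_1,\dots,i_{n_B})$ of $w_0$, its restriction to the stratum $\{x_{i_1}(t_1)\cdots x_{i_{n_B}}(t_{n_B})B^\vee_-: t_l\in\mathbb C^*\}$ is $\epsilon_{\mathbf i}\bigwedge_l dt_l/t_l$ with $\epsilon_{\mathbf i}\in\{\pm1\}$ and $\epsilon_{\mathbf i_0}=1$. Let $\tilde\omega$ be the pullback of $\omega$ to $\tilde Z_B^{\mathfrak h^\vee}$ along $(h^\vee,b,h_R)\mapsto b\dot w_0B_-^\vee$. **Maps.** For $T\in\tilde{\mathcal Z}$ let $\gamma(T)=\mathrm{diag}(T_{v_{11}},\dots,T_{v_{n+1,n+1}})$, let $\tilde\beta=\beta\circ c$, and let $\gamma_R(T)$ be the diagonal matrix with $k$-th entry $S_{k-1}-S_k$, where $S_k=\sum_{i-j=k}T_{v_{ij}}$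 (so $S_0=S_{n+1}=0$). **Joe–Kim phase.** For $\lambda_1+\dots+\lambda_{n+1}=0$ put $\lambda_{c_{i1}}=\lambda_i+\tfrac12(\lambda_1+\dots+\lambda_{i-1})$; $\lambda_{c_{ij}}=\tfrac12\lambda_{i-j+1}$ for $j>1$; $\lambda_{d_{n+1,j}}=-\lambda_{n+2-j}-\tfrac12(\lambda_1+\dots+\lambda_{n+1-j})$; $\lambda_{d_{ij}}=-\tfrac12\lambda_{i-j+1}$ for $i<n+1$; and $$\tilde{\mathcal F}_{JK}(T;\lambda)=\sum_{a\in\mathcal A}e^{T_{h_a}-T_{t_a}}+\sum_{a\in\mathcal A}\lambda_a(T_{h_a}-T_{t_a}).$$ **Theorem.** 1. $(\gamma,\tilde\beta,\gamma_R)$ maps $\tilde{\mathcal Z}$ into $\tilde Z_B^{\mathfrak h^\vee}$. It is a covering composed with an open embedding, and it is holomorphic and locally biholomorphic. It takes the fiber $\tilde{\mathcal Z}_{(T_1,\dots,T_{n+1})}$ into the fiber $\tilde Z_B^{h^\vee}$ with $h^\vee=\mathrm{diag}(T_1,\dots,T_{n+1})$. 2. There is a sign $\epsilon\in\{\pm1\}$,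 the same for all fibers, such that on every fiber $\tilde{\mathcal Z}_{(T_1,\dots,T_{n+1})}$ one has $(\gamma,\tilde\beta,\gamma_R)^*\tilde\omega=\epsilon\bigwedge_{v\in\mathcal V_-}dT_v$ (the sign depends only on $n$, on $\mathbf i_0$ and on the ordering chosen on $\mathcal V_-$). 3. For all $\lambda$ with $\sum_i\lambda_i=0$, with $h=\mathrm{diag}(\lambda_1,\dots,\lambda_{n+1})$, and all $T\in\tilde{\mathcal Z}$, $$e^{\tilde{\mathcal F}_{JK}(T;\lambda)}=\bigl(e^{\mathcal F_B}\tilde\phi(\,\cdot\,;h)\bigr)\bigl(\gamma(T),\tilde\beta(T),\gamma_R(T)\bigr).$$ -/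

import Mathlib

open scoped MatrixGroups Topology
open Matrix

noncomputable section

namespace FlagMirror

/-! ### The quiver -/

/-- Pairs `(i, j)` with `j ≤ i`, both running from `0` to `m - 1`. -/
abbrev Tri (m : ℕ) : Type := {p : Fin m × Fin m // p.2 ≤ p.1}

/-- The vertices `v_{ij}`, `1 ≤ j ≤ i ≤ n + 1`; indices are shifted by one, so that `v_{ij}` is
the pair `(i - 1, j - 1)`. -/
abbrev Vertex (n : ℕ) : Type := Tri (n + 1)

/-- The diagonal vertex `v_{ii}`. -/
def diagVertex {n : ℕ} (i : Fin (n + 1)) : Vertex n := ⟨(i, i), le_refl i⟩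

/-- The vertices strictly below the diagonal. -/
abbrev LowerVertex (n : ℕ) : Type := {v : Vertex n // v.1.2 < v.1.1}

/-- The arrows. With unshifted labels, `Sum.inl (i - 1, j - 1)` is the vertical arrow `c_{ij}` from
`v_{i+1,j}` to `v_{ij}` (`1 ≤ j ≤ i ≤ n`), and `Sum.inr (i - 2, j - 2)` is the horizontal arrow
`d_{ij}` from `v_{ij}` to `v_{i,j-1}` (`2 ≤ j ≤ i ≤ n + 1`). -/
abbrev Arrow (n : ℕ) : Type := Tri n ⊕ Tri n

def head {n : ℕ} : Arrow n → Vertex n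
  | Sum.inl p => ⟨(p.1.1.castSucc, p.1.2.castSucc), Fin.castSucc_le_castSucc_iff.mpr p.2⟩
  | Sum.inr p => ⟨(p.1.1.succ, p.1.2.castSucc),
      (Fin.castSucc_le_castSucc_iff.mpr p.2).trans (Fin.castSucc_lt_succ).le⟩

def tail {n : ℕ} : Arrow n → Vertex n
  | Sum.inl p => ⟨(p.1.1.succ, p.1.2.castSucc),
      (Fin.castSucc_le_castSucc_iff.mpr p.2).trans (Fin.castSucc_lt_succ).le⟩
  | Sum.inr p => ⟨(p.1.1.succ, p.1.2.succ), Fin.succ_le_succ_iff.mpr p.2⟩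

/-- Givental's variety: nonzero complex numbers on the arrows such that `σ_d σ_c = σ_c' σ_d'` for
every square of the quiver with top arrow `d`, right arrow `c`, left arrow `c'` and bottom
arrow `d'`. -/
def GivZ (n : ℕ) : Type :=
  {σ : Arrow n → ℂˣ // ∀ d c c' d' : Tri n,
    tail (Sum.inr d) = head (Sum.inl c) → head (Sum.inr d) = head (Sum.inl c') →
    tail (Sum.inl c') = head (Sum.inr d') → tail (Sum.inl c) = tail (Sum.inr d') →
    σ (Sum.inr d) * σ (Sum.inl c) = σ (Sum.inl c') * σ (Sum.inr d')}

/-- `q̃_i = c_{ii} d_{i+1,i+1}`. -/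
def qTilde {n : ℕ} (σ : GivZ n) (i : Fin n) : ℂˣ :=
  σ.1 (Sum.inl ⟨(i, i), le_refl i⟩) * σ.1 (Sum.inr ⟨(i, i), le_refl i⟩)

/-- Givental's phase function. -/
def givPhase {n : ℕ} (σ : GivZ n) : ℂ := ∑ a, (σ.1 a : ℂ)

/-! ### Groups -/

/-- The Lie algebra of the diagonal torus, as the traceless diagonal matrices. It serves for
`SL_{n+1}` and for `PSL_{n+1}`. -/
def Cartan (n : ℕ) : Submodule ℂ (Fin (n + 1) → ℂ) where
  carrier := {h | ∑ i, h i = 0}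
  add_mem' := by
    intro a b ha hb
    simp only [Set.mem_ofPred_eq, Pi.add_apply, Finset.sum_add_distrib] at *
    rw [ha, hb, add_zero]
  zero_mem' := by simp
  smul_mem' := by
    intro c a ha
    simp only [Set.mem_ofPred_eq, Pi.smul_apply, smul_eq_mul, ← Finset.mul_sum] at *
    rw [ha, mul_zero]

/-- The simply connected cover `SL_{n+1}(ℂ)` of `G^∨`. -/
abbrev SLn (n : ℕ) : Type := Matrix.SpecialLinearGroup (Fin (n + 1)) ℂ

/-- `G^∨ = PSL_{n+1}(ℂ)`, with the quotient topology. -/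
abbrev Gd (n : ℕ) : Type := Matrix.ProjectiveSpecialLinearGroup (Fin (n + 1)) ℂ

/-- The covering homomorphism `SL_{n+1} → PSL_{n+1}`. -/
def toGd {n : ℕ} : SLn n →* Gd n := QuotientGroup.mk' _

/-- The class in `PSL_{n+1}(ℂ) = PGL_{n+1}(ℂ)` of an invertible matrix. -/
def classGL {n : ℕ} (g : GL (Fin (n + 1)) ℂ) : Gd n :=
  Matrix.ProjectiveSpecialLinearGroup.isoPSLOfAlgClosed (Matrix.ProjGenLinGroup.mk g)

theorem succ_ne {n : ℕ} (i : Fin n) : i.succ ≠ i.castSucc := (Fin.castSucc_lt_succ).ne'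

/-- `x_i(t) = exp(t e_i)`, with `e_i = E_{i,i+1}`. -/
def xRoot {n : ℕ} (i : Fin n) (t : ℂ) : SLn n :=
  Matrix.SpecialLinearGroup.transvection (succ_ne i).symm t

/-- `y_i(t) = exp(t f_i)`, with `f_i = E_{i+1,i}`. -/
def yRoot {n : ℕ} (i : Fin n) (t : ℂ) : SLn n :=
  Matrix.SpecialLinearGroup.transvection (succ_ne i) t

/-- The representative `ṡ_i = x_i(1) y_i(-1) x_i(1)` of a simple reflection. -/
def sDot {n : ℕ} (i : Fin n) : SLn n := xRoot i 1 * yRoot i (-1) * xRoot i 1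

/-- The product over `k = 1, …, n` (in this order) of the products over `j = n, …, k` (in this
order) of the elements `F j k`. -/
def stdProd {n : ℕ} (F : ∀ j k : Fin n, k ≤ j → SLn n) : SLn n :=
  ((List.finRange n).map fun k =>
    ((List.finRange n).reverse.map fun j => if hkj : k ≤ j then F j k hkj else 1).prod).prod

/-- The representative `ẇ₀` of the longest element, from the reduced expression
`(n, …, 1, n, …, 2, …, n)` of `w₀`. -/
def w0Dot (n : ℕ) : SLn n := stdProd fun j _ _ => sDot j

/-- `x_c(σ) = ∏_{k=1}^{n} ∏_{j=n}^{k} x_j(σ_{c_{jk}})`. -/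
def xC {n : ℕ} (σ : Arrow n → ℂ) : SLn n :=
  stdProd fun j k hkj => xRoot j (σ (Sum.inl ⟨(j, k), hkj⟩))

/-- `x_d(σ) = ∏_{k=n}^{1} ∏_{j=1}^{k} x_{n-j+1}(σ_{d_{k+1,j+1}})`. -/
def xD {n : ℕ} (σ : Arrow n → ℂ) : SLn n :=
  ((List.finRange n).reverse.map fun k =>
    ((List.finRange n).map fun j =>
      if hjk : j ≤ k then xRoot j.rev (σ (Sum.inr ⟨(k, j), hjk⟩)) else 1).prod).prod

/-- An invertible diagonal matrix. -/
def diagGL {n : ℕ} (d : Fin (n + 1) → ℂˣ) : GL (Fin (n + 1)) ℂ where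
  val := Matrix.diagonal fun i => (d i : ℂ)
  inv := Matrix.diagonal fun i => ((d i)⁻¹ : ℂˣ)
  val_inv := by simp [Matrix.diagonal_mul_diagonal]
  inv_val := by simp [Matrix.diagonal_mul_diagonal]

/-- The matrix `diag(q̃_1 ⋯ q̃_n, …, q̃_{n-1} q̃_n, q̃_n, 1)` representing `τ(σ)`. -/
def tauGL {n : ℕ} (σ : GivZ n) : GL (Fin (n + 1)) ℂ :=
  diagGL fun m => ∏ i : Fin n, if m ≤ i.castSucc then qTilde σ i else 1

/-- `β(σ) = x_c(σ) τ(σ) ẇ₀⁻¹ x_d(-σ)⁻¹` in `PSL_{n+1}`. -/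
def beta {n : ℕ} (σ : GivZ n) : Gd n :=
  classGL (Matrix.SpecialLinearGroup.toGL (xC fun a => (σ.1 a : ℂ)) * tauGL σ *
    Matrix.SpecialLinearGroup.toGL (w0Dot n)⁻¹ *
    (Matrix.SpecialLinearGroup.toGL (xD fun a => -(σ.1 a : ℂ)))⁻¹)

/-- `exp : 𝔥^∨ → T^∨ ⊂ SL_{n+1}`, before projecting to `PSL_{n+1}`. -/
def expSL {n : ℕ} (h : Cartan n) : SLn n :=
  ⟨Matrix.diagonal fun i => Complex.exp (h.1 i), by
    rw [Matrix.det_diagonal, ← Complex.exp_sum, h.2, Complex.exp_zero]⟩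

/-- `exp : 𝔥^∨ → T^∨`. -/
def expT {n : ℕ} (h : Cartan n) : Gd n := toGd (expSL h)

/-- The lower triangular matrices of determinant one. -/
def borelSL (n : ℕ) : Subgroup (SLn n) where
  carrier := {g | ∀ i j, i < j → g i j = 0}
  one_mem' := by
    intro i j hij
    simp [hij.ne]
  mul_mem' := by
    intro a b ha hb i j hij
    rw [Matrix.SpecialLinearGroup.coe_mul, Matrix.mul_apply]
    refine Finset.sum_eq_zero fun k _ => ?_
    rcases lt_or_ge i k with hk | hk
    · rw [ha i k hk, zero_mul]
    · rw [hb k j (hk.trans_lt hij), mul_zero]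
  inv_mem' := by
    intro a ha
    have hT : Matrix.BlockTriangular (a : Matrix (Fin (n + 1)) (Fin (n + 1)) ℂ)
        OrderDual.toDual := fun i j hij => ha i j hij
    let _ : Invertible (a : Matrix (Fin (n + 1)) (Fin (n + 1)) ℂ) :=
      Matrix.invertibleOfIsUnitDet _ (by simp)
    have h2 := Matrix.blockTriangular_inv_of_blockTriangular hT
    intro i j hij
    have h3 := h2 (show OrderDual.toDual j < OrderDual.toDual i from hij)
    rw [Matrix.inv_def] at h3
    simpa [Matrix.SpecialLinearGroup.coe_inv] using h3

/-- The Borel subgroup `B^∨_-` of `G^∨`. -/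
def Bminus (n : ℕ) : Subgroup (Gd n) := (borelSL n).map toGd

/-- `B^∨_+`. -/
def Bplus (n : ℕ) : Set (Gd n) := toGd '' {g | ∀ i j, j < i → g i j = 0}

/-- `U^∨_+`. -/
def Uplus (n : ℕ) : Set (Gd n) :=
  toGd '' {g | (∀ i j, j < i → g i j = 0) ∧ ∀ i, g i i = 1}

/-- `U^∨_-`. -/
def Uminus (n : ℕ) : Set (Gd n) :=
  toGd '' {g | (∀ i j, i < j → g i j = 0) ∧ ∀ i, g i i = 1}

/-! ### The covering family `Z̃_B^{𝔥^∨}` -/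

/-- The triples `(h^∨, b, h_R)` with `b ∈ B^∨_- ∩ U^∨_+ exp(h^∨) ẇ₀⁻¹ U^∨_+` and
`b exp(-h_R) ∈ U^∨_-`, with the topology induced from `𝔥^∨ × G^∨ × 𝔥^∨`. -/
abbrev ZB (n : ℕ) : Type :=
  {z : Cartan n × Gd n × Cartan n //
    z.2.1 ∈ Bminus n ∧
    (∃ u₁ ∈ Uplus n, ∃ u₂ ∈ Uplus n, z.2.1 = u₁ * expT z.1 * toGd (w0Dot n)⁻¹ * u₂) ∧
    z.2.1 * expT (-z.2.2) ∈ Uminus n}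

/-- The fiber of `Z̃_B^{𝔥^∨}` over `h^∨`. -/
def fiberZB {n : ℕ} (h : Cartan n) : Set (ZB n) := {z | z.1.1 = h}

/-! ### The phase function `F_B` -/

/-- Functions on `(n+1) × (n+1)` matrices; `SL_{n+1}` acts by `(g φ)(x) = φ(x g)`. -/
abbrev MatFun (n : ℕ) : Type := Matrix (Fin (n + 1)) (Fin (n + 1)) ℂ → ℂ

def act {n : ℕ} (g : SLn n) (φ : MatFun n) : MatFun n :=
  fun x => φ (x * (g : Matrix (Fin (n + 1)) (Fin (n + 1)) ℂ))

/-- The product of the leading principal minors of sizes `1, …, n`: it is fixed by `U_+`, and the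
torus acts on it by the character `ρ`, the sum of the fundamental weights. -/
def vPlus (n : ℕ) : MatFun n := fun x =>
  ∏ k : Fin n, (x.submatrix (Fin.castLE (show k.val + 1 ≤ n + 1 by omega))
    (Fin.castLE (show k.val + 1 ≤ n + 1 by omega))).det

/-- The lowest weight vector with `v⁺ = ẇ₀ v⁻`. -/
def vMinus (n : ℕ) : MatFun n := act (w0Dot n)⁻¹ (vPlus n)

/-- The irreducible representation `V(ρ)` of highest weight `ρ`, generated by the highest weight
vector `vPlus`. -/
def Vrho (n : ℕ) : Submodule ℂ (MatFun n) := Submodule.span ℂ (Set.range fun g => act g (vPlus n))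

/-- The diagonal torus of `SL_{n+1}`. -/
abbrev TorusSL (n : ℕ) : Type := {t : SLn n // ∀ i j, i ≠ j → t i j = 0}

/-- The subspace of `V(ρ)` on which the torus acts by `χ`. -/
def weightSpace {n : ℕ} (χ : TorusSL n → ℂ) : Submodule ℂ (MatFun n) where
  carrier := {φ | φ ∈ Vrho n ∧ ∀ t : TorusSL n, act t.1 φ = χ t • φ}
  add_mem' := by
    rintro a b ⟨ha, ha'⟩ ⟨hb, hb'⟩
    refine ⟨add_mem ha hb, fun t => ?_⟩
    have h : act t.1 (a + b) = act t.1 a + act t.1 b := rfl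
    rw [h, ha' t, hb' t, smul_add]
  zero_mem' := ⟨zero_mem _, fun t => by rw [smul_zero]; rfl⟩
  smul_mem' := by
    rintro c a ⟨ha, ha'⟩
    refine ⟨Submodule.smul_mem _ c ha, fun t => ?_⟩
    have h : act t.1 (c • a) = c • act t.1 a := rfl
    rw [h, ha' t, smul_comm]

open Classical in
/-- The coefficient `⟨φ, w⟩` of an extremal weight vector `w` of `V(ρ)` in `φ ∈ V(ρ)`: the number
`c` such that `φ = c w +` a sum of vectors in the other weight spaces. -/
def coeff {n : ℕ} (φ w : MatFun n) : ℂ :=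
  if hc : ∃ c : ℂ, φ - c • w ∈
      ⨆ χ : TorusSL n → ℂ, ⨆ _ : w ∉ weightSpace χ, weightSpace χ
  then hc.choose else 0

/-- The action of the Lie algebra, `X φ = d/ds (exp(sX) φ)` at `s = 0`. -/
def lieAct {n : ℕ} (X : Matrix (Fin (n + 1)) (Fin (n + 1)) ℂ) (φ : MatFun n) : MatFun n :=
  fun x => deriv (fun s : ℂ => φ (x * NormedSpace.exp (s • X))) 0

/-- `f = ∑ f_i`. -/
def fSum (n : ℕ) : Matrix (Fin (n + 1)) (Fin (n + 1)) ℂ :=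
  ∑ i : Fin n, Matrix.single i.succ i.castSucc 1

/-- `F_B(h^∨, b, h_R) = (⟨f b̃ v⁺, v⁻⟩ + ⟨b̃ f v⁺, v⁻⟩) / ⟨b̃ v⁺, v⁻⟩`, where `b̃ ∈ SL_{n+1}` is a
lift of `b`. -/
def phaseB {n : ℕ} (z : ZB n) : ℂ :=
  let b : SLn n := Quotient.out z.1.2.1
  (coeff (lieAct (fSum n) (act b (vPlus n))) (vMinus n) +
    coeff (act b (lieAct (fSum n) (vPlus n))) (vMinus n)) / coeff (act b (vPlus n)) (vMinus n)

/-- The dual pairing between `𝔥` and `𝔥^∨`. -/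
def pairing {n : ℕ} (h h' : Cartan n) : ℂ := ∑ i, h.1 i * h'.1 i

/-- `φ̃(h^∨, b, h_R; h) = exp ⟨h, h_R⟩`. -/
def phiTilde {n : ℕ} (z : ZB n) (h : Cartan n) : ℂ := Complex.exp (pairing h z.1.2.2)

/-! ### The holomorphic form -/

/-- The flag variety `G^∨ / B^∨_-`. -/
abbrev Flag (n : ℕ) : Type := Gd n ⧸ Bminus n

/-- `R_{1,w₀} = (B^∨_+ B^∨_- ∩ B^∨_- ẇ₀ B^∨_-) / B^∨_-`. -/
def Rcell (n : ℕ) : Set (Flag n) :=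
  {x | (∃ g ∈ Bplus n, x = QuotientGroup.mk g) ∧
    ∃ b ∈ Bminus n, x = QuotientGroup.mk (b * toGd (w0Dot n))}

/-- Positions strictly above the diagonal. -/
abbrev Pos (n : ℕ) : Type := {p : Fin (n + 1) × Fin (n + 1) // p.1 < p.2}

/-- The upper unitriangular matrix with given entries above the diagonal. -/
def unip {n : ℕ} (a : Pos n → ℂ) : SLn n :=
  ⟨Matrix.of fun i j => if h : i < j then a ⟨(i, j), h⟩ else if i = j then 1 else 0, by
    rw [Matrix.det_of_isUpperTriangular]
    · simp
    · intro i j hij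
      have hij' : j < i := hij
      simp [hij'.not_gt, hij'.ne']⟩

/-- The affine chart `U^∨_+ ≅ ℂ^{Pos n}` of the flag variety, centred at the base point. -/
def cell {n : ℕ} (a : Pos n → ℂ) : Flag n := QuotientGroup.mk (toGd (unip a))

/-- The coordinates of a point of the big cell `B^∨_+ B^∨_- / B^∨_-`; inverse to `cell`. -/
def cellCoord {n : ℕ} (x : Flag n) : Pos n → ℂ := Function.invFun cell x

/-- `n_B`, the length of `w₀`. -/
abbrev nB (n : ℕ) : ℕ := n * (n + 1) / 2

/-- A word of length `ℓ(w₀)` in the simple transpositions whose product is `w₀`. -/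
def IsReducedW0 {n : ℕ} (w : Fin (nB n) → Fin n) : Prop :=
  (List.ofFn fun l => Equiv.swap (w l).castSucc (w l).succ).prod = Fin.revPerm

/-- The point `x_{i_1}(t_1) ⋯ x_{i_N}(t_N) B^∨_-` of the flag variety, in the coordinates of the
big cell. For `t_l ≠ 0` these points form the open Deodhar stratum of the word, with standard
coordinates `t_l`. -/
def stratumChart {n : ℕ} (w : Fin (nB n) → Fin n) (t : Fin (nB n) → ℂ) : Pos n → ℂ :=
  cellCoord (QuotientGroup.mk (toGd (List.ofFn fun l => xRoot (w l) (t l)).prod))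

/-- `ω` is a holomorphic `n_B`-form on `R_{1,w₀}` (viewed as an open subset of the affine chart)
whose restriction to the open stratum of each reduced expression `i` of `w₀` is
`ε_i ⋀ dt_l / t_l`, where `ε_i = ±1` and `ε_{i₀} = 1`. -/
def IsMirrorForm {n : ℕ} (i₀ : Fin (nB n) → Fin n)
    (ω : (Pos n → ℂ) → (Pos n → ℂ) [⋀^Fin (nB n)]→L[ℂ] ℂ) : Prop :=
  DifferentiableOn ℂ ω (cell ⁻¹' Rcell n) ∧
  ∀ w : Fin (nB n) → Fin n, IsReducedW0 w → ∃ ε : ℂ, (ε = 1 ∨ ε = -1) ∧ (w = i₀ → ε = 1) ∧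
    ∀ t : Fin (nB n) → ℂ, (∀ l, t l ≠ 0) → ∀ v : Fin (nB n) → (Fin (nB n) → ℂ),
      ω (stratumChart w t) (fun m => fderiv ℂ (stratumChart w) t (v m)) =
        ε * Matrix.det (Matrix.of fun l m => v m l / t l)

open Classical in
/-- The form `ω` on `R_{1,w₀}`. It is unique on `R_{1,w₀}`, and only its values there matter. -/
def mirrorForm {n : ℕ} (i₀ : Fin (nB n) → Fin n) :
    (Pos n → ℂ) → (Pos n → ℂ) [⋀^Fin (nB n)]→L[ℂ] ℂ :=
  if hω : ∃ ω, IsMirrorForm i₀ ω then hω.choose else 0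

/-- The map `Z̃_B^{𝔥^∨} → R_{1,w₀}`, `(h^∨, b, h_R) ↦ b ẇ₀ B^∨_-`, in the coordinates of the big
cell. -/
def toR {n : ℕ} (z : ZB n) : Pos n → ℂ :=
  cellCoord (QuotientGroup.mk (z.1.2.1 * toGd (w0Dot n)))

/-- The map `Z̃_B^{𝔥^∨} → 𝔥^∨ × R_{1,w₀}`. It is a covering of an open subset of an affine space,
and its local inverses are the holomorphic charts of `Z̃_B^{𝔥^∨}`. -/
def chartZB {n : ℕ} (z : ZB n) : Cartan n × (Pos n → ℂ) := (z.1.1, toR z)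

/-- The value at `x`, on tangent vectors `v`, of the pullback along `Φ` of the form `ω̃` on
`Z̃_B^{𝔥^∨}`; here `ω̃` is itself the pullback of `ω` along the map to `R_{1,w₀}`. -/
def pullbackForm {n : ℕ} (i₀ : Fin (nB n) → Fin n) {E : Type} [NormedAddCommGroup E]
    [NormedSpace ℂ E] (Φ : E → ZB n) (x : E) (v : Fin (nB n) → E) : ℂ :=
  mirrorForm i₀ (toR (Φ x)) fun m => fderiv ℂ (fun y => toR (Φ y)) x (v m)

/-! ### The universal cover and the comparison maps -/

/-- `Z̃ = {(T_v) : ∑ T_{v_ii} = 0}`. -/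
def Ztilde (n : ℕ) : Submodule ℂ (Vertex n → ℂ) where
  carrier := {T | ∑ i, T (diagVertex i) = 0}
  add_mem' := by
    intro a b ha hb
    simp only [Set.mem_ofPred_eq, Pi.add_apply, Finset.sum_add_distrib] at *
    rw [ha, hb, add_zero]
  zero_mem' := by simp
  smul_mem' := by
    intro c a ha
    simp only [Set.mem_ofPred_eq, Pi.smul_apply, smul_eq_mul, ← Finset.mul_sum] at *
    rw [ha, mul_zero]

/-- The fiber of `Z̃` over `(T_1, …, T_{n+1})`. -/
def fiberZtilde {n : ℕ} (h : Cartan n) : Set (Ztilde n) := {T | ∀ i, T.1 (diagVertex i) = h.1 i}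

/-- The universal covering `c : Z̃ → Z`, `(T_v) ↦ (exp(T_{h_a} - T_{t_a}))_a`. -/
def cMap {n : ℕ} (T : Ztilde n) : GivZ n :=
  ⟨fun a => Units.mk0 (Complex.exp (T.1 (head a) - T.1 (tail a))) (Complex.exp_ne_zero _), by
    intro d c c' d' h1 h2 h3 h4
    ext
    simp only [Units.val_mul, Units.val_mk0, ← Complex.exp_add, h1, h2, h3, h4]
    congr 1
    ring⟩

/-- `γ(T) = diag(T_{v_11}, …, T_{v_{n+1,n+1}})`. -/
def gamma {n : ℕ} (T : Ztilde n) : Cartan n := ⟨fun i => T.1 (diagVertex i), T.2⟩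

/-- `β̃ = β ∘ c`. -/
def betaTilde {n : ℕ} (T : Ztilde n) : Gd n := beta (cMap T)

/-- `∑_{i - j = k} T_{v_ij}`. -/
def diagSum {n : ℕ} (T : Ztilde n) (k : ℕ) : ℂ :=
  ∑ v : Vertex n, if (v.1.1 : ℕ) = v.1.2 + k then T.1 v else 0

theorem diagSum_zero {n : ℕ} (T : Ztilde n) : diagSum T 0 = 0 := by
  have hT : ∑ i, T.1 (diagVertex i) = 0 := T.2
  rw [← hT, diagSum, ← Finset.sum_filter]
  symm
  refine Finset.sum_bij (fun i _ => diagVertex i) ?_ ?_ ?_ ?_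
  · intro i _
    simp [diagVertex]
  · intro i _ j _ hij
    exact congrArg (fun v : Vertex n => v.1.1) hij
  · intro v hv
    have hv' : (v.1.1 : ℕ) = v.1.2 := by simpa using hv
    refine ⟨v.1.1, Finset.mem_univ _, Subtype.ext (Prod.ext rfl (Fin.ext hv'))⟩
  · intro i _
    rfl

theorem diagSum_top {n : ℕ} (T : Ztilde n) : diagSum T (n + 1) = 0 := by
  refine Finset.sum_eq_zero fun v _ => if_neg ?_
  have := v.1.1.2
  omega

/-- `γ_R(T)` is the diagonal matrix with entries `S_{k-1} - S_k`, `k = 1, …, n + 1`, where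
`S_k = ∑_{i - j = k} T_{v_ij}` (so `S_0 = S_{n+1} = 0`); hence the `k`-th fundamental weight takes
the value `-S_k` on it. -/
def gammaR {n : ℕ} (T : Ztilde n) : Cartan n :=
  ⟨fun m => diagSum T m - diagSum T (m + 1), by
    change ∑ m : Fin (n + 1), (diagSum T m - diagSum T (m + 1)) = 0
    rw [Fin.sum_univ_eq_sum_range (fun m => diagSum T m - diagSum T (m + 1)) (n + 1),
      Finset.sum_range_sub', diagSum_zero, diagSum_top, sub_zero]⟩

/-! ### Joe and Kim's phase function -/

/-- `λ_k`, for `1 ≤ k ≤ n + 1`. -/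
def lam {n : ℕ} (h : Cartan n) (k : ℕ) : ℂ :=
  if hk : 1 ≤ k ∧ k ≤ n + 1 then h.1 ⟨k - 1, by omega⟩ else 0

/-- The weight of the vertical arrow `c_{ij}`. -/
def weightC {n : ℕ} (h : Cartan n) (i j : ℕ) : ℂ :=
  if j = 1 then lam h i + 1 / 2 * ∑ m ∈ Finset.Ico 1 i, lam h m else 1 / 2 * lam h (i - j + 1)

/-- The weight of the horizontal arrow `d_{ij}`. -/
def weightD {n : ℕ} (h : Cartan n) (i j : ℕ) : ℂ :=
  if i = n + 1 then -lam h (n + 2 - j) - 1 / 2 * ∑ m ∈ Finset.Ico 1 (n + 2 - j), lam h m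
  else -(1 / 2 * lam h (i - j + 1))

def arrowWeight {n : ℕ} (h : Cartan n) : Arrow n → ℂ
  | Sum.inl p => weightC h (p.1.1 + 1) (p.1.2 + 1)
  | Sum.inr p => weightD h (p.1.1 + 2) (p.1.2 + 2)

/-- `F̃_JK(T; λ) = F̃(c(T)) + ∑_a λ_a (T_{h_a} - T_{t_a})`. -/
def phaseJK {n : ℕ} (T : Ztilde n) (h : Cartan n) : ℂ :=
  givPhase (cMap T) + ∑ a, arrowWeight h a * (T.1 (head a) - T.1 (tail a))

/-! ### Coverings and vertical tangent vectors -/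

/-- `f` is a (surjective) covering followed by an open embedding. -/
def IsCoveringThenOpenEmbedding {X Y : Type} [TopologicalSpace X] [TopologicalSpace Y]
    (f : X → Y) : Prop :=
  ∃ (E : Type) (_ : TopologicalSpace E) (p : X → E) (j : E → Y),
    IsCoveringMap p ∧ Function.Surjective p ∧ Topology.IsOpenEmbedding j ∧ f = j ∘ p

/-- Tangent vectors to the fibers of `Z̃`. -/
def IsVertical {n : ℕ} (v : Ztilde n) : Prop := ∀ i, v.1 (diagVertex i) = 0

end FlagMirror

end

open FlagMirror

noncomputable section

namespace FlagMirror

/-! ### Ordered products -/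

section OrderedProducts

variable {M : Type*} [Monoid M]

/-- `f 0 * f 1 * ⋯ * f (m - 1)`. -/
def ascProd (m : ℕ) (f : ℕ → M) : M := ((List.range m).map f).prod

/-- `f (m - 1) * ⋯ * f 1 * f 0`. -/
def descProd (m : ℕ) (f : ℕ → M) : M := ((List.range m).reverse.map f).prod

@[simp] theorem ascProd_zero (f : ℕ → M) : ascProd 0 f = 1 := rfl

@[simp] theorem descProd_zero (f : ℕ → M) : descProd 0 f = 1 := rfl

theorem ascProd_succ (m : ℕ) (f : ℕ → M) : ascProd (m + 1) f = ascProd m f * f m := by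
  simp [ascProd, List.range_succ]

theorem descProd_succ (m : ℕ) (f : ℕ → M) : descProd (m + 1) f = f m * descProd m f := by
  simp [descProd, List.range_succ]

theorem ascProd_congr {m : ℕ} {f g : ℕ → M} (h : ∀ k < m, f k = g k) :
    ascProd m f = ascProd m g := by
  unfold ascProd
  congr 1
  exact List.map_congr_left fun k hk => h k (List.mem_range.mp hk)

theorem descProd_congr {m : ℕ} {f g : ℕ → M} (h : ∀ k < m, f k = g k) :
    descProd m f = descProd m g := by
  unfold descProd
  congr 1
  exact List.map_congr_left fun k hk => h k (by simpa using hk)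

theorem ascProd_eq_one {m : ℕ} {f : ℕ → M} (h : ∀ k < m, f k = 1) : ascProd m f = 1 := by
  induction m with
  | zero => rfl
  | succ m ih => rw [ascProd_succ, ih fun k hk => h k (by omega), h m (by omega), one_mul]

theorem descProd_eq_one {m : ℕ} {f : ℕ → M} (h : ∀ k < m, f k = 1) : descProd m f = 1 := by
  induction m with
  | zero => rfl
  | succ m ih => rw [descProd_succ, ih fun k hk => h k (by omega), h m (by omega), one_mul]

theorem prod_map_finRange {n : ℕ} (F : Fin n → M) :
    ((List.finRange n).map F).prod = ascProd n fun m => if h : m < n then F ⟨m, h⟩ else 1 := by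
  rw [ascProd, ← List.map_coe_finRange_eq_range, List.map_map]
  congr 2
  funext i
  simp

theorem prod_map_reverse_finRange {n : ℕ} (F : Fin n → M) :
    ((List.finRange n).reverse.map F).prod =
      descProd n fun m => if h : m < n then F ⟨m, h⟩ else 1 := by
  rw [descProd, ← List.map_coe_finRange_eq_range, ← List.map_reverse, List.map_map]
  congr 2
  funext i
  simp

theorem Commute.ascProd_right {a : M} {m : ℕ} {f : ℕ → M} (h : ∀ k < m, Commute a (f k)) :
    Commute a (ascProd m f) := by
  induction m with
  | zero => exact Commute.one_right a
  | succ m ih =>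
    rw [ascProd_succ]
    exact (ih fun k hk => h k (by omega)).mul_right (h m (by omega))

theorem Commute.descProd_right {a : M} {m : ℕ} {f : ℕ → M} (h : ∀ k < m, Commute a (f k)) :
    Commute a (descProd m f) := by
  induction m with
  | zero => exact Commute.one_right a
  | succ m ih =>
    rw [descProd_succ]
    exact (h m (by omega)).mul_right (ih fun k hk => h k (by omega))

theorem ascProd_mul {m : ℕ} {a b : ℕ → M} (h : ∀ k k', k < k' → k' < m → Commute (b k) (a k')) :
    ascProd m (fun k => a k * b k) = ascProd m a * ascProd m b := by
  induction m with
  | zero => simp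
  | succ m ih =>
    rw [ascProd_succ, ascProd_succ, ascProd_succ, ih fun k k' h1 h2 => h k k' h1 (by omega)]
    have hc : Commute (ascProd m b) (a m) :=
      (Commute.ascProd_right fun k hk => (h k m hk (by omega)).symm).symm
    rw [mul_assoc, ← mul_assoc _ (a m), hc.eq]
    simp only [mul_assoc]

theorem descProd_ge {m p : ℕ} (hp : p < m) (f : ℕ → M) :
    descProd m (fun j => if p ≤ j then f j else 1) =
      descProd m (fun j => if p + 1 ≤ j then f j else 1) * f p := by
  induction m with
  | zero => omega
  | succ m ih =>
    rw [descProd_succ, descProd_succ]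
    rcases Nat.lt_or_ge p m with h | h
    · rw [ih h, if_pos h.le, if_pos (show p + 1 ≤ m from h), mul_assoc]
    · have : p = m := by omega
      subst this
      rw [if_pos le_rfl, if_neg (by omega), descProd_eq_one (fun k hk => if_neg (by omega)),
        descProd_eq_one (fun k hk => if_neg (by omega)), mul_one, one_mul, one_mul]

theorem descProd_le {m p : ℕ} (hp : p < m) (f : ℕ → M) :
    descProd m (fun j => if j ≤ p then f j else 1) =
      f p * descProd m (fun j => if j + 1 ≤ p then f j else 1) := by
  induction m with
  | zero => omega
  | succ m ih =>
    rw [descProd_succ, descProd_succ]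
    rcases Nat.lt_or_ge p m with h | h
    · rw [ih h, if_neg (by omega), if_neg (by omega), one_mul, one_mul]
    · have : p = m := by omega
      subst this
      rw [if_pos le_rfl, if_neg (by omega), one_mul]
      congr 1
      exact descProd_congr fun k hk => by rw [if_pos (by omega), if_pos (by omega)]

/-- The part of the product over `k` (increasing) and `j ≥ k` (decreasing) where `j ≥ k + r`. -/
def upperProd (n : ℕ) (G : ℕ → ℕ → M) (r : ℕ) : M :=
  ascProd n fun k => descProd n fun j => if k + r ≤ j then G j k else 1

theorem upperProd_self (n : ℕ) (G : ℕ → ℕ → M) : upperProd n G n = 1 :=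
  ascProd_eq_one fun _ _ => descProd_eq_one fun _ _ => if_neg (by omega)

theorem upperProd_step {n : ℕ} {G : ℕ → ℕ → M} {r : ℕ}
    (hG : ∀ j k j' k', j + 2 ≤ j' → Commute (G j k) (G j' k')) :
    upperProd n G r =
      upperProd n G (r + 1) * ascProd n fun k => if k + r < n then G (k + r) k else 1 := by
  unfold upperProd
  rw [← ascProd_mul]
  · refine ascProd_congr fun k hk => ?_
    by_cases h : k + r < n
    · rw [if_pos h, descProd_ge h fun j => G j k]
      rfl
    · rw [if_neg h, descProd_eq_one (fun j hj => if_neg (by omega)),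
        descProd_eq_one (fun j hj => if_neg (by omega)), one_mul]
  · intro k k' h1 h2
    refine Commute.descProd_right fun j hj => ?_
    split_ifs
    · exact hG _ _ _ _ (by omega)
    all_goals first | exact Commute.one_left _ | exact Commute.one_right _

/-- The part of the product over `k` (increasing) and `j ≤ k` (decreasing) where `j + r ≤ k`. -/
def lowerProd (n : ℕ) (H : ℕ → ℕ → M) (r : ℕ) : M :=
  ascProd n fun k => descProd n fun j => if j + r ≤ k then H k j else 1

theorem lowerProd_self (n : ℕ) (H : ℕ → ℕ → M) : lowerProd n H n = 1 :=
  ascProd_eq_one fun _ _ => descProd_eq_one fun _ _ => if_neg (by omega)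

theorem lowerProd_step {n : ℕ} {H : ℕ → ℕ → M} {r : ℕ}
    (hH : ∀ k j k' j', j + 2 ≤ j' → j' < n → Commute (H k j) (H k' j')) :
    lowerProd n H r =
      (ascProd n fun k => if r ≤ k then H k (k - r) else 1) * lowerProd n H (r + 1) := by
  unfold lowerProd
  rw [← ascProd_mul]
  · refine ascProd_congr fun k hk => ?_
    by_cases h : r ≤ k
    · rw [if_pos h]
      have h1 := descProd_le (show k - r < n by omega) fun j => H k j
      rw [descProd_congr (fun j _ => ?_), h1, descProd_congr (fun j _ => ?_)]
      · congr 1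
        exact propext (by omega)
      · congr 1
        exact propext (by omega)
    · rw [if_neg h, descProd_eq_one (fun j hj => if_neg (by omega)),
        descProd_eq_one (fun j hj => if_neg (by omega)), one_mul]
  · intro k k' h1 h2
    refine (Commute.descProd_right fun j hj => ?_).symm
    split_ifs
    · exact (hH _ _ _ _ (by omega) (by omega)).symm
    all_goals first | exact Commute.one_left _ | exact Commute.one_right _

theorem inv_ascProd {G : Type*} [Group G] (m : ℕ) (f : ℕ → G) :
    (ascProd m f)⁻¹ = descProd m fun k => (f k)⁻¹ := by
  induction m with
  | zero => simp
  | succ m ih => rw [ascProd_succ, descProd_succ, _root_.mul_inv_rev, ih]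

theorem inv_descProd {G : Type*} [Group G] (m : ℕ) (f : ℕ → G) :
    (descProd m f)⁻¹ = ascProd m fun k => (f k)⁻¹ := by
  induction m with
  | zero => simp
  | succ m ih => rw [ascProd_succ, descProd_succ, _root_.mul_inv_rev, ih]

end OrderedProducts

/-! ### Entries of products of root subgroup elements -/

/-- The matrix of an element of `SL_{n+1}`. -/
def mat {n : ℕ} (g : SLn n) : Matrix (Fin (n + 1)) (Fin (n + 1)) ℂ := g.1

theorem mat_mul {n : ℕ} (g h : SLn n) : mat (g * h) = mat g * mat h :=
  rfl

@[simp] theorem mat_one {n : ℕ} : mat (1 : SLn n) = 1 := rfl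

theorem mat_injective {n : ℕ} : Function.Injective (mat (n := n)) := Subtype.val_injective

theorem det_mat {n : ℕ} (g : SLn n) : (mat g).det = 1 := g.2

theorem mat_mul_mat_inv {n : ℕ} (g : SLn n) : mat g * mat g⁻¹ = 1 := by
  rw [← mat_mul, mul_inv_cancel, mat_one]

theorem mat_inv_mul_mat {n : ℕ} (g : SLn n) : mat g⁻¹ * mat g = 1 := by
  rw [← mat_mul, inv_mul_cancel, mat_one]

/-- Matrix entries indexed by natural numbers, extended by zero. -/
def ent {n : ℕ} (A : Matrix (Fin (n + 1)) (Fin (n + 1)) ℂ) (i j : ℕ) : ℂ :=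
  if h : i < n + 1 ∧ j < n + 1 then A ⟨i, h.1⟩ ⟨j, h.2⟩ else 0

theorem ent_val {n : ℕ} (A : Matrix (Fin (n + 1)) (Fin (n + 1)) ℂ) (i j : Fin (n + 1)) :
    ent A i j = A i j := dif_pos ⟨i.2, j.2⟩

theorem ext_ent {n : ℕ} {A B : Matrix (Fin (n + 1)) (Fin (n + 1)) ℂ}
    (h : ∀ i j, i ≤ n → j ≤ n → ent A i j = ent B i j) : A = B := by
  ext i j
  simpa [ent_val] using h i j (by omega) (by omega)

theorem ent_eq_zero {n : ℕ} (A : Matrix (Fin (n + 1)) (Fin (n + 1)) ℂ) {i j : ℕ}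
    (h : n < i ∨ n < j) : ent A i j = 0 := dif_neg (by omega)

theorem ent_one {n : ℕ} {i j : ℕ} (hi : i ≤ n) :
    ent (1 : Matrix (Fin (n + 1)) (Fin (n + 1)) ℂ) i j = if i = j then 1 else 0 := by
  unfold ent
  split_ifs with h1 h2 h3
  · subst h2
    exact Matrix.one_apply_eq _
  · exact Matrix.one_apply_ne fun h => h2 (congrArg Fin.val h)
  · omega
  · rfl

/-- `x_{m+1}(t)`, extended by `1` to all natural indices. -/
def xr (n m : ℕ) (t : ℂ) : SLn n := if h : m < n then xRoot ⟨m, h⟩ t else 1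

theorem mat_xRoot {n : ℕ} (i : Fin n) (t : ℂ) :
    mat (xRoot i t) = 1 + single i.castSucc i.succ t := rfl

theorem mat_yRoot {n : ℕ} (i : Fin n) (t : ℂ) :
    mat (yRoot i t) = 1 + single i.succ i.castSucc t := rfl

theorem ent_add {n : ℕ} (A B : Matrix (Fin (n + 1)) (Fin (n + 1)) ℂ) (i j : ℕ) :
    ent (A + B) i j = ent A i j + ent B i j := by
  unfold ent; split_ifs <;> simp

theorem ent_single_mul {n : ℕ} (a b : Fin (n + 1)) (t : ℂ)
    (A : Matrix (Fin (n + 1)) (Fin (n + 1)) ℂ) (i j : ℕ) :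
    ent (single a b t * A) i j = if i = a then t * ent A b j else 0 := by
  unfold ent
  split_ifs with h1 h2 h3 h4 h5
  · have : (⟨i, h1.1⟩ : Fin (n + 1)) = a := Fin.ext h2
    subst this
    simp
  · omega
  · rw [Matrix.single_mul_apply_of_ne]
    exact fun h => h2 (by simp [← h])
  · omega
  · simp
  · rfl

theorem ent_mul_single {n : ℕ} (a b : Fin (n + 1)) (t : ℂ)
    (A : Matrix (Fin (n + 1)) (Fin (n + 1)) ℂ) (i j : ℕ) :
    ent (A * single a b t) i j = if j = b then t * ent A i a else 0 := by
  unfold ent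
  split_ifs with h1 h2 h3 h4 h5
  · have : (⟨j, h1.2⟩ : Fin (n + 1)) = b := Fin.ext h2
    subst this
    simp [mul_comm]
  · omega
  · rw [Matrix.mul_single_apply_of_ne]
    exact fun h => h2 (by simp [← h])
  · omega
  · simp
  · rfl

theorem ent_xr_mul {n m : ℕ} (hm : m < n) (t : ℂ) (A : Matrix (Fin (n + 1)) (Fin (n + 1)) ℂ)
    (i j : ℕ) :
    ent (mat (xr n m t) * A) i j =
      ent A i j + if i = m then t * ent A (m + 1) j else 0 := by
  rw [xr, dif_pos hm, mat_xRoot, add_mul, one_mul, ent_add, ent_single_mul]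
  simp

theorem ent_mul_xr {n m : ℕ} (hm : m < n) (t : ℂ) (A : Matrix (Fin (n + 1)) (Fin (n + 1)) ℂ)
    (i j : ℕ) :
    ent (A * mat (xr n m t)) i j =
      ent A i j + if j = m + 1 then t * ent A i m else 0 := by
  rw [xr, dif_pos hm, mat_xRoot, mul_add, mul_one, ent_add, ent_mul_single]
  simp

theorem xr_of_le {n m : ℕ} (h : n ≤ m) (t : ℂ) : xr n m t = 1 := dif_neg (by omega)

theorem xr_commute {n m m' : ℕ} (h : m + 2 ≤ m') (t t' : ℂ) :
    Commute (xr n m t) (xr n m' t') := by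
  rcases Nat.lt_or_ge m' n with h1 | h1
  · refine mat_injective (ext_ent fun i j _ _ => ?_)
    have h2 : m < n := by omega
    rw [mat_mul, mat_mul, ent_mul_xr h1, ent_mul_xr h2, xr, dif_pos h2, xr, dif_pos h1, mat_xRoot, mat_xRoot]
    have key : ∀ (a b : Fin (n + 1)) (s : ℂ) (p q : ℕ), ent (single a b s) p q =
        if q = b then s * ent (1 : Matrix (Fin (n + 1)) (Fin (n + 1)) ℂ) p a else 0 := by
      intro a b s p q
      rw [← ent_mul_single, one_mul]
    simp only [ent_add, key]
    rcases Nat.lt_or_ge n i with hi | hi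
    · simp [ent_eq_zero _ (Or.inl hi)]
    · simp only [ent_one hi]
      by_cases e1 : j = m + 1 <;> by_cases e2 : j = m' + 1 <;> by_cases e3 : i = m <;>
        by_cases e4 : i = m' <;> simp [e1, e2, e3, e4] <;> split_ifs <;> first | omega | ring
  · rw [xr_of_le h1]
    exact Commute.one_right _

/-- Left multiplication by `x_r(s_0) x_{r+1}(s_1) ⋯ x_{r+m-1}(s_{m-1})` adds to each row a multiple
of the next row of the result. -/
theorem ent_ascProd_xr_mul {n r : ℕ} (s : ℕ → ℂ) (m : ℕ)
    (A : Matrix (Fin (n + 1)) (Fin (n + 1)) ℂ) (i j : ℕ) :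
    ent (mat (ascProd m fun k => xr n (k + r) (s k)) * A) i j = ent A i j +
      if r ≤ i ∧ i < r + m ∧ i < n then
        s (i - r) * ent (mat (ascProd m fun k => xr n (k + r) (s k)) * A)
          (i + 1) j
      else 0 := by
  induction m generalizing A i with
  | zero =>
    rw [if_neg (by omega)]
    simp
  | succ m ih =>
    rw [ascProd_succ, mat_mul, Matrix.mul_assoc]
    rcases Nat.lt_or_ge (m + r) n with h | h
    · rw [ih, ent_xr_mul h]
      by_cases h1 : i = m + r
      · subst h1
        rw [if_pos rfl, if_neg (by omega), if_pos (by omega), ih, if_neg (by omega),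
          ent_xr_mul h, if_neg (by omega), show m + r - r = m by omega]
        ring
      · rw [if_neg h1, add_zero]
        congr 1
        by_cases h2 : r ≤ i ∧ i < r + m ∧ i < n
        · rw [if_pos h2, if_pos (by omega)]
        · rw [if_neg h2, if_neg (by omega)]
    · rw [xr_of_le h, mat_one, Matrix.one_mul, ih]
      congr 1
      by_cases h2 : r ≤ i ∧ i < r + m ∧ i < n
      · rw [if_pos h2, if_pos (by omega)]
      · rw [if_neg h2, if_neg (by omega)]

/-- Right multiplication by `x_{n-1}(s_r) x_{n-2}(s_{r+1}) ⋯` adds to each column a multiple of the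
previous column. -/
theorem ent_mul_ascProd_xr {n r : ℕ} (s : ℕ → ℂ) (m : ℕ) (hm : m ≤ n)
    (A : Matrix (Fin (n + 1)) (Fin (n + 1)) ℂ) (i j : ℕ) :
    ent (A * mat (ascProd m fun k => if r ≤ k then xr n (n - 1 - (k - r)) (s k) else 1)) i j = ent A i j +
      if r + 1 ≤ j ∧ j ≤ n ∧ n + r - j < m then s (n + r - j) * ent A i (j - 1) else 0 := by
  induction m generalizing j with
  | zero =>
    rw [if_neg (by omega)]
    simp
  | succ m ih =>
    rw [ascProd_succ, mat_mul, ← Matrix.mul_assoc]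
    rcases Nat.lt_or_ge m r with h | h
    · rw [if_neg (by omega), mat_one, Matrix.mul_one, ih (by omega)]
      congr 1
      rw [if_neg (by omega), if_neg (by omega)]
    · rw [if_pos h, ent_mul_xr (by omega), ih (by omega), ih (by omega)]
      by_cases h1 : j = n - 1 - (m - r) + 1
      · subst h1
        rw [if_neg (by omega), if_pos rfl, if_neg (by omega), if_pos (by omega),
          show n + r - (n - 1 - (m - r) + 1) = m by omega, Nat.add_sub_cancel]
        ring
      · rw [if_neg h1, add_zero]
        congr 1
        by_cases h2 : r + 1 ≤ j ∧ j ≤ n ∧ n + r - j < m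
        · rw [if_pos h2, if_pos (by omega)]
        · rw [if_neg h2, if_neg (by omega)]

theorem stdProd_eq {n : ℕ} (F : ∀ j k : Fin n, k ≤ j → SLn n) (G : ℕ → ℕ → SLn n)
    (hG : ∀ j k : Fin n, ∀ h : k ≤ j, F j k h = G j k) : stdProd F = upperProd n G 0 := by
  unfold stdProd upperProd
  rw [prod_map_finRange]
  refine ascProd_congr fun k hk => ?_
  rw [dif_pos hk, prod_map_reverse_finRange]
  refine descProd_congr fun j hj => ?_
  rw [dif_pos hj]
  by_cases h : k ≤ j
  · rw [if_pos (by omega), dif_pos (by exact h), hG]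
  · rw [if_neg (by omega), dif_neg (by exact h)]

/-! ### The representative of the longest element -/

/-- `ṡ_{m+1}`, extended by `1` to all natural indices. -/
def sd (n m : ℕ) : SLn n := if h : m < n then sDot ⟨m, h⟩ else 1

theorem ent_mul_sd {n m : ℕ} (hm : m < n) (A : Matrix (Fin (n + 1)) (Fin (n + 1)) ℂ) (i j : ℕ) :
    ent (A * mat (sd n m)) i j =
      if j = m then -ent A i (m + 1) else if j = m + 1 then ent A i m else ent A i j := by
  rw [sd, dif_pos hm, sDot, mat_mul, mat_mul, mat_xRoot,
    mat_yRoot]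
  simp only [mul_add, mul_one, add_mul, one_mul, ← Matrix.mul_assoc, ent_add, ent_mul_single,
    Fin.val_succ, Fin.val_castSucc]
  by_cases h1 : j = m
  · subst h1
    simp
  · by_cases h2 : j = m + 1
    · subst h2
      simp
    · simp [h1, h2]

theorem ent_mul_descProd_sd {n k : ℕ} (m : ℕ) (hk : k ≤ m) (hm : m ≤ n)
    (A : Matrix (Fin (n + 1)) (Fin (n + 1)) ℂ) (i j : ℕ) :
    ent (A * mat (descProd m fun j => if k ≤ j then sd n j else 1)) i j =
      if j = k then (-1) ^ (m - k) * ent A i m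
      else if k < j ∧ j ≤ m then ent A i (j - 1) else ent A i j := by
  induction m generalizing A j with
  | zero =>
    have : k = 0 := by omega
    subst this
    by_cases h : j = 0
    · subst h
      simp
    · rw [if_neg h, if_neg (by omega)]
      simp
  | succ m ih =>
    rw [descProd_succ, mat_mul, ← Matrix.mul_assoc]
    rcases Nat.lt_or_ge m k with h | h
    · have : k = m + 1 := by omega
      subst this
      rw [if_neg (by omega), descProd_eq_one fun j hj => if_neg (by omega)]
      by_cases h : j = m + 1
      · subst h
        simp
      · rw [if_neg h, if_neg (by omega)]
        simp
    · rw [if_pos h, ih h (by omega)]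
      simp only [ent_mul_sd (show m < n by omega)]
      by_cases h1 : j = k
      · subst h1
        simp only [if_true]
        rw [show m + 1 - j = m - j + 1 by omega, pow_succ]
        ring
      · rw [if_neg h1, if_neg h1]
        by_cases h2 : k < j ∧ j ≤ m
        · rw [if_pos h2, if_neg (show j - 1 ≠ m by omega), if_neg (show j - 1 ≠ m + 1 by omega),
            if_pos (show k < j ∧ j ≤ m + 1 by omega)]
        · rw [if_neg h2]
          by_cases h3 : j = m + 1
          · subst h3
            rw [if_neg (by omega), if_pos rfl, if_pos (by omega), Nat.add_sub_cancel]
          · rw [if_neg (by omega), if_neg h3, if_neg (by omega)]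

theorem ent_ascProd_descProd_sd {n : ℕ} (k : ℕ) (hk : k ≤ n) {i j : ℕ} (hi : i ≤ n) (hj : j ≤ n) :
    ent (mat (ascProd k fun k => descProd n fun j => if k ≤ j then sd n j else 1)) i j =
      if j < k then (if i + j = n then (-1) ^ (n - j) else 0)
      else if i + k = j then 1 else 0 := by
  induction k generalizing j with
  | zero => simp [ent_one hi]
  | succ k ih =>
    rw [ascProd_succ, mat_mul, ent_mul_descProd_sd n (by omega) le_rfl]
    by_cases h1 : j = k
    · subst h1
      rw [if_pos rfl, if_pos (by omega), ih (by omega) le_rfl, if_neg (by omega)]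
      simp
    · rw [if_neg h1]
      by_cases h2 : k < j
      · rw [if_pos ⟨h2, hj⟩, if_neg (by omega), ih (by omega) (by omega), if_neg (by omega)]
        congr 1
        exact propext (by omega)
      · rw [if_neg (by omega), ih (by omega) hj, if_pos (show j < k by omega),
          if_pos (show j < k + 1 by omega)]

theorem ent_w0Dot {n i j : ℕ} (hi : i ≤ n) (hj : j ≤ n) :
    ent (mat (w0Dot n)) i j = if i + j = n then (-1) ^ i else 0 := by
  rw [w0Dot, stdProd_eq _ (fun j _ => sd n j) (fun j k h => by simp [sd]), upperProd]
  simp only [add_zero]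
  rw [ent_ascProd_descProd_sd n le_rfl hi hj]
  by_cases h : i + j = n
  · rw [if_pos h, if_pos h, show n - j = i by omega]
    by_cases h1 : j < n
    · rw [if_pos h1]
    · rw [if_neg h1, if_pos (by omega), show i = 0 by omega, pow_zero]
  · rw [if_neg h, if_neg (show ¬ i + n = j by omega)]
    simp [h]

theorem mat_w0Dot_apply {n : ℕ} (i j : Fin (n + 1)) :
    mat (w0Dot n) i j = if j = i.rev then (-1) ^ (i : ℕ) else 0 := by
  rw [← ent_val (mat (w0Dot n)) i j, ent_w0Dot (by omega) (by omega)]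
  congr 1
  rw [Fin.ext_iff, Fin.val_rev]
  exact propext (by omega)

theorem mat_w0Dot_inv (n : ℕ) :
    mat (w0Dot n)⁻¹ = (mat (w0Dot n))ᵀ := by
  have h : mat (w0Dot n) * (mat (w0Dot n))ᵀ = 1 := by
    ext i j
    simp only [Matrix.mul_apply, Matrix.transpose_apply, mat_w0Dot_apply]
    simp only [ite_mul, zero_mul, Finset.sum_ite_eq', Finset.mem_univ, if_true]
    by_cases hij : i = j
    · subst hij
      simp [← mul_pow]
    · rw [if_neg (fun h => hij (Fin.rev_injective h)), mul_zero, Matrix.one_apply_ne hij]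
  have h1 : (w0Dot n)⁻¹ = ⟨(mat (w0Dot n))ᵀ, by rw [Matrix.det_transpose, det_mat]⟩ :=
    inv_eq_of_mul_eq_one_right (Subtype.ext h)
  rw [h1]
  rfl

theorem mat_w0Dot_inv_apply {n : ℕ} (i j : Fin (n + 1)) :
    mat (w0Dot n)⁻¹ i j = if j = i.rev then (-1) ^ (j : ℕ) else 0 := by
  rw [mat_w0Dot_inv, Matrix.transpose_apply, mat_w0Dot_apply]
  congr 1
  exact propext (by rw [eq_comm, Fin.rev_eq_iff])

/-! ### Lower triangularity -/

/-- `x_c` for coefficients indexed by natural numbers. -/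
def xCNat (n : ℕ) (c : ℕ → ℕ → ℂ) : SLn n := upperProd n (fun j k => xr n j (c j k)) 0

/-- `x_d(-·)⁻¹` for coefficients indexed by natural numbers. -/
def xDNat (n : ℕ) (d : ℕ → ℕ → ℂ) : SLn n := lowerProd n (fun k j => xr n (n - 1 - j) (d k j)) 0

/-- The coordinate of the vertical arrow `(i, k)`. -/
def cWeight (T : ℕ → ℕ → ℂ) (i k : ℕ) : ℂ := Complex.exp (T i k - T (i + 1) k)

/-- The coordinate of the horizontal arrow `(k, j)`. -/
def dWeight (T : ℕ → ℕ → ℂ) (k j : ℕ) : ℂ := Complex.exp (T (k + 1) j - T (k + 1) (j + 1))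

/-- `∑_i T_{i+r,i}`. -/
def levelSum (n : ℕ) (T : ℕ → ℕ → ℂ) (r : ℕ) : ℂ := ∑ i ∈ Finset.range (n + 1 - r), T (i + r) i

/-- A matrix whose first `r` rows and columns are lower triangular with the expected diagonal, and
whose complementary block is antidiagonal. -/
structure IsPartlyReduced (n : ℕ) (T : ℕ → ℕ → ℂ) (r : ℕ)
    (A : Matrix (Fin (n + 1)) (Fin (n + 1)) ℂ) : Prop where
  above : ∀ i j, i < r → i < j → ent A i j = 0
  diag : ∀ i, i < r → ent A i i = Complex.exp (levelSum n T i - levelSum n T (i + 1))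
  anti : ∀ i j, r ≤ i → i ≤ n → r ≤ j → j ≤ n → ent A i j =
    if i + j = n + r then (-1) ^ (n - i) * Complex.exp (T i (i - r)) else 0

/-- `x_r(c_{r,0}) x_{r+1}(c_{r+1,1}) ⋯`. -/
def levelC (n : ℕ) (c : ℕ → ℕ → ℂ) (r : ℕ) : SLn n := ascProd n fun k => xr n (k + r) (c (k + r) k)

/-- `x_{n-1}(d_{r,0}) x_{n-2}(d_{r+1,1}) ⋯`. -/
def levelD (n : ℕ) (d : ℕ → ℕ → ℂ) (r : ℕ) : SLn n :=
  ascProd n fun k => if r ≤ k then xr n (n - 1 - (k - r)) (d k (k - r)) else 1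

theorem ent_levelC_mul {n r : ℕ} (c : ℕ → ℕ → ℂ) (A : Matrix (Fin (n + 1)) (Fin (n + 1)) ℂ)
    (i j : ℕ) : ent (mat (levelC n c r) * A) i j = ent A i j +
      if r ≤ i ∧ i < n then c i (i - r) * ent (mat (levelC n c r) * A) (i + 1) j else 0 := by
  rw [levelC, ent_ascProd_xr_mul]
  congr 1
  by_cases h : r ≤ i ∧ i < n
  · rw [if_pos h, if_pos (by omega), Nat.sub_add_cancel h.1]
  · rw [if_neg h, if_neg (by omega)]

theorem ent_mul_levelD {n r : ℕ} (d : ℕ → ℕ → ℂ) (A : Matrix (Fin (n + 1)) (Fin (n + 1)) ℂ)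
    (i j : ℕ) : ent (A * mat (levelD n d r)) i j = ent A i j +
      if r < j ∧ j ≤ n then d (n + r - j) (n - j) * ent A i (j - 1) else 0 := by
  rw [levelD, ent_mul_ascProd_xr (fun k => d k (k - r)) n le_rfl]
  congr 1
  by_cases h : r < j ∧ j ≤ n
  · rw [if_pos h, if_pos (by omega), show n + r - j - r = n - j by omega]
  · rw [if_neg h, if_neg (by omega)]

theorem upperProd_xr_step {n : ℕ} (c : ℕ → ℕ → ℂ) (r : ℕ) :
    upperProd n (fun j k => xr n j (c j k)) r =
      upperProd n (fun j k => xr n j (c j k)) (r + 1) * levelC n c r := by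
  rw [upperProd_step fun j k j' k' h => xr_commute h _ _, levelC]
  congr 1
  refine ascProd_congr fun k _ => ?_
  split_ifs with h
  · rfl
  · rw [xr_of_le (by omega)]

theorem lowerProd_xr_step {n : ℕ} (d : ℕ → ℕ → ℂ) (r : ℕ) :
    lowerProd n (fun k j => xr n (n - 1 - j) (d k j)) r =
      levelD n d r * lowerProd n (fun k j => xr n (n - 1 - j) (d k j)) (r + 1) :=
  lowerProd_step fun _ _ _ _ _ _ => (xr_commute (by omega) _ _).symm

theorem levelSum_sub_eq {n r : ℕ} (T : ℕ → ℕ → ℂ) (h : r ≤ n) :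
    levelSum n T r - levelSum n T (r + 1) =
      (∑ m ∈ Finset.range (n - r), (T (m + r) m - T (m + r + 1) m)) + T n (n - r) := by
  unfold levelSum
  rw [show n + 1 - r = n - r + 1 by omega, show n + 1 - (r + 1) = n - r by omega,
    Finset.sum_range_succ, Finset.sum_sub_distrib, Nat.sub_add_cancel h]
  simp only [add_assoc]
  ring

theorem IsPartlyReduced.step {n r : ℕ} {T : ℕ → ℕ → ℂ}
    {A : Matrix (Fin (n + 1)) (Fin (n + 1)) ℂ} (hA : IsPartlyReduced n T r A) (hr : r < n) :
    IsPartlyReduced n T (r + 1)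
      (mat (levelC n (cWeight T) r) * (A * mat (levelD n (dWeight T) r))) := by
  set B := A * mat (levelD n (dWeight T) r) with hB
  set N := mat (levelC n (cWeight T) r) * B with hN
  have hBe : ∀ i j, ent B i j = ent A i j +
      if r < j ∧ j ≤ n then dWeight T (n + r - j) (n - j) * ent A i (j - 1) else 0 :=
    fun i j => ent_mul_levelD _ _ _ _
  have hNe : ∀ i j, ent N i j = ent B i j +
      if r ≤ i ∧ i < n then cWeight T i (i - r) * ent N (i + 1) j else 0 :=
    fun i j => ent_levelC_mul _ _ _ _
  have hlow : ∀ i j, i < r → i ≤ j → ent N i j = ent A i j := by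
    intro i j hi hij
    rw [hNe, if_neg (by omega), add_zero, hBe]
    split_ifs with h
    · rw [hA.above i (j - 1) hi (by omega), mul_zero, add_zero]
    · rw [add_zero]
  have hB1 : ∀ i, r ≤ i → i ≤ n → ent B i r = if i = n then Complex.exp (T n (n - r)) else 0 := by
    intro i h1 h2
    rw [hBe, if_neg (by omega), add_zero, hA.anti i r h1 h2 le_rfl hr.le]
    by_cases h : i = n
    · subst h
      simp
    · rw [if_neg h, if_neg (by omega)]
  have hN1 : ∀ m i, i + m = n → r ≤ i → ent N i r = Complex.exp
      ((∑ p ∈ Finset.Ico (i - r) (n - r), (T (p + r) p - T (p + r + 1) p)) + T n (n - r)) := by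
    intro m
    induction m with
    | zero =>
      intro i h1 h2
      rw [hNe, if_neg (by omega), add_zero, hB1 i h2 (by omega), if_pos (by omega),
        show i = n by omega, Finset.Ico_self, Finset.sum_empty, zero_add]
    | succ m ih =>
      intro i h1 h2
      rw [hNe, if_pos (by omega), hB1 i h2 (by omega), if_neg (by omega), zero_add,
        ih (i + 1) (by omega) (by omega), cWeight, ← Complex.exp_add,
        Finset.sum_eq_sum_Ico_succ_bot (show i - r < n - r by omega),
        show i + 1 - r = i - r + 1 by omega, Nat.sub_add_cancel h2]
      congr 1
      ring
  have hB2 : ∀ i j, r ≤ i → i ≤ n → r < j → j ≤ n → ent B i j =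
      (if i + j = n + r then (-1) ^ (n - i) * Complex.exp (T i (i - r)) else 0) +
      if i + j = n + r + 1 then (-1) ^ (n - i) * Complex.exp (T i (i - r - 1)) else 0 := by
    intro i j h1 h2 h3 h4
    rw [hBe, if_pos ⟨h3, h4⟩, hA.anti i j h1 h2 h3.le h4,
      hA.anti i (j - 1) h1 h2 (by omega) (by omega)]
    congr 1
    by_cases h : i + j = n + r + 1
    · rw [if_pos h, if_pos (by omega), dWeight, show n + r - j + 1 = i by omega,
        show n - j = i - r - 1 by omega, show i - r - 1 + 1 = i - r by omega, mul_left_comm,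
        ← Complex.exp_add]
      congr 2
      ring
    · rw [if_neg h, if_neg (by omega), mul_zero]
  have hN2 : ∀ m i j, i + m = n → r ≤ i → r < j → j ≤ n → ent N i j =
      if i + j = n + r + 1 then (-1) ^ (n - i) * Complex.exp (T i (i - r - 1)) else 0 := by
    intro m
    induction m with
    | zero =>
      intro i j h1 h2 h3 h4
      rw [hNe, if_neg (by omega), add_zero, hB2 i j h2 (by omega) h3 h4, if_neg (by omega),
        zero_add]
    | succ m ih =>
      intro i j h1 h2 h3 h4
      rw [hNe, if_pos (by omega), hB2 i j h2 (by omega) h3 h4,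
        ih (i + 1) j (by omega) (by omega) h3 h4]
      by_cases h : i + j = n + r
      · rw [if_pos h, if_neg (by omega), if_pos (by omega), add_zero, cWeight, mul_left_comm,
          ← Complex.exp_add, show i + 1 - r - 1 = i - r by omega, sub_add_cancel,
          show n - i = n - (i + 1) + 1 by omega, pow_succ]
        ring
      · rw [if_neg h, if_neg (show ¬ i + 1 + j = n + r + 1 by omega), mul_zero, add_zero, zero_add]
  refine ⟨fun i j hi hij => ?_, fun i hi => ?_, fun i j h1 h2 h3 h4 => ?_⟩
  · rcases Nat.lt_or_ge i r with h | h
    · rw [hlow i j h hij.le, hA.above i j h hij]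
    · rcases Nat.lt_or_ge n j with h' | h'
      · exact ent_eq_zero _ (Or.inr h')
      · rw [hN2 (n - i) i j (by omega) h (by omega) h', if_neg (by omega)]
  · rcases Nat.lt_or_ge i r with h | h
    · rw [hlow i i h le_rfl, hA.diag i h]
    · have : i = r := by omega
      subst this
      rw [hN1 (n - i) i (by omega) le_rfl, levelSum_sub_eq T hr.le, Nat.sub_self,
        Finset.range_eq_Ico]
  · rw [hN2 (n - i) i j (by omega) (by omega) (by omega) h4]
    rfl

theorem exists_isPartlyReduced {n : ℕ} {T : ℕ → ℕ → ℂ}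
    {A : Matrix (Fin (n + 1)) (Fin (n + 1)) ℂ} (hA : IsPartlyReduced n T 0 A) (r : ℕ)
    (hr : r ≤ n) : ∃ B, IsPartlyReduced n T r B ∧
      mat (xCNat n (cWeight T)) * A * mat (xDNat n (dWeight T)) =
        mat (upperProd n (fun j k => xr n j (cWeight T j k)) r) * B *
          mat (lowerProd n (fun k j => xr n (n - 1 - j) (dWeight T k j)) r) := by
  induction r with
  | zero => exact ⟨A, hA, rfl⟩
  | succ r ih =>
    obtain ⟨B, hB, h⟩ := ih (by omega)
    refine ⟨_, hB.step (by omega), ?_⟩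
    rw [h, upperProd_xr_step, lowerProd_xr_step, mat_mul, mat_mul]
    simp only [Matrix.mul_assoc]

/-- `x_c diag(exp T_{ii}) ẇ₀⁻¹ x_d(-·)⁻¹` is lower triangular, with the exponentials of the
differences of the level sums on the diagonal. -/
theorem isPartlyReduced_factorization (n : ℕ) (T : ℕ → ℕ → ℂ) :
    IsPartlyReduced n T (n + 1)
      (mat (xCNat n (cWeight T)) * (diagonal (fun i : Fin (n + 1) => Complex.exp (T i i)) *
        mat (w0Dot n)⁻¹) * mat (xDNat n (dWeight T))) := by
  have h0 : IsPartlyReduced n T 0 (diagonal (fun i : Fin (n + 1) => Complex.exp (T i i)) *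
      mat (w0Dot n)⁻¹) := by
    refine ⟨fun i j h => by omega, fun i h => by omega, fun i j _ hi _ hj => ?_⟩
    have h1 := ent_val (diagonal (fun i : Fin (n + 1) => Complex.exp (T i i)) * mat (w0Dot n)⁻¹)
      ⟨i, by omega⟩ ⟨j, by omega⟩
    simp only at h1
    rw [h1, Matrix.diagonal_mul, mat_w0Dot_inv_apply]
    by_cases h : i + j = n
    · rw [if_pos (Fin.ext (by simp; omega)), if_pos (by omega), mul_comm, Nat.sub_zero]
      simp only
      rw [show n - i = j by omega]
    · rw [if_neg (fun h' => h ?_), if_neg (by omega), mul_zero]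
      have := congrArg Fin.val h'
      simp only [Fin.val_rev] at this
      omega
  obtain ⟨B, hB, h⟩ := exists_isPartlyReduced h0 n le_rfl
  rw [h, upperProd_self, lowerProd_self, mat_one, Matrix.one_mul, Matrix.mul_one]
  refine ⟨fun i j hi hij => ?_, fun i hi => ?_, fun i j hi hi' => by omega⟩
  · rcases Nat.lt_or_ge i n with h' | h'
    · exact hB.above i j h' hij
    · exact ent_eq_zero _ (Or.inr (by omega))
  · rcases Nat.lt_or_ge i n with h' | h'
    · exact hB.diag i h'
    · have : i = n := by omega
      subst this
      rw [hB.anti i i le_rfl le_rfl le_rfl le_rfl, if_pos rfl]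
      simp [levelSum]

/-! ### Superdiagonal entries -/

/-- Upper unitriangular elements of `SL_{n+1}`. -/
def upperUnipotent (n : ℕ) : Submonoid (SLn n) where
  carrier := {g | (∀ i j, j < i → mat g i j = 0) ∧ ∀ i, mat g i i = 1}
  one_mem' := ⟨fun i j h => by simp [h.ne'], fun i => by simp⟩
  mul_mem' := by
    rintro a b ⟨ha, ha'⟩ ⟨hb, hb'⟩
    refine ⟨fun i j hij => ?_, fun i => ?_⟩
    · rw [mat_mul, Matrix.mul_apply]
      refine Finset.sum_eq_zero fun k _ => ?_
      rcases lt_or_ge k i with hk | hk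
      · rw [ha i k hk, zero_mul]
      · rw [hb k j (hij.trans_le hk), mul_zero]
    · rw [mat_mul, Matrix.mul_apply, Finset.sum_eq_single i, ha' i, hb' i,
        mul_one]
      · intro k _ hk
        rcases lt_or_gt_of_ne hk with h | h
        · rw [ha i k h, zero_mul]
        · rw [hb k i h, mul_zero]
      · simp

/-- The sum of the entries just above the diagonal. -/
def superSum {n : ℕ} (g : SLn n) : ℂ := ∑ i : Fin n, mat g i.castSucc i.succ

theorem superSum_one {n : ℕ} : superSum (1 : SLn n) = 0 :=
  Finset.sum_eq_zero fun i _ => by simp [(Fin.castSucc_lt_succ (i := i)).ne]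

theorem superSum_mul {n : ℕ} {a b : SLn n} (ha : a ∈ upperUnipotent n)
    (hb : b ∈ upperUnipotent n) : superSum (a * b) = superSum a + superSum b := by
  unfold superSum
  rw [← Finset.sum_add_distrib]
  refine Finset.sum_congr rfl fun i _ => ?_
  have hlt : i.castSucc < i.succ := Fin.castSucc_lt_succ
  rw [mat_mul, Matrix.mul_apply,
    Finset.sum_eq_add_of_mem i.castSucc i.succ (Finset.mem_univ _) (Finset.mem_univ _) hlt.ne]
  · rw [ha.2, hb.2]
    ring
  · rintro k - ⟨h1, h2⟩
    rcases lt_or_gt_of_ne h1 with h | h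
    · rw [ha.1 _ _ h, zero_mul]
    · have : i.succ < k := lt_of_le_of_ne (Fin.castSucc_lt_iff_succ_le.mp h) (Ne.symm h2)
      rw [hb.1 _ _ this, mul_zero]

theorem xRoot_mem {n : ℕ} (i : Fin n) (t : ℂ) : xRoot i t ∈ upperUnipotent n := by
  have h0 := mat_xRoot i t
  have hlt : i.castSucc < i.succ := Fin.castSucc_lt_succ
  refine ⟨fun p q hpq => ?_, fun p => ?_⟩
  · rw [h0, Matrix.add_apply, Matrix.one_apply_ne hpq.ne', Matrix.single_apply_of_ne, add_zero]
    rintro ⟨rfl, rfl⟩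
    exact absurd hpq hlt.not_gt
  · rw [h0, Matrix.add_apply, Matrix.one_apply_eq, Matrix.single_apply_of_ne, add_zero]
    rintro ⟨rfl, h⟩
    exact hlt.ne' h

theorem superSum_xRoot {n : ℕ} (i : Fin n) (t : ℂ) : superSum (xRoot i t) = t := by
  have h0 := mat_xRoot i t
  unfold superSum
  rw [h0, Finset.sum_eq_single i]
  · rw [Matrix.add_apply, Matrix.one_apply_ne (Fin.castSucc_lt_succ).ne,
      Matrix.single_apply_same, zero_add]
  · intro j _ hj
    rw [Matrix.add_apply, Matrix.one_apply_ne (Fin.castSucc_lt_succ).ne,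
      Matrix.single_apply_of_ne, add_zero]
    rintro ⟨h, -⟩
    exact hj (Fin.castSucc_injective n h).symm
  · simp

theorem ascProd_mem {n : ℕ} {m : ℕ} {f : ℕ → SLn n} (h : ∀ k < m, f k ∈ upperUnipotent n) :
    ascProd m f ∈ upperUnipotent n := by
  induction m with
  | zero => exact one_mem _
  | succ m ih =>
    rw [ascProd_succ]
    exact mul_mem (ih fun k hk => h k (by omega)) (h m (by omega))

theorem descProd_mem {n : ℕ} {m : ℕ} {f : ℕ → SLn n} (h : ∀ k < m, f k ∈ upperUnipotent n) :
    descProd m f ∈ upperUnipotent n := by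
  induction m with
  | zero => exact one_mem _
  | succ m ih =>
    rw [descProd_succ]
    exact mul_mem (h m (by omega)) (ih fun k hk => h k (by omega))

theorem superSum_ascProd {n : ℕ} {m : ℕ} {f : ℕ → SLn n} (h : ∀ k < m, f k ∈ upperUnipotent n) :
    superSum (ascProd m f) = ∑ k ∈ Finset.range m, superSum (f k) := by
  induction m with
  | zero => exact superSum_one
  | succ m ih =>
    have h' : ∀ k < m, f k ∈ upperUnipotent n := fun k hk => h k (by omega)
    rw [ascProd_succ, superSum_mul (ascProd_mem h') (h m (by omega)), ih h', Finset.sum_range_succ]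

theorem superSum_descProd {n : ℕ} {m : ℕ} {f : ℕ → SLn n} (h : ∀ k < m, f k ∈ upperUnipotent n) :
    superSum (descProd m f) = ∑ k ∈ Finset.range m, superSum (f k) := by
  induction m with
  | zero => exact superSum_one
  | succ m ih =>
    have h' : ∀ k < m, f k ∈ upperUnipotent n := fun k hk => h k (by omega)
    rw [descProd_succ, superSum_mul (h m (by omega)) (descProd_mem h'), ih h',
      Finset.sum_range_succ, add_comm]

theorem xr_mem (n m : ℕ) (t : ℂ) : xr n m t ∈ upperUnipotent n := by
  unfold xr
  split_ifs
  · exact xRoot_mem _ _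
  · exact one_mem _

theorem superSum_xr {n m : ℕ} (h : m < n) (t : ℂ) : superSum (xr n m t) = t := by
  rw [xr, dif_pos h, superSum_xRoot]

theorem xCNat_mem (n : ℕ) (c : ℕ → ℕ → ℂ) : xCNat n c ∈ upperUnipotent n := by
  refine ascProd_mem fun k _ => descProd_mem fun j _ => ?_
  split_ifs
  exacts [xr_mem _ _ _, one_mem _]

theorem xDNat_mem (n : ℕ) (d : ℕ → ℕ → ℂ) : xDNat n d ∈ upperUnipotent n := by
  refine ascProd_mem fun k _ => descProd_mem fun j _ => ?_
  split_ifs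
  exacts [xr_mem _ _ _, one_mem _]

theorem superSum_ite {n : ℕ} (p : Prop) [Decidable p] (g : SLn n) :
    superSum (if p then g else 1) = if p then superSum g else 0 := by
  split_ifs
  exacts [rfl, superSum_one]

theorem superSum_xCNat (n : ℕ) (c : ℕ → ℕ → ℂ) : superSum (xCNat n c) =
    ∑ k ∈ Finset.range n, ∑ j ∈ Finset.range n, if k ≤ j then c j k else 0 := by
  have hm : ∀ k j, (if k + 0 ≤ j then xr n j (c j k) else 1) ∈ upperUnipotent n := by
    intro k j
    split_ifs
    exacts [xr_mem _ _ _, one_mem _]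
  rw [xCNat, upperProd, superSum_ascProd fun k _ => descProd_mem fun j _ => hm k j]
  refine Finset.sum_congr rfl fun k _ => ?_
  rw [superSum_descProd fun j _ => hm k j]
  refine Finset.sum_congr rfl fun j hj => ?_
  rw [superSum_ite, superSum_xr (Finset.mem_range.mp hj), add_zero]

theorem superSum_xDNat (n : ℕ) (d : ℕ → ℕ → ℂ) : superSum (xDNat n d) =
    ∑ k ∈ Finset.range n, ∑ j ∈ Finset.range n, if j ≤ k then d k j else 0 := by
  have hm : ∀ k j, (if j + 0 ≤ k then xr n (n - 1 - j) (d k j) else 1) ∈ upperUnipotent n := by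
    intro k j
    split_ifs
    exacts [xr_mem _ _ _, one_mem _]
  rw [xDNat, lowerProd, superSum_ascProd fun k _ => descProd_mem fun j _ => hm k j]
  refine Finset.sum_congr rfl fun k hk => ?_
  rw [superSum_descProd fun j _ => hm k j]
  refine Finset.sum_congr rfl fun j hj => ?_
  have := Finset.mem_range.mp hk
  rw [superSum_ite, superSum_xr (by omega), add_zero]

/-! ### The comparison map -/

/-- The coordinates `T_v`, indexed by pairs of natural numbers and extended by zero. -/
def tExt {n : ℕ} (T : Ztilde n) (i j : ℕ) : ℂ :=
  if h : i < n + 1 ∧ j ≤ i then T.1 ⟨(⟨i, h.1⟩, ⟨j, by omega⟩), h.2⟩ else 0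

theorem tExt_eq {n : ℕ} (T : Ztilde n) (v : Vertex n) : tExt T v.1.1 v.1.2 = T.1 v :=
  dif_pos ⟨v.1.1.2, v.2⟩

theorem cMap_inl {n : ℕ} (T : Ztilde n) (p : Tri n) :
    ((cMap T).1 (Sum.inl p) : ℂ) = cWeight (tExt T) p.1.1 p.1.2 := by
  change Complex.exp (T.1 (head (Sum.inl p)) - T.1 (tail (Sum.inl p))) = _
  rw [cWeight, ← tExt_eq, ← tExt_eq]
  rfl

theorem cMap_inr {n : ℕ} (T : Ztilde n) (p : Tri n) :
    ((cMap T).1 (Sum.inr p) : ℂ) = dWeight (tExt T) p.1.1 p.1.2 := by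
  change Complex.exp (T.1 (head (Sum.inr p)) - T.1 (tail (Sum.inr p))) = _
  rw [dWeight, ← tExt_eq, ← tExt_eq]
  rfl

theorem xC_eq {n : ℕ} (σ : Arrow n → ℂ) (c : ℕ → ℕ → ℂ)
    (h : ∀ p : Tri n, σ (Sum.inl p) = c p.1.1 p.1.2) : xC σ = xCNat n c := by
  refine stdProd_eq _ _ fun j k hjk => ?_
  rw [h, xr, dif_pos j.2]

theorem inv_xD_eq {n : ℕ} (σ : Arrow n → ℂ) (d : ℕ → ℕ → ℂ)
    (h : ∀ p : Tri n, σ (Sum.inr p) = d p.1.1 p.1.2) :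
    (xD fun a => -σ a)⁻¹ = xDNat n d := by
  rw [xD, prod_map_reverse_finRange, inv_descProd, xDNat, lowerProd]
  refine ascProd_congr fun k hk => ?_
  rw [dif_pos hk, prod_map_finRange, inv_ascProd]
  refine descProd_congr fun j hj => ?_
  rw [dif_pos hj]
  by_cases hjk : j ≤ k
  · rw [dif_pos (by exact hjk), if_pos (by omega), h, xr, dif_pos (by omega)]
    simp only [xRoot]
    rw [SpecialLinearGroup.transvection_inv, neg_neg]
    have : (⟨j, hj⟩ : Fin n).rev = ⟨n - 1 - j, by omega⟩ := Fin.ext (by simp; omega)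
    rw [this]
  · rw [dif_neg (by exact hjk), if_neg (by omega), inv_one]

theorem classGL_mul {n : ℕ} (g h : GL (Fin (n + 1)) ℂ) :
    classGL (g * h) = classGL g * classGL h := by
  simp [classGL]

theorem classGL_toGL {n : ℕ} (g : SLn n) : classGL (SpecialLinearGroup.toGL g) = toGd g := by
  unfold classGL ProjectiveSpecialLinearGroup.isoPSLOfAlgClosed
  rw [dif_pos ⟨0⟩]
  unfold ProjectiveSpecialLinearGroup.isoPSLOfAlgClosedOfNonempty
  rw [MulEquiv.symm_apply_eq]
  rfl

theorem classGL_scalar {n : ℕ} (r : ℂˣ) :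
    classGL (GeneralLinearGroup.scalar (Fin (n + 1)) r) = 1 := by
  unfold classGL
  have : ProjGenLinGroup.mk (GeneralLinearGroup.scalar (Fin (n + 1)) r) = 1 := by
    rw [← map_one ProjGenLinGroup.mk, ProjGenLinGroup.mk_eq_mk_iff]
    exact ⟨r⁻¹, by rw [← map_mul]; simp⟩
  rw [this, map_one]

theorem sum_telescope_ge (t : ℕ → ℂ) {m n : ℕ} (h : m ≤ n) :
    (∑ i ∈ Finset.range n, if m ≤ i then t i - t (i + 1) else 0) = t m - t n := by
  induction n with
  | zero =>
    have : m = 0 := by omega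
    subst this
    simp
  | succ n ih =>
    rw [Finset.sum_range_succ]
    rcases Nat.lt_or_ge n m with h' | h'
    · have : m = n + 1 := by omega
      subst this
      rw [if_neg (by omega), Finset.sum_eq_zero]
      · simp
      · intro i hi
        rw [if_neg]
        have := Finset.mem_range.mp hi
        omega
    · rw [ih h', if_pos h']
      ring

theorem tauGL_cMap {n : ℕ} (T : Ztilde n) : tauGL (cMap T) =
    GeneralLinearGroup.scalar (Fin (n + 1))
      (Units.mk0 (Complex.exp (-tExt T n n)) (Complex.exp_ne_zero _)) *
        SpecialLinearGroup.toGL (expSL (gamma T)) := by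
  ext i j
  have h1 : ((tauGL (cMap T) : GL (Fin (n + 1)) ℂ) : Matrix _ _ ℂ) = Matrix.diagonal fun m =>
      ((∏ i : Fin n, if m ≤ i.castSucc then qTilde (cMap T) i else 1 : ℂˣ) : ℂ) := rfl
  have h2 : ∀ m : Fin (n + 1),
      ((∏ i : Fin n, if m ≤ i.castSucc then qTilde (cMap T) i else 1 : ℂˣ) : ℂ) =
        Complex.exp (-tExt T n n) * Complex.exp ((gamma T).1 m) := by
    intro m
    rw [Units.coe_prod, ← Complex.exp_add]
    have h3 : ∀ i : Fin n, ((if m ≤ i.castSucc then qTilde (cMap T) i else 1 : ℂˣ) : ℂ) =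
        Complex.exp (if (m : ℕ) ≤ i then tExt T i i - tExt T (i + 1) (i + 1) else 0) := by
      intro i
      by_cases h : m ≤ i.castSucc
      · rw [if_pos h, if_pos (by exact h), qTilde, Units.val_mul, cMap_inl, cMap_inr, cWeight,
          dWeight, ← Complex.exp_add]
        congr 1
        simp only
        ring
      · rw [if_neg h, if_neg (by exact h), Complex.exp_zero, Units.val_one]
    rw [Finset.prod_congr rfl fun i _ => h3 i, ← Complex.exp_sum,
      Fin.sum_univ_eq_sum_range (fun i => if (m : ℕ) ≤ i then tExt T i i - tExt T (i + 1) (i + 1)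
        else 0), sum_telescope_ge (fun i => tExt T i i) (by omega)]
    congr 1
    rw [show (gamma T).1 m = tExt T m m from (tExt_eq T (diagVertex m)).symm]
    ring
  rw [h1, Units.val_mul, GeneralLinearGroup.coe_scalar]
  change _ = (Matrix.scalar (Fin (n + 1)) (Complex.exp (-tExt T n n)) *
    Matrix.diagonal fun i => Complex.exp ((gamma T).1 i)) i j
  rw [Matrix.scalar_apply, Matrix.diagonal_mul_diagonal]
  simp only [h2]

/-- The lift of `β̃(T)` to `SL_{n+1}`. -/
def betaSL {n : ℕ} (T : Ztilde n) : SLn n :=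
  xCNat n (cWeight (tExt T)) * expSL (gamma T) * (w0Dot n)⁻¹ * xDNat n (dWeight (tExt T))

theorem betaTilde_eq {n : ℕ} (T : Ztilde n) : betaTilde T = toGd (betaSL T) := by
  rw [betaTilde, beta, tauGL_cMap, ← map_inv, inv_xD_eq _ _ (cMap_inr T),
    xC_eq _ _ (cMap_inl T)]
  simp only [classGL_mul, classGL_toGL, classGL_scalar, one_mul, betaSL, map_mul]

theorem levelSum_tExt {n : ℕ} (T : Ztilde n) (k : ℕ) : levelSum n (tExt T) k = diagSum T k := by
  rw [levelSum, diagSum, ← Finset.sum_filter]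
  refine Finset.sum_bij (fun i hi => ⟨(⟨i + k, ?_⟩, ⟨i, ?_⟩), ?_⟩) ?_ ?_ ?_ ?_
  · have := Finset.mem_range.mp hi
    omega
  · have := Finset.mem_range.mp hi
    omega
  · exact Nat.le_add_right i k
  · intro i hi
    simp
  · intro i hi j hj h
    exact congrArg (fun v : Vertex n => (v.1.2 : ℕ)) h
  · intro v hv
    have hv' : (v.1.1 : ℕ) = v.1.2 + k := by simpa using hv
    refine ⟨v.1.2, Finset.mem_range.mpr (by omega), Subtype.ext (Prod.ext (Fin.ext ?_) rfl)⟩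
    exact hv'.symm
  · intro i hi
    have := Finset.mem_range.mp hi
    exact dif_pos ⟨by omega, by omega⟩

theorem mat_expSL {n : ℕ} (h : Cartan n) :
    mat (expSL h) = Matrix.diagonal fun i => Complex.exp (h.1 i) := rfl

theorem mat_betaSL_isPartlyReduced {n : ℕ} (T : Ztilde n) :
    IsPartlyReduced n (tExt T) (n + 1) (mat (betaSL T)) := by
  have h := isPartlyReduced_factorization n (tExt T)
  have h2 : (fun i : Fin (n + 1) => Complex.exp (tExt T i i)) =
      fun i => Complex.exp ((gamma T).1 i) := by
    funext i
    rw [show (gamma T).1 i = tExt T i i from (tExt_eq T (diagVertex i)).symm]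
  rw [h2, ← mat_expSL, ← mat_mul, ← mat_mul, ← mat_mul, ← mul_assoc] at h
  exact h

theorem mat_betaSL_of_lt {n : ℕ} (T : Ztilde n) {i j : Fin (n + 1)} (h : i < j) :
    mat (betaSL T) i j = 0 := by
  rw [← ent_val (mat (betaSL T)) i j]
  exact (mat_betaSL_isPartlyReduced T).above i j i.2 h

theorem mat_betaSL_diag {n : ℕ} (T : Ztilde n) (i : Fin (n + 1)) :
    mat (betaSL T) i i = Complex.exp ((gammaR T).1 i) := by
  rw [← ent_val (mat (betaSL T)) i i, (mat_betaSL_isPartlyReduced T).diag i i.2, levelSum_tExt,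
    levelSum_tExt]
  rfl

theorem mem_ZB {n : ℕ} (T : Ztilde n) : betaTilde T ∈ Bminus n ∧
    (∃ u₁ ∈ Uplus n, ∃ u₂ ∈ Uplus n,
      betaTilde T = u₁ * expT (gamma T) * toGd (w0Dot n)⁻¹ * u₂) ∧
    betaTilde T * expT (-gammaR T) ∈ Uminus n := by
  rw [betaTilde_eq]
  refine ⟨⟨betaSL T, fun i j h => mat_betaSL_of_lt T h, rfl⟩,
    ⟨toGd (xCNat n (cWeight (tExt T))), ⟨_, xCNat_mem _ _, rfl⟩,
      toGd (xDNat n (dWeight (tExt T))), ⟨_, xDNat_mem _ _, rfl⟩, ?_⟩,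
    ⟨betaSL T * expSL (-gammaR T), ⟨fun i j h => ?_, fun i => ?_⟩, ?_⟩⟩
  · simp only [betaSL, map_mul, expT]
  · change mat (betaSL T * expSL (-gammaR T)) i j = 0
    rw [mat_mul, mat_expSL, Matrix.mul_diagonal, mat_betaSL_of_lt T h, zero_mul]
  · change mat (betaSL T * expSL (-gammaR T)) i i = 1
    rw [mat_mul, mat_expSL, Matrix.mul_diagonal, mat_betaSL_diag, ← Complex.exp_add]
    simp
  · simp only [map_mul, expT]

/-- The map `(γ, β̃, γ_R)`. -/
def phiMap {n : ℕ} (T : Ztilde n) : ZB n := ⟨(gamma T, betaTilde T, gammaR T), mem_ZB T⟩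

/-! ### Leading minors -/

/-- The leading block of size `k + 1`. -/
def lead {n : ℕ} (k : Fin n) (x : Matrix (Fin (n + 1)) (Fin (n + 1)) ℂ) :
    Matrix (Fin (k.val + 1)) (Fin (k.val + 1)) ℂ :=
  x.submatrix (Fin.castLE (show k.val + 1 ≤ n + 1 by omega))
    (Fin.castLE (show k.val + 1 ≤ n + 1 by omega))

theorem vPlus_eq {n : ℕ} (x : Matrix (Fin (n + 1)) (Fin (n + 1)) ℂ) :
    vPlus n x = ∏ k : Fin n, (lead k x).det := rfl

theorem lead_lower_mul {n : ℕ} (k : Fin n) {l : Matrix (Fin (n + 1)) (Fin (n + 1)) ℂ}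
    (hl : ∀ i j, i < j → l i j = 0) (x : Matrix (Fin (n + 1)) (Fin (n + 1)) ℂ) :
    lead k (l * x) = lead k l * lead k x := by
  ext i j
  simp only [lead, Matrix.submatrix_apply, Matrix.mul_apply]
  symm
  refine Fintype.sum_of_injective (Fin.castLE _) (Fin.castLE_injective _) _ _ ?_ fun _ => rfl
  intro a ha
  rw [hl, zero_mul]
  by_contra h
  refine ha ⟨⟨a, ?_⟩, rfl⟩
  have h1 : (a : ℕ) ≤ i := Fin.le_def.mp (not_lt.mp h)
  omega

theorem lead_mul_upper {n : ℕ} (k : Fin n) {u : Matrix (Fin (n + 1)) (Fin (n + 1)) ℂ}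
    (hu : ∀ i j, j < i → u i j = 0) (x : Matrix (Fin (n + 1)) (Fin (n + 1)) ℂ) :
    lead k (x * u) = lead k x * lead k u := by
  ext i j
  simp only [lead, Matrix.submatrix_apply, Matrix.mul_apply]
  symm
  refine Fintype.sum_of_injective (Fin.castLE _) (Fin.castLE_injective _) _ _ ?_ fun _ => rfl
  intro a ha
  rw [hu, mul_zero]
  by_contra h
  refine ha ⟨⟨a, ?_⟩, rfl⟩
  have h1 : (a : ℕ) ≤ j := Fin.le_def.mp (not_lt.mp h)
  omega

theorem vPlus_lower_mul {n : ℕ} {l : Matrix (Fin (n + 1)) (Fin (n + 1)) ℂ}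
    (hl : ∀ i j, i < j → l i j = 0) (x : Matrix (Fin (n + 1)) (Fin (n + 1)) ℂ) :
    vPlus n (l * x) = vPlus n l * vPlus n x := by
  simp only [vPlus_eq, lead_lower_mul _ hl, Matrix.det_mul, Finset.prod_mul_distrib]

theorem vPlus_mul_upper {n : ℕ} {u : Matrix (Fin (n + 1)) (Fin (n + 1)) ℂ}
    (hu : ∀ i j, j < i → u i j = 0) (x : Matrix (Fin (n + 1)) (Fin (n + 1)) ℂ) :
    vPlus n (x * u) = vPlus n x * vPlus n u := by
  simp only [vPlus_eq, lead_mul_upper _ hu, Matrix.det_mul, Finset.prod_mul_distrib]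

theorem vPlus_lower {n : ℕ} {l : Matrix (Fin (n + 1)) (Fin (n + 1)) ℂ}
    (hl : ∀ i j, i < j → l i j = 0) :
    vPlus n l = ∏ k : Fin n, ∏ i : Fin (k.val + 1),
      l (Fin.castLE (show k.val + 1 ≤ n + 1 by omega) i)
        (Fin.castLE (show k.val + 1 ≤ n + 1 by omega) i) := by
  refine Finset.prod_congr rfl fun k _ => ?_
  exact Matrix.det_of_isLowerTriangular _ fun i j hij => hl _ _ hij

theorem vPlus_upper {n : ℕ} {u : Matrix (Fin (n + 1)) (Fin (n + 1)) ℂ}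
    (hu : ∀ i j, j < i → u i j = 0) :
    vPlus n u = ∏ k : Fin n, ∏ i : Fin (k.val + 1),
      u (Fin.castLE (show k.val + 1 ≤ n + 1 by omega) i)
        (Fin.castLE (show k.val + 1 ≤ n + 1 by omega) i) := by
  refine Finset.prod_congr rfl fun k _ => ?_
  exact Matrix.det_of_isUpperTriangular fun i j hij => hu _ _ hij

theorem vPlus_lower_ne_zero {n : ℕ} {l : Matrix (Fin (n + 1)) (Fin (n + 1)) ℂ}
    (hl : ∀ i j, i < j → l i j = 0) (hd : ∀ i, l i i ≠ 0) : vPlus n l ≠ 0 := by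
  rw [vPlus_lower hl]
  exact Finset.prod_ne_zero_iff.mpr fun k _ => Finset.prod_ne_zero_iff.mpr fun i _ => hd _

theorem vPlus_upper_ne_zero {n : ℕ} {u : Matrix (Fin (n + 1)) (Fin (n + 1)) ℂ}
    (hu : ∀ i j, j < i → u i j = 0) (hd : ∀ i, u i i ≠ 0) : vPlus n u ≠ 0 := by
  rw [vPlus_upper hu]
  exact Finset.prod_ne_zero_iff.mpr fun k _ => Finset.prod_ne_zero_iff.mpr fun i _ => hd _

theorem vPlus_upper_eq_one {n : ℕ} {u : Matrix (Fin (n + 1)) (Fin (n + 1)) ℂ}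
    (hu : ∀ i j, j < i → u i j = 0) (hd : ∀ i, u i i = 1) : vPlus n u = 1 := by
  rw [vPlus_upper hu]
  exact Finset.prod_eq_one fun k _ => Finset.prod_eq_one fun i _ => hd _

theorem vPlus_lower_eq_one {n : ℕ} {l : Matrix (Fin (n + 1)) (Fin (n + 1)) ℂ}
    (hl : ∀ i j, i < j → l i j = 0) (hd : ∀ i, l i i = 1) : vPlus n l = 1 := by
  rw [vPlus_lower hl]
  exact Finset.prod_eq_one fun k _ => Finset.prod_eq_one fun i _ => hd _

/-! ### Conjugation by the longest element -/

theorem w0_conj_apply {n : ℕ} (A : Matrix (Fin (n + 1)) (Fin (n + 1)) ℂ) (i j : Fin (n + 1)) :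
    (mat (w0Dot n) * A * mat (w0Dot n)⁻¹) i j =
      (-1) ^ (i : ℕ) * (-1) ^ (j : ℕ) * A i.rev j.rev := by
  rw [Matrix.mul_apply, Finset.sum_eq_single j.rev, Matrix.mul_apply, Finset.sum_eq_single i.rev,
    mat_w0Dot_apply, mat_w0Dot_inv_apply, if_pos rfl, if_pos (Fin.rev_rev j).symm]
  · ring
  · intro b _ hb
    rw [mat_w0Dot_apply, if_neg hb, zero_mul]
  · simp
  · intro b _ hb
    rw [mat_w0Dot_inv_apply, if_neg (fun h => hb (by rw [h, Fin.rev_rev])), mul_zero]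
  · simp

theorem w0_inv_conj_apply {n : ℕ} (A : Matrix (Fin (n + 1)) (Fin (n + 1)) ℂ) (i j : Fin (n + 1)) :
    (mat (w0Dot n)⁻¹ * A * mat (w0Dot n)) i j =
      (-1) ^ (i.rev : ℕ) * (-1) ^ (j.rev : ℕ) * A i.rev j.rev := by
  rw [Matrix.mul_apply, Finset.sum_eq_single j.rev, Matrix.mul_apply, Finset.sum_eq_single i.rev,
    mat_w0Dot_apply, mat_w0Dot_inv_apply, if_pos rfl, if_pos (Fin.rev_rev j).symm]
  · ring
  · intro b _ hb
    rw [mat_w0Dot_inv_apply, if_neg hb, zero_mul]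
  · simp
  · intro b _ hb
    rw [mat_w0Dot_apply, if_neg (fun h => hb (by rw [h, Fin.rev_rev])), mul_zero]
  · simp

theorem w0_conj_lower {n : ℕ} {A : Matrix (Fin (n + 1)) (Fin (n + 1)) ℂ}
    (hA : ∀ i j, j < i → A i j = 0) (i j : Fin (n + 1)) (h : i < j) :
    (mat (w0Dot n) * A * mat (w0Dot n)⁻¹) i j = 0 := by
  rw [w0_conj_apply, hA _ _ (Fin.rev_lt_rev.mpr h), mul_zero]

theorem w0_conj_upper {n : ℕ} {A : Matrix (Fin (n + 1)) (Fin (n + 1)) ℂ}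
    (hA : ∀ i j, i < j → A i j = 0) (i j : Fin (n + 1)) (h : j < i) :
    (mat (w0Dot n) * A * mat (w0Dot n)⁻¹) i j = 0 := by
  rw [w0_conj_apply, hA _ _ (Fin.rev_lt_rev.mpr h), mul_zero]

theorem w0_inv_conj_lower {n : ℕ} {A : Matrix (Fin (n + 1)) (Fin (n + 1)) ℂ}
    (hA : ∀ i j, j < i → A i j = 0) (i j : Fin (n + 1)) (h : i < j) :
    (mat (w0Dot n)⁻¹ * A * mat (w0Dot n)) i j = 0 := by
  rw [w0_inv_conj_apply, hA _ _ (Fin.rev_lt_rev.mpr h), mul_zero]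

theorem w0_conj_diag {n : ℕ} (A : Matrix (Fin (n + 1)) (Fin (n + 1)) ℂ) (i : Fin (n + 1)) :
    (mat (w0Dot n) * A * mat (w0Dot n)⁻¹) i i = A i.rev i.rev := by
  rw [w0_conj_apply, ← mul_pow]
  simp

/-! ### Polynomial functions on matrices -/

/-- The matrix coordinates. -/
def coord {n : ℕ} (p : Fin (n + 1) × Fin (n + 1)) : MatFun n := fun x => x p.1 p.2

/-- Polynomial functions on matrices. -/
def polyFun (n : ℕ) : Subalgebra ℂ (MatFun n) := Algebra.adjoin ℂ (Set.range coord)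

theorem coord_mem {n : ℕ} (p : Fin (n + 1) × Fin (n + 1)) : coord p ∈ polyFun n :=
  Algebra.subset_adjoin ⟨p, rfl⟩

theorem vPlus_mem_polyFun (n : ℕ) : vPlus n ∈ polyFun n := by
  have h : vPlus n = ∏ k : Fin n, (Matrix.of fun i j => coord
      ((Fin.castLE (show k.val + 1 ≤ n + 1 by omega) i),
        (Fin.castLE (show k.val + 1 ≤ n + 1 by omega) j)) :
        Matrix (Fin (k.val + 1)) (Fin (k.val + 1)) (MatFun n)).det := by
    funext x
    rw [vPlus, Finset.prod_apply]
    refine Finset.prod_congr rfl fun k _ => ?_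
    rw [Matrix.det_apply, Matrix.det_apply, Finset.sum_apply]
    refine Finset.sum_congr rfl fun τ _ => ?_
    rw [Pi.smul_apply, Finset.prod_apply]
    rfl
  rw [h]
  refine Subalgebra.prod_mem _ fun k _ => ?_
  rw [Matrix.det_apply]
  refine Subalgebra.sum_mem _ fun τ _ => ?_
  have hp : (∏ i, (Matrix.of fun i j => coord
      ((Fin.castLE (show k.val + 1 ≤ n + 1 by omega) i),
        (Fin.castLE (show k.val + 1 ≤ n + 1 by omega) j)) :
        Matrix (Fin (k.val + 1)) (Fin (k.val + 1)) (MatFun n)) (τ i) i) ∈ polyFun n :=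
    Subalgebra.prod_mem _ fun i _ => coord_mem _
  rcases Int.units_eq_one_or (Equiv.Perm.sign τ) with h' | h'
  · rw [h', one_smul]
    exact hp
  · rw [h', Units.neg_smul, one_smul]
    exact neg_mem hp

/-- Right translation, as an algebra homomorphism. -/
def actHom {n : ℕ} (g : SLn n) : MatFun n →ₐ[ℂ] MatFun n where
  toFun := act g
  map_one' := rfl
  map_mul' _ _ := rfl
  map_zero' := rfl
  map_add' _ _ := rfl
  commutes' _ := rfl

theorem actHom_apply {n : ℕ} (g : SLn n) (φ : MatFun n) : actHom g φ = act g φ := rfl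

theorem act_apply {n : ℕ} (g : SLn n) (φ : MatFun n)
    (x : Matrix (Fin (n + 1)) (Fin (n + 1)) ℂ) : act g φ x = φ (x * mat g) := rfl

theorem act_coord {n : ℕ} (g : SLn n) (p : Fin (n + 1) × Fin (n + 1)) :
    act g (coord p) = ∑ k, mat g k p.2 • coord (p.1, k) := by
  funext x
  rw [act_apply, Finset.sum_apply]
  simp only [coord, Matrix.mul_apply, Pi.smul_apply, smul_eq_mul, mul_comm]

theorem act_act {n : ℕ} (g h : SLn n) (φ : MatFun n) : act g (act h φ) = act (g * h) φ := by
  funext x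
  simp only [act_apply, mat_mul, Matrix.mul_assoc]

/-- The span of the constants and the coordinates. -/
def affineFun (n : ℕ) : Submodule ℂ (MatFun n) :=
  Submodule.span ℂ (insert 1 (Set.range coord))

theorem exists_mem_affineFun_pow {n : ℕ} {φ : MatFun n} (h : φ ∈ polyFun n) :
    ∃ N, φ ∈ affineFun n ^ N := by
  have h1 : (1 : Submodule ℂ (MatFun n)) ≤ affineFun n := by
    rw [Submodule.one_le]
    exact Submodule.subset_span (Set.mem_insert _ _)
  have hmono : ∀ a b : ℕ, a ≤ b → affineFun n ^ a ≤ affineFun n ^ b :=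
    fun a b hab => pow_le_pow_right' h1 hab
  induction h using Algebra.adjoin_induction with
  | mem x hx => exact ⟨1, by
      rw [pow_one]
      exact Submodule.subset_span (Set.mem_insert_of_mem _ hx)⟩
  | algebraMap r => exact ⟨0, by
      rw [pow_zero]
      exact Submodule.mem_one.mpr ⟨r, rfl⟩⟩
  | add x y _ _ hx hy =>
    obtain ⟨a, ha⟩ := hx
    obtain ⟨b, hb⟩ := hy
    exact ⟨max a b, add_mem (hmono _ _ (le_max_left _ _) ha) (hmono _ _ (le_max_right _ _) hb)⟩
  | mul x y _ _ hx hy =>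
    obtain ⟨a, ha⟩ := hx
    obtain ⟨b, hb⟩ := hy
    exact ⟨a + b, by
      rw [pow_add]
      exact Submodule.mul_mem_mul ha hb⟩

theorem map_actHom_affineFun_pow_le {n : ℕ} (g : SLn n) (N : ℕ) :
    (affineFun n ^ N).map (actHom g).toLinearMap ≤ affineFun n ^ N := by
  rw [Submodule.map_pow]
  refine pow_le_pow_left' ?_ N
  rw [affineFun, Submodule.map_span_le]
  rintro φ (rfl | ⟨p, rfl⟩)
  · exact Submodule.subset_span (Set.mem_insert _ _)
  · change act g (coord p) ∈ _
    rw [act_coord]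
    exact Submodule.sum_mem _ fun k _ => Submodule.smul_mem _ _
      (Submodule.subset_span (Set.mem_insert_of_mem _ ⟨_, rfl⟩))

theorem act_mem_polyFun {n : ℕ} (g : SLn n) {φ : MatFun n} (h : φ ∈ polyFun n) :
    act g φ ∈ polyFun n := by
  rw [← actHom_apply]
  have : (polyFun n).map (actHom g) ≤ polyFun n := by
    rw [polyFun, AlgHom.map_adjoin, Algebra.adjoin_le_iff]
    rintro _ ⟨_, ⟨p, rfl⟩, rfl⟩
    rw [actHom_apply, act_coord]
    exact Subalgebra.sum_mem _ fun k _ => Subalgebra.smul_mem _ (coord_mem _) _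
  exact this ⟨φ, h, rfl⟩

theorem Vrho_le_polyFun (n : ℕ) : Vrho n ≤ Subalgebra.toSubmodule (polyFun n) := by
  refine Submodule.span_le.mpr ?_
  rintro _ ⟨g, rfl⟩
  exact act_mem_polyFun g (vPlus_mem_polyFun n)

instance finiteDimensional_Vrho (n : ℕ) : FiniteDimensional ℂ (Vrho n) := by
  obtain ⟨N, hN⟩ := exists_mem_affineFun_pow (vPlus_mem_polyFun n)
  have hfg : (affineFun n ^ N).FG := by
    refine Submodule.FG.pow ?_ N
    exact Submodule.fg_span ((Set.finite_range _).insert _)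
  have : FiniteDimensional ℂ ↥(affineFun n ^ N) := Module.Finite.iff_fg.mpr hfg
  have hle : Vrho n ≤ affineFun n ^ N := by
    refine Submodule.span_le.mpr ?_
    rintro _ ⟨g, rfl⟩
    exact map_actHom_affineFun_pow_le g N ⟨_, hN, rfl⟩
  exact Submodule.finiteDimensional_of_le hle

theorem act_mem_Vrho {n : ℕ} (g : SLn n) {φ : MatFun n} (h : φ ∈ Vrho n) : act g φ ∈ Vrho n := by
  have : (Vrho n).map (actHom g).toLinearMap ≤ Vrho n := by
    rw [Vrho, Submodule.map_span_le]
    rintro _ ⟨g', rfl⟩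
    change act g (act g' (vPlus n)) ∈ _
    rw [act_act]
    exact Submodule.subset_span ⟨_, rfl⟩
  exact this ⟨φ, h, rfl⟩

/-- The derivative of a polynomial function along a curve is linear in the tangent. -/
theorem exists_hasDerivAt_of_mem_polyFun {n : ℕ} {φ : MatFun n} (h : φ ∈ polyFun n)
    (y : Matrix (Fin (n + 1)) (Fin (n + 1)) ℂ) :
    ∃ D : Matrix (Fin (n + 1)) (Fin (n + 1)) ℂ →ₗ[ℂ] ℂ,
      ∀ z, ∀ A : ℂ → Matrix (Fin (n + 1)) (Fin (n + 1)) ℂ, A 0 = y →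
        (∀ i j, HasDerivAt (fun s => A s i j) (z i j) 0) →
          HasDerivAt (fun s => φ (A s)) (D z) 0 := by
  induction h using Algebra.adjoin_induction with
  | mem x hx =>
    obtain ⟨p, rfl⟩ := hx
    exact ⟨Matrix.entryLinearMap ℂ ℂ p.1 p.2, fun z A _ hA => hA p.1 p.2⟩
  | algebraMap r => exact ⟨0, fun z A _ _ => hasDerivAt_const _ _⟩
  | add a b _ _ ha hb =>
    obtain ⟨d, hd⟩ := ha
    obtain ⟨e, he⟩ := hb
    exact ⟨d + e, fun z A h0 hA => (hd z A h0 hA).add (he z A h0 hA)⟩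
  | mul a b _ _ ha hb =>
    obtain ⟨d, hd⟩ := ha
    obtain ⟨e, he⟩ := hb
    refine ⟨b y • d + a y • e, fun z A h0 hA => ?_⟩
    have := (hd z A h0 hA).mul (he z A h0 hA)
    rw [h0] at this
    refine this.congr_deriv ?_
    rw [LinearMap.add_apply, LinearMap.smul_apply, LinearMap.smul_apply, smul_eq_mul, smul_eq_mul,
      mul_comm (b y)]

/-! ### The weight decomposition -/

/-- Components of a vector of a submodule stable under a family of operators lie in it again, when
the components are simultaneous eigenvectors for distinct systems of eigenvalues. -/
theorem component_mem_of_sum_mem {V I : Type*} [AddCommGroup V] [Module ℂ V]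
    (W : Submodule ℂ V) (A : I → V →ₗ[ℂ] V) (hW : ∀ i, ∀ v ∈ W, A i v ∈ W)
    (S : Finset (I → ℂ)) (c : (I → ℂ) → V) (hc : ∀ χ ∈ S, ∀ i, A i (c χ) = χ i • c χ)
    (hs : ∑ χ ∈ S, c χ ∈ W) : ∀ χ ∈ S, c χ ∈ W := by
  classical
  induction S using Finset.induction_on generalizing c with
  | empty => simp
  | insert χ₀ S hχ₀ ih =>
    rw [Finset.sum_insert hχ₀] at hs
    have hS : ∀ χ ∈ S, c χ ∈ W := by
      intro χ hχ
      have hne : χ ≠ χ₀ := fun h => hχ₀ (h ▸ hχ)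
      obtain ⟨i, hi⟩ := Function.ne_iff.mp hne
      have h1 : ∑ χ ∈ S, (χ i - χ₀ i) • c χ ∈ W := by
        have h2 := W.sub_mem (hW i _ hs) (W.smul_mem (χ₀ i) hs)
        rw [map_add, map_sum, hc χ₀ (Finset.mem_insert_self _ _) i, smul_add, Finset.smul_sum,
          add_sub_add_left_eq_sub, ← Finset.sum_sub_distrib] at h2
        convert h2 using 1
        refine Finset.sum_congr rfl fun χ hχ => ?_
        rw [hc χ (Finset.mem_insert_of_mem hχ) i, sub_smul]
      have h3 := ih (fun χ => (χ i - χ₀ i) • c χ) (fun χ hχ j => by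
        rw [map_smul, hc χ (Finset.mem_insert_of_mem hχ) j, smul_comm]) h1 χ hχ
      have h4 := W.smul_mem (χ i - χ₀ i)⁻¹ h3
      rwa [smul_smul, inv_mul_cancel₀ (sub_ne_zero.mpr hi), one_smul] at h4
    intro χ hχ
    rcases Finset.mem_insert.mp hχ with rfl | h
    · have := W.sub_mem hs (W.sum_mem hS)
      rwa [add_sub_cancel_right] at this
    · exact hS χ h

/-- Simultaneous eigenfunctions of the torus. -/
def IsWeightFun {n : ℕ} (χ : TorusSL n → ℂ) (φ : MatFun n) : Prop :=
  ∀ t : TorusSL n, act t.1 φ = χ t • φ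

theorem polyFun_le_span_weightFun {n : ℕ} {φ : MatFun n} (h : φ ∈ polyFun n) :
    φ ∈ Submodule.span ℂ {ψ : MatFun n | ∃ χ, IsWeightFun χ ψ} := by
  induction h using Algebra.adjoin_induction with
  | mem x hx =>
    obtain ⟨p, rfl⟩ := hx
    refine Submodule.subset_span ⟨fun t => mat t.1 p.2 p.2, fun t => ?_⟩
    rw [act_coord, Finset.sum_eq_single p.2]
    · intro k _ hk
      rw [show mat t.1 k p.2 = 0 from t.2 k p.2 hk, zero_smul]
    · simp
  | algebraMap r => exact Submodule.subset_span ⟨1, fun t => by rw [Pi.one_apply, one_smul]; rfl⟩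
  | add a b _ _ ha hb => exact add_mem ha hb
  | mul a b _ _ ha hb =>
    have := Submodule.mul_mem_mul ha hb
    rw [Submodule.span_mul_span] at this
    refine Submodule.span_mono ?_ this
    rintro _ ⟨x, ⟨χ, hx⟩, y, ⟨χ', hy⟩, rfl⟩
    refine ⟨χ * χ', fun t => ?_⟩
    change actHom t.1 (x * y) = _
    rw [map_mul, actHom_apply, actHom_apply, hx t, hy t, Pi.mul_apply, smul_mul_smul_comm]

theorem exists_weight_decomposition {n : ℕ} {φ : MatFun n} (h : φ ∈ Vrho n) :
    ∃ (S : Finset (TorusSL n → ℂ)) (c : (TorusSL n → ℂ) → MatFun n),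
      (∀ χ ∈ S, c χ ∈ weightSpace χ) ∧ ∑ χ ∈ S, c χ = φ := by
  classical
  have h1 := polyFun_le_span_weightFun (Vrho_le_polyFun n h)
  have h2 : ∃ (S : Finset (TorusSL n → ℂ)) (c : (TorusSL n → ℂ) → MatFun n),
      (∀ χ, IsWeightFun χ (c χ)) ∧ ∑ χ ∈ S, c χ = φ := by
    clear h
    have hz : ∀ χ : TorusSL n → ℂ, IsWeightFun χ (0 : MatFun n) := by
      intro χ t
      rw [smul_zero]
      rfl
    have hextend : ∀ (S S' : Finset (TorusSL n → ℂ)) (c : (TorusSL n → ℂ) → MatFun n), S ⊆ S' →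
        ∑ χ ∈ S', (if χ ∈ S then c χ else 0) = ∑ χ ∈ S, c χ := by
      intro S S' c hS
      rw [← Finset.sum_filter, Finset.filter_mem_eq_inter, Finset.inter_eq_right.mpr hS]
    induction h1 using Submodule.span_induction with
    | mem x hx =>
      obtain ⟨χ, hχ⟩ := hx
      refine ⟨{χ}, fun χ' => if χ' = χ then x else 0, fun χ' => ?_, by simp⟩
      dsimp only
      split_ifs with h
      · rw [h]
        exact hχ
      · exact hz _
    | zero => exact ⟨∅, 0, fun χ => hz χ, by simp⟩
    | add x y _ _ hx hy =>
      obtain ⟨S, c, hc, hs⟩ := hx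
      obtain ⟨S', c', hc', hs'⟩ := hy
      refine ⟨S ∪ S', fun χ => (if χ ∈ S then c χ else 0) + (if χ ∈ S' then c' χ else 0),
        fun χ t => ?_, ?_⟩
      · rw [← actHom_apply, map_add, smul_add]
        congr 1
        · split_ifs
          exacts [hc χ t, hz χ t]
        · split_ifs
          exacts [hc' χ t, hz χ t]
      · rw [Finset.sum_add_distrib, hextend _ _ _ Finset.subset_union_left,
          hextend _ _ _ Finset.subset_union_right, hs, hs']
    | smul a x _ hx =>
      obtain ⟨S, c, hc, hs⟩ := hx
      refine ⟨S, fun χ => a • c χ, fun χ t => ?_, by rw [← Finset.smul_sum, hs]⟩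
      rw [← actHom_apply, map_smul, actHom_apply, hc χ t, smul_comm]
  obtain ⟨S, c, hc, hs⟩ := h2
  refine ⟨S, c, fun χ hχ => ⟨?_, hc χ⟩, hs⟩
  refine component_mem_of_sum_mem (Vrho n) (fun t : TorusSL n => (actHom t.1).toLinearMap)
    (fun t v hv => act_mem_Vrho t.1 hv) S c (fun χ _ t => hc χ t) (hs ▸ h) χ hχ

theorem Vrho_lower_mul {n : ℕ} {l : Matrix (Fin (n + 1)) (Fin (n + 1)) ℂ}
    (hl : ∀ i j, i < j → l i j = 0) {φ : MatFun n} (h : φ ∈ Vrho n)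
    (x : Matrix (Fin (n + 1)) (Fin (n + 1)) ℂ) : φ (l * x) = vPlus n l * φ x := by
  induction h using Submodule.span_induction with
  | mem φ hφ =>
    obtain ⟨g, rfl⟩ := hφ
    simp only [act_apply, Matrix.mul_assoc, vPlus_lower_mul hl]
  | zero => simp
  | add a b _ _ ha hb => rw [Pi.add_apply, Pi.add_apply, ha, hb, mul_add]
  | smul c a _ ha => rw [Pi.smul_apply, Pi.smul_apply, ha, smul_eq_mul, smul_eq_mul, mul_left_comm]

theorem vMinus_apply {n : ℕ} (x : Matrix (Fin (n + 1)) (Fin (n + 1)) ℂ) :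
    vMinus n x = vPlus n (x * mat (w0Dot n)⁻¹) := rfl

theorem vPlus_one (n : ℕ) : vPlus n 1 = 1 :=
  vPlus_upper_eq_one (fun _ _ h => Matrix.one_apply_ne h.ne') fun _ => Matrix.one_apply_eq _

theorem vMinus_w0Dot (n : ℕ) : vMinus n (mat (w0Dot n)) = 1 := by
  rw [vMinus_apply, mat_mul_mat_inv, vPlus_one]

/-- The weight of the lowest weight vector. -/
def lowestWeight {n : ℕ} (t : TorusSL n) : ℂ :=
  vPlus n (mat (w0Dot n) * mat t.1 * mat (w0Dot n)⁻¹)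

theorem Vrho_w0Dot_mul {n : ℕ} (t : TorusSL n) {φ : MatFun n} (h : φ ∈ Vrho n)
    (x : Matrix (Fin (n + 1)) (Fin (n + 1)) ℂ) :
    φ (mat (w0Dot n) * mat t.1 * mat (w0Dot n)⁻¹ * x) = lowestWeight t * φ x :=
  Vrho_lower_mul (w0_conj_lower fun i j hij => t.2 i j hij.ne') h x

theorem vMinus_mem_weightSpace (n : ℕ) : vMinus n ∈ weightSpace (n := n) lowestWeight := by
  refine ⟨Submodule.subset_span ⟨_, rfl⟩, fun t => ?_⟩
  funext x
  rw [act_apply, vMinus_apply, Pi.smul_apply, smul_eq_mul, lowestWeight, vMinus_apply]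
  have h : x * mat t.1 * mat (w0Dot n)⁻¹ =
      x * mat (w0Dot n)⁻¹ * (mat (w0Dot n) * mat t.1 * mat (w0Dot n)⁻¹) := by
    simp only [Matrix.mul_assoc]
    rw [← Matrix.mul_assoc (mat (w0Dot n)⁻¹) (mat (w0Dot n)), mat_inv_mul_mat, Matrix.one_mul]
  rw [h, vPlus_mul_upper (w0_conj_upper (A := mat t.1) fun i j hij => t.2 i j hij.ne), mul_comm]

/-- A vector of `V(ρ)` vanishing at `ẇ₀` is a sum of weight vectors of other weights than the
lowest one. -/
theorem eval_w0Dot_eq_zero {n : ℕ} {χ : TorusSL n → ℂ} (hχ : vMinus n ∉ weightSpace χ)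
    {φ : MatFun n} (h : φ ∈ weightSpace χ) : φ (mat (w0Dot n)) = 0 := by
  by_contra h0
  refine hχ ?_
  have : χ = lowestWeight := by
    funext t
    have h1 := congrFun (h.2 t) (mat (w0Dot n))
    rw [act_apply, Pi.smul_apply, smul_eq_mul] at h1
    have h2 := Vrho_w0Dot_mul t h.1 (mat (w0Dot n))
    rw [Matrix.mul_assoc (mat (w0Dot n) * mat t.1), mat_inv_mul_mat, Matrix.mul_one, h1] at h2
    exact mul_right_cancel₀ h0 h2
  rw [this]
  exact vMinus_mem_weightSpace n

/-- The sum of the weight spaces of `V(ρ)` other than the lowest one. -/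
def otherWeights (n : ℕ) : Submodule ℂ (MatFun n) :=
  ⨆ χ : TorusSL n → ℂ, ⨆ _ : vMinus n ∉ weightSpace χ, weightSpace χ

theorem weightSpace_le_Vrho {n : ℕ} (χ : TorusSL n → ℂ) : weightSpace χ ≤ Vrho n :=
  fun _ h => h.1

theorem otherWeights_le_Vrho (n : ℕ) : otherWeights n ≤ Vrho n :=
  iSup₂_le fun χ _ => weightSpace_le_Vrho χ

theorem eval_w0Dot_otherWeights {n : ℕ} {φ : MatFun n} (h : φ ∈ otherWeights n) :
    φ (mat (w0Dot n)) = 0 := by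
  have : otherWeights n ≤
      LinearMap.ker (LinearMap.proj (R := ℂ) (φ := fun _ => ℂ) (mat (w0Dot n))) :=
    iSup₂_le fun χ hχ ψ hψ => eval_w0Dot_eq_zero hχ hψ
  exact this h

theorem act_mem_otherWeights {n : ℕ} (t : TorusSL n) {φ : MatFun n} (h : φ ∈ otherWeights n) :
    act t.1 φ ∈ otherWeights n := by
  have : (otherWeights n).map (actHom t.1).toLinearMap ≤ otherWeights n := by
    rw [otherWeights, Submodule.map_iSup]
    refine iSup_le fun χ => ?_
    rw [Submodule.map_iSup]
    refine iSup_le fun hχ => ?_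
    rintro _ ⟨ψ, hψ, rfl⟩
    change act t.1 ψ ∈ _
    rw [hψ.2 t]
    exact Submodule.smul_mem _ _ (Submodule.mem_iSup_of_mem χ (Submodule.mem_iSup_of_mem hχ hψ))
  exact this ⟨φ, h, rfl⟩

/-- The vectors whose component of lowest weight is a multiple of the lowest weight vector. -/
def goodVectors (n : ℕ) : Submodule ℂ (MatFun n) :=
  Submodule.span ℂ {vMinus n} ⊔ otherWeights n

theorem vMinus_mem_Vrho (n : ℕ) : vMinus n ∈ Vrho n := (vMinus_mem_weightSpace n).1

theorem goodVectors_le_Vrho (n : ℕ) : goodVectors n ≤ Vrho n := by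
  refine sup_le (Submodule.span_le.mpr ?_) (otherWeights_le_Vrho n)
  rintro _ rfl
  exact vMinus_mem_Vrho n

theorem isClosed_otherWeights (n : ℕ) : IsClosed (otherWeights n : Set (MatFun n)) := by
  have := Submodule.finiteDimensional_of_le (otherWeights_le_Vrho n)
  exact Submodule.closed_of_finiteDimensional _

theorem isClosed_goodVectors (n : ℕ) : IsClosed (goodVectors n : Set (MatFun n)) := by
  have := Submodule.finiteDimensional_of_le (goodVectors_le_Vrho n)
  exact Submodule.closed_of_finiteDimensional _

theorem coeff_eq {n : ℕ} {φ : MatFun n} (h : φ ∈ goodVectors n) :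
    coeff φ (vMinus n) = φ (mat (w0Dot n)) := by
  have hex : ∃ c : ℂ, φ - c • vMinus n ∈
      ⨆ χ : TorusSL n → ℂ, ⨆ _ : vMinus n ∉ weightSpace χ, weightSpace χ := by
    obtain ⟨a, ha, b, hb, rfl⟩ := Submodule.mem_sup.mp h
    obtain ⟨c, rfl⟩ := Submodule.mem_span_singleton.mp ha
    exact ⟨c, by rwa [add_sub_cancel_left]⟩
  rw [coeff, dif_pos hex]
  have h1 := eval_w0Dot_otherWeights hex.choose_spec
  rw [Pi.sub_apply, Pi.smul_apply, vMinus_w0Dot, smul_eq_mul, mul_one, sub_eq_zero] at h1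
  exact h1.symm

/-! ### Translates of the lowest weight vector -/

theorem continuous_vPlus (n : ℕ) : Continuous (vPlus n) := by
  unfold vPlus
  refine continuous_finsetProd _ fun k _ => Continuous.matrix_det ?_
  exact continuous_id.matrix_submatrix _ _

theorem continuous_vMinus (n : ℕ) : Continuous (vMinus n) :=
  (continuous_vPlus n).comp (continuous_id.matrix_mul continuous_const)

theorem prod_zpow_eq {ι : Type*} {s : Finset ι} {z : ℂ} (hz : z ≠ 0) (f : ι → ℤ) :
    ∏ i ∈ s, z ^ f i = z ^ ∑ i ∈ s, f i := by
  classical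
  induction s using Finset.induction_on with
  | empty => simp
  | insert a s ha ih => rw [Finset.prod_insert ha, Finset.sum_insert ha, zpow_add₀ hz, ih]

/-- The value at `z` of a one-parameter subgroup contracting the upper unitriangular group. -/
def contracting (n : ℕ) (z : ℂ) (hz : z ≠ 0) : TorusSL n :=
  ⟨⟨Matrix.diagonal fun i => z ^ ((n : ℤ) - 2 * (i : ℤ)), by
      rw [Matrix.det_diagonal, prod_zpow_eq hz]
      rw [show ∑ i : Fin (n + 1), ((n : ℤ) - 2 * (i : ℤ)) = 0 from ?_, zpow_zero]
      rw [Finset.sum_sub_distrib, ← Finset.mul_sum, Fin.sum_univ_eq_sum_range (fun i => (i : ℤ))]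
      have := Finset.sum_range_id_mul_two (n + 1)
      zify at this
      simp only [Finset.sum_const, Finset.card_univ, Fintype.card_fin, nsmul_eq_mul]
      push_cast at this ⊢
      linarith⟩,
    fun _ _ h => Matrix.diagonal_apply_ne _ h⟩

theorem contracting_conj {n : ℕ} {z : ℂ} (hz : z ≠ 0) {u : SLn n} (hu : u ∈ upperUnipotent n)
    (i j : Fin (n + 1)) :
    mat ((contracting n z hz).1 * u * (contracting n z hz).1⁻¹) i j =
      mat u i j * z ^ (2 * ((j : ℕ) - (i : ℕ))) := by
  have h : mat ((contracting n z hz).1 * u * (contracting n z hz).1⁻¹) *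
      mat (contracting n z hz).1 = mat (contracting n z hz).1 * mat u := by
    rw [← mat_mul, inv_mul_cancel_right, mat_mul]
  have h1 : mat (contracting n z hz).1 = Matrix.diagonal fun i : Fin (n + 1) =>
    z ^ ((n : ℤ) - 2 * (i : ℤ)) := rfl
  have h2 := congrFun (congrFun h i) j
  rw [h1, Matrix.mul_diagonal, Matrix.diagonal_mul] at h2
  rcases lt_or_ge j i with hji | hij
  · rw [hu.1 i j hji, mul_zero] at h2
    rw [hu.1 i j hji, zero_mul]
    exact (mul_eq_zero.mp h2).resolve_right (zpow_ne_zero _ hz)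
  · refine mul_right_cancel₀ (zpow_ne_zero ((n : ℤ) - 2 * (j : ℤ)) hz) (h2.trans ?_)
    rw [mul_assoc, mul_comm (mat u i j), ← zpow_natCast, ← zpow_add₀ hz]
    congr 2
    have : (i : ℕ) ≤ j := hij
    push_cast [Nat.cast_sub this]
    ring

theorem act_vMinus_sub_mem {n : ℕ} {u : SLn n} (hu : u ∈ upperUnipotent n) :
    vMinus n - act u (vMinus n) ∈ otherWeights n := by
  classical
  have hV : act u (vMinus n) ∈ Vrho n := act_mem_Vrho u (vMinus_mem_Vrho n)
  obtain ⟨c, hc, w, hw, hcw⟩ : ∃ c ∈ weightSpace (n := n) lowestWeight,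
      ∃ w ∈ otherWeights n, c + w = act u (vMinus n) := by
    obtain ⟨S, c, hc, hs⟩ := exists_weight_decomposition hV
    rw [← hs, ← Submodule.mem_sup]
    refine Submodule.sum_mem _ fun χ hχ => ?_
    by_cases h : vMinus n ∈ weightSpace χ
    · refine Submodule.mem_sup_left ?_
      have : χ = lowestWeight := by
        funext t
        have h1 := congrFun ((h.2 t).symm.trans ((vMinus_mem_weightSpace n).2 t)) (mat (w0Dot n))
        simpa [vMinus_w0Dot] using h1
      rw [← this]
      exact hc χ hχ
    · exact Submodule.mem_sup_right
        (Submodule.mem_iSup_of_mem χ (Submodule.mem_iSup_of_mem h (hc χ hχ)))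
  have hlw : ∀ t : TorusSL n, lowestWeight t ≠ 0 := by
    intro t
    refine vPlus_lower_ne_zero (w0_conj_lower fun i j hij => t.2 i j hij.ne') fun i => ?_
    rw [w0_conj_diag]
    have h1 := det_mat t.1
    have h2 : mat t.1 = Matrix.diagonal fun i => mat t.1 i i := by
      ext i j
      by_cases h : i = j
      · subst h
        simp
      · rw [Matrix.diagonal_apply_ne _ h]
        exact t.2 i j h
    rw [h2, Matrix.det_diagonal] at h1
    have h3 : ∀ i ∈ Finset.univ, mat t.1 i i ≠ 0 :=
      Finset.prod_ne_zero_iff.mp (by rw [h1]; exact one_ne_zero)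
    exact h3 i.rev (Finset.mem_univ _)
  have hmem : ∀ z : ℂ, ∀ hz : z ≠ 0,
      act ((contracting n z hz).1 * u * (contracting n z hz).1⁻¹) (vMinus n) -
        act u (vMinus n) ∈ otherWeights n := by
    intro z hz
    set t := contracting n z hz
    have h1 : act t.1⁻¹ (vMinus n) = (lowestWeight t)⁻¹ • vMinus n := by
      have h2 := congrArg (act t.1⁻¹) ((vMinus_mem_weightSpace n).2 t)
      rw [act_act, inv_mul_cancel, ← actHom_apply, ← actHom_apply, map_smul, actHom_apply,
        actHom_apply] at h2
      rw [eq_inv_smul_iff₀ (hlw t), ← h2]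
      funext x
      simp [act_apply]
    have h3 : act (t.1 * u * t.1⁻¹) (vMinus n) = c + (lowestWeight t)⁻¹ • act t.1 w := by
      rw [← act_act, ← act_act, h1, ← actHom_apply u, map_smul, actHom_apply, ← hcw,
        ← actHom_apply t.1, map_smul, map_add, actHom_apply, hc.2 t, smul_add,
        inv_smul_smul₀ (hlw t), actHom_apply]
    rw [h3, ← hcw, add_sub_add_left_eq_sub]
    exact sub_mem (Submodule.smul_mem _ _ (act_mem_otherWeights t hw)) hw
  have hlim : Filter.Tendsto (fun z : ℂ => if hz : z ≠ 0 then
      act ((contracting n z hz).1 * u * (contracting n z hz).1⁻¹) (vMinus n) - act u (vMinus n)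
      else 0) (𝓝[≠] 0) (𝓝 (vMinus n - act u (vMinus n))) := by
    rw [tendsto_pi_nhds]
    intro x
    let A : ℂ → Matrix (Fin (n + 1)) (Fin (n + 1)) ℂ := fun z =>
      Matrix.of fun i j => mat u i j * z ^ (2 * ((j : ℕ) - (i : ℕ)))
    have hA : Continuous A := by
      refine continuous_matrix fun i j => ?_
      exact continuous_const.mul (continuous_pow _)
    have hA0 : A 0 = 1 := by
      ext i j
      simp only [A, Matrix.of_apply]
      rcases lt_trichotomy i j with h | h | h
      · have : (i : ℕ) < j := h
        rw [zero_pow (by omega), mul_zero, Matrix.one_apply_ne h.ne]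
      · subst h
        rw [hu.2]
        simp
      · rw [hu.1 i j h, zero_mul, Matrix.one_apply_ne h.ne']
    have h1 : Filter.Tendsto (fun z => vMinus n (x * A z) - act u (vMinus n) x) (𝓝[≠] 0)
        (𝓝 (vMinus n x - act u (vMinus n) x)) := by
      have h2 : Continuous fun z => vMinus n (x * A z) - act u (vMinus n) x :=
        ((continuous_vMinus n).comp (continuous_const.matrix_mul hA)).sub continuous_const
      have h3 := h2.tendsto 0
      rw [hA0, Matrix.mul_one] at h3
      exact h3.mono_left nhdsWithin_le_nhds
    refine h1.congr' ?_
    filter_upwards [self_mem_nhdsWithin] with z hz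
    have hz' : z ≠ 0 := hz
    rw [dif_pos hz', Pi.sub_apply, act_apply]
    congr 3
    ext i j
    exact (contracting_conj hz' hu i j).symm
  refine (isClosed_otherWeights n).mem_of_tendsto hlim ?_
  filter_upwards [self_mem_nhdsWithin] with z hz
  have hz' : z ≠ 0 := hz
  rw [dif_pos hz']
  exact hmem z hz'

theorem act_vMinus_mem {n : ℕ} {u : SLn n} (hu : u ∈ upperUnipotent n) :
    act u (vMinus n) ∈ goodVectors n := by
  have h1 : vMinus n ∈ goodVectors n :=
    Submodule.mem_sup_left (Submodule.mem_span_singleton_self _)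
  have h2 := (goodVectors n).sub_mem h1 (Submodule.mem_sup_right (act_vMinus_sub_mem hu))
  rwa [sub_sub_cancel] at h2

/-! ### Derivatives of polynomial functions on matrices -/

/-- The matrices on which `MatFun n` consists of functions. -/
abbrev Mx (n : ℕ) : Type := Matrix (Fin (n + 1)) (Fin (n + 1)) ℂ

/-- The derivative of `φ` at `y` in direction `z`. -/
def polyDeriv {n : ℕ} (φ : MatFun n) (y z : Mx n) : ℂ := deriv (fun s : ℂ => φ (y + s • z)) 0

theorem hasDerivAt_line {n : ℕ} (y z : Mx n) (i j : Fin (n + 1)) :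
    HasDerivAt (fun s : ℂ => (y + s • z) i j) (z i j) 0 := by
  have := ((hasDerivAt_id (0 : ℂ)).mul_const (z i j)).const_add (y i j)
  rwa [one_mul] at this

theorem exists_polyDeriv {n : ℕ} {φ : MatFun n} (h : φ ∈ polyFun n) (y : Mx n) :
    ∃ D : Mx n →ₗ[ℂ] ℂ, (∀ z, polyDeriv φ y z = D z) ∧ ∀ z, ∀ A : ℂ → Mx n, A 0 = y →
        (∀ i j, HasDerivAt (fun s => A s i j) (z i j) 0) →
          HasDerivAt (fun s => φ (A s)) (D z) 0 := by
  obtain ⟨D, hD⟩ := exists_hasDerivAt_of_mem_polyFun h y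
  exact ⟨D, fun z => (hD z (fun s => y + s • z) (by simp) (hasDerivAt_line y z)).deriv, hD⟩

theorem hasDerivAt_polyDeriv {n : ℕ} {φ : MatFun n} (h : φ ∈ polyFun n) (y z : Mx n) :
    HasDerivAt (fun s : ℂ => φ (y + s • z)) (polyDeriv φ y z) 0 := by
  obtain ⟨D, hD, hD'⟩ := exists_polyDeriv h y
  rw [hD]
  exact hD' z _ (by simp) (hasDerivAt_line y z)

theorem polyDeriv_add {n : ℕ} {φ : MatFun n} (h : φ ∈ polyFun n) (y z w : Mx n) :
    polyDeriv φ y (z + w) = polyDeriv φ y z + polyDeriv φ y w := by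
  obtain ⟨D, hD, -⟩ := exists_polyDeriv h y
  rw [hD, hD, hD, map_add]

section MatrixNorm

attribute [local instance] Matrix.linftyOpNormedRing Matrix.linftyOpNormedAlgebra

theorem hasDerivAt_mul_exp {n : ℕ} (x X : Mx n) (i j : Fin (n + 1)) :
    HasDerivAt (fun s : ℂ => (x * NormedSpace.exp (s • X)) i j) ((x * X) i j) 0 := by
  have h1 : HasDerivAt (fun s : ℂ => NormedSpace.exp (s • X)) X 0 := by
    have := hasDerivAt_exp_smul_const (𝕂 := ℂ) X 0
    rwa [zero_smul, NormedSpace.exp_zero, one_mul] at this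
  have h2 := h1.const_mul x
  have h3 : HasFDerivAt (fun y : Mx n => y i j)
      (LinearMap.toContinuousLinearMap (Matrix.entryLinearMap ℂ ℂ i j : Mx n →ₗ[ℂ] ℂ))
      (x * NormedSpace.exp ((0 : ℂ) • X)) :=
    (LinearMap.toContinuousLinearMap (Matrix.entryLinearMap ℂ ℂ i j : Mx n →ₗ[ℂ] ℂ)).hasFDerivAt
  exact h3.comp_hasDerivAt 0 h2

end MatrixNorm

theorem lieAct_eq {n : ℕ} {φ : MatFun n} (h : φ ∈ polyFun n) (X x : Mx n) :
    lieAct X φ x = polyDeriv φ x (x * X) := by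
  obtain ⟨D, hD, hD'⟩ := exists_polyDeriv h x
  rw [hD]
  exact (hD' (x * X) _ (by rw [zero_smul, NormedSpace.exp_zero, mul_one])
    (hasDerivAt_mul_exp x X)).deriv

/-- A closed subspace contains the pointwise derivatives of its curves. -/
theorem mem_of_hasDerivAt {X : Type*} {W : Submodule ℂ (X → ℂ)} (hW : IsClosed (W : Set (X → ℂ)))
    {g : ℂ → X → ℂ} {g' : X → ℂ} (hg : ∀ s, g s ∈ W)
    (hd : ∀ x, HasDerivAt (fun s => g s x) (g' x) 0) : g' ∈ W := by
  have hlim : Filter.Tendsto (fun s : ℂ => s⁻¹ • (g s - g 0)) (𝓝[≠] 0) (𝓝 g') := by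
    rw [tendsto_pi_nhds]
    intro x
    have := (hasDerivAt_iff_tendsto_slope.mp (hd x))
    simp only [slope_fun_def, sub_zero] at this
    exact this
  exact hW.mem_of_tendsto hlim (Filter.Eventually.of_forall fun s =>
    W.smul_mem _ (W.sub_mem (hg s) (hg 0)))

theorem hasDerivAt_det_one_add_smul {m : ℕ} (M : Matrix (Fin m) (Fin m) ℂ) :
    HasDerivAt (fun s : ℂ => (1 + s • M).det) M.trace 0 := by
  have h1 := (Matrix.det (1 + (Polynomial.X : Polynomial ℂ) • M.map Polynomial.C)).hasDerivAt 0
  rw [Matrix.derivative_det_one_add_X_smul] at h1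
  refine h1.congr_of_eventuallyEq (Filter.Eventually.of_forall fun s => ?_)
  simp [eval_det, ← Matrix.smul_eq_mul_diagonal]

theorem lead_one_add_smul {n : ℕ} (k : Fin n) (s : ℂ) (Y : Mx n) :
    lead k (1 + s • Y) = 1 + s • lead k Y := by
  ext i j
  simp only [lead, Matrix.submatrix_apply, Matrix.add_apply, Matrix.smul_apply]
  congr 1
  rw [Matrix.one_apply, Matrix.one_apply]
  congr 1
  exact propext (by rw [(Fin.castLE_injective _).eq_iff])

/-- `diag(n, n - 1, …, 0)`. -/
def heightDiag (n : ℕ) : Mx n := Matrix.diagonal fun i => (n : ℂ) - (i : ℕ)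

theorem sum_trace_lead {n : ℕ} (Y : Mx n) :
    ∑ k : Fin n, (lead k Y).trace = (heightDiag n * Y).trace := by
  have h1 : ∀ k : Fin n, (lead k Y).trace =
      ∑ i ∈ Finset.range (n + 1), if i ≤ k then ent Y i i else 0 := by
    intro k
    rw [← Finset.sum_filter]
    have : (Finset.range (n + 1)).filter (fun i => i ≤ (k : ℕ)) = Finset.range (k + 1) := by
      ext i
      simp only [Finset.mem_filter, Finset.mem_range]
      omega
    rw [this, ← Fin.sum_univ_eq_sum_range (fun i => ent Y i i)]
    refine Finset.sum_congr rfl fun i _ => ?_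
    exact (ent_val Y (Fin.castLE (by omega) i) (Fin.castLE (by omega) i)).symm
  rw [Finset.sum_congr rfl fun k _ => h1 k, Finset.sum_comm, Matrix.trace]
  have h2 : ∀ i : Fin (n + 1), (heightDiag n * Y).diag i =
      ((n : ℂ) - (i : ℕ)) * ent Y (i : ℕ) (i : ℕ) := by
    intro i
    rw [Matrix.diag_apply, heightDiag, Matrix.diagonal_mul, ent_val]
  rw [Finset.sum_congr rfl fun i _ => h2 i,
    Fin.sum_univ_eq_sum_range (fun i => ((n : ℂ) - (i : ℕ)) * ent Y i i)]
  refine Finset.sum_congr rfl fun i hi => ?_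
  have hi' := Finset.mem_range.mp hi
  rw [← Finset.sum_filter, Finset.sum_const, nsmul_eq_mul]
  congr 1
  have h3 : (Finset.univ.filter fun k : Fin n => i ≤ (k : ℕ)).card = n - i := by
    rw [← Finset.card_map Fin.valEmbedding]
    have : (Finset.univ.filter fun k : Fin n => i ≤ (k : ℕ)).map Fin.valEmbedding =
        Finset.Ico i n := by
      ext j
      simp only [Finset.mem_map, Finset.mem_filter, Finset.mem_univ, true_and,
        Fin.valEmbedding_apply, Finset.mem_Ico]
      exact ⟨fun ⟨k, h, h'⟩ => h' ▸ ⟨h, k.2⟩, fun h => ⟨⟨j, h.2⟩, h.1, rfl⟩⟩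
    rw [this, Nat.card_Ico]
  rw [h3, Nat.cast_sub (by omega)]

theorem hasDerivAt_vPlus_one_add_smul {n : ℕ} (Y : Mx n) :
    HasDerivAt (fun s : ℂ => vPlus n (1 + s • Y)) (heightDiag n * Y).trace 0 := by
  have h : HasDerivAt (fun s : ℂ => ∏ k : Fin n, (1 + s • lead k Y).det) _ 0 :=
    HasDerivAt.fun_finsetProd (u := Finset.univ) fun k _ => hasDerivAt_det_one_add_smul (lead k Y)
  rw [← sum_trace_lead]
  simp only [vPlus_eq, lead_one_add_smul]
  refine h.congr_deriv (Finset.sum_congr rfl fun k _ => ?_)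
  simp

theorem trace_mul_fSum {n : ℕ} (V : Mx n) :
    (V * fSum n).trace = ∑ i : Fin n, V i.castSucc i.succ := by
  rw [fSum, Finset.mul_sum, Matrix.trace_sum]
  refine Finset.sum_congr rfl fun i _ => ?_
  rw [Matrix.trace_mul_single]
  simp

theorem inv_mem_upperUnipotent {n : ℕ} {u : SLn n} (hu : u ∈ upperUnipotent n) :
    u⁻¹ ∈ upperUnipotent n := by
  have hT : Matrix.BlockTriangular (mat u) id := fun i j hij => hu.1 i j hij
  let _ : Invertible (mat u) := Matrix.invertibleOfIsUnitDet _ (by rw [det_mat]; exact isUnit_one)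
  have h2 := Matrix.blockTriangular_inv_of_blockTriangular hT
  have h3 : (mat u)⁻¹ = mat u⁻¹ := Matrix.inv_eq_right_inv (mat_mul_mat_inv u)
  rw [h3] at h2
  refine ⟨fun i j hij => h2 hij, fun i => ?_⟩
  have h4 : (mat u * mat u⁻¹) i i = 1 := by rw [mat_mul_mat_inv, Matrix.one_apply_eq]
  rw [Matrix.mul_apply, Finset.sum_eq_single i, hu.2, one_mul] at h4
  · exact h4
  · intro k _ hk
    rcases lt_or_gt_of_ne hk with h | h
    · rw [hu.1 _ _ h, zero_mul]
    · rw [show mat u⁻¹ k i = 0 from h2 h, mul_zero]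
  · simp

theorem trace_heightDiag_conj {n : ℕ} {u : SLn n} (hu : u ∈ upperUnipotent n) :
    (heightDiag n * (mat u * fSum n * mat u⁻¹)).trace = superSum u := by
  set V := mat u⁻¹ * heightDiag n * mat u with hV
  have h1 : (heightDiag n * (mat u * fSum n * mat u⁻¹)).trace = (V * fSum n).trace := by
    rw [← Matrix.mul_assoc, Matrix.trace_mul_comm, hV]
    simp only [Matrix.mul_assoc]
  have hu' := inv_mem_upperUnipotent hu
  have hup : ∀ i j, j < i → V i j = 0 := by
    intro i j hij
    rw [hV, heightDiag, Matrix.mul_apply]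
    refine Finset.sum_eq_zero fun k _ => ?_
    rw [Matrix.mul_diagonal]
    rcases lt_or_ge k i with hk | hk
    · rw [hu'.1 i k hk, zero_mul, zero_mul]
    · rw [hu.1 k j (hij.trans_le hk), mul_zero]
  have huV : mat u * V = heightDiag n * mat u := by
    rw [hV, Matrix.mul_assoc, ← Matrix.mul_assoc (mat u), mat_mul_mat_inv, Matrix.one_mul]
  have hd : ∀ i, V i i = (n : ℂ) - (i : ℕ) := by
    intro i
    have h2 := congrFun (congrFun huV i) i
    rw [heightDiag, Matrix.diagonal_mul, hu.2, mul_one, Matrix.mul_apply,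
      Finset.sum_eq_single i, hu.2, one_mul] at h2
    · exact h2
    · intro k _ hk
      rcases lt_or_gt_of_ne hk with h | h
      · rw [hu.1 _ _ h, zero_mul]
      · rw [hup k i h, mul_zero]
    · simp
  rw [h1, trace_mul_fSum, superSum]
  refine Finset.sum_congr rfl fun i _ => ?_
  have hlt : i.castSucc < i.succ := Fin.castSucc_lt_succ
  have h2 := congrFun (congrFun huV i.castSucc) i.succ
  rw [heightDiag, Matrix.diagonal_mul, Matrix.mul_apply,
    Finset.sum_eq_add_of_mem i.castSucc i.succ (Finset.mem_univ _) (Finset.mem_univ _) hlt.ne,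
    hu.2, hd] at h2
  · simp only [Fin.val_succ, Fin.val_castSucc] at h2
    push_cast at h2
    linear_combination h2
  · rintro k - ⟨h3, h4⟩
    rcases lt_or_gt_of_ne h3 with h | h
    · rw [hu.1 _ _ h, zero_mul]
    · have : i.succ < k := lt_of_le_of_ne (Fin.castSucc_lt_iff_succ_le.mp h) (Ne.symm h4)
      rw [hup _ _ this, mul_zero]

theorem trace_heightDiag_w0_conj {n : ℕ} (Y : Mx n) (hY : Y.trace = 0) :
    (heightDiag n * (mat (w0Dot n) * Y * mat (w0Dot n)⁻¹)).trace = -(heightDiag n * Y).trace := by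
  rw [Matrix.trace, Matrix.trace, eq_neg_iff_add_eq_zero, ← Equiv.sum_comp Fin.revPerm,
    ← Finset.sum_add_distrib]
  have : (n : ℂ) * Y.trace = 0 := by rw [hY, mul_zero]
  rw [← this, Matrix.trace, Finset.mul_sum]
  refine Finset.sum_congr rfl fun i _ => ?_
  rw [Matrix.diag_apply, Matrix.diag_apply, Matrix.diag_apply, heightDiag, Matrix.diagonal_mul,
    Matrix.diagonal_mul, w0_conj_diag, Fin.revPerm_apply, Fin.rev_rev, Fin.val_rev]
  rw [Nat.cast_sub (by omega)]
  push_cast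
  ring

theorem superSum_inv {n : ℕ} {u : SLn n} (hu : u ∈ upperUnipotent n) :
    superSum u⁻¹ = -superSum u := by
  have h := superSum_mul hu (inv_mem_upperUnipotent hu)
  rw [mul_inv_cancel, superSum_one] at h
  linear_combination -h

/-! ### The phase function -/

theorem vMinus_mul_lower {n : ℕ} {M : Mx n} (hM : ∀ i j, i < j → M i j = 0) (y : Mx n) :
    vMinus n (y * M) = vMinus n y * vPlus n (mat (w0Dot n) * M * mat (w0Dot n)⁻¹) := by
  rw [vMinus_apply, vMinus_apply, ← vPlus_mul_upper (w0_conj_upper hM)]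
  congr 1
  simp only [← Matrix.mul_assoc]
  rw [Matrix.mul_assoc y (mat (w0Dot n)⁻¹) (mat (w0Dot n)), mat_inv_mul_mat, Matrix.mul_one]

theorem vMinus_mul_mem {n : ℕ} {N : Mx n} (hN : ∀ i j, j < i → N i j = 0) (hN' : ∀ i, N i i = 1) :
    (fun x => vMinus n (x * N)) ∈ goodVectors n := by
  have hdet : N.det = 1 := by
    rw [Matrix.det_of_isUpperTriangular fun i j hij => hN i j hij]
    exact Finset.prod_eq_one fun i _ => hN' i
  exact act_vMinus_mem (u := ⟨N, hdet⟩) ⟨hN, hN'⟩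

theorem upper_mul {n : ℕ} {A B : Mx n} (hA : ∀ i j, j < i → A i j = 0) (hA' : ∀ i, A i i = 1)
    (hB : ∀ i j, j < i → B i j = 0) (hB' : ∀ i, B i i = 1) :
    (∀ i j, j < i → (A * B) i j = 0) ∧ ∀ i, (A * B) i i = 1 := by
  have hdA : A.det = 1 := by
    rw [Matrix.det_of_isUpperTriangular fun i j hij => hA i j hij]
    exact Finset.prod_eq_one fun i _ => hA' i
  have hdB : B.det = 1 := by
    rw [Matrix.det_of_isUpperTriangular fun i j hij => hB i j hij]
    exact Finset.prod_eq_one fun i _ => hB' i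
  exact mul_mem (show (⟨A, hdA⟩ : SLn n) ∈ upperUnipotent n from ⟨hA, hA'⟩)
    (show (⟨B, hdB⟩ : SLn n) ∈ upperUnipotent n from ⟨hB, hB'⟩)

/-- The factorization `b = u₁ t ẇ₀⁻¹ u₂`. -/
structure HasFactorization {n : ℕ} (b u₁ u₂ : SLn n) (t : Fin (n + 1) → ℂ) : Prop where
  left : u₁ ∈ upperUnipotent n
  right : u₂ ∈ upperUnipotent n
  torus : ∀ i, t i ≠ 0
  eq : mat b = mat u₁ * Matrix.diagonal t * mat (w0Dot n)⁻¹ * mat u₂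

/-- The value of the extremal matrix coefficient. -/
def kappa {n : ℕ} (t : Fin (n + 1) → ℂ) : ℂ :=
  vPlus n (mat (w0Dot n) * Matrix.diagonal t * mat (w0Dot n)⁻¹)

theorem diagonal_lower {n : ℕ} (t : Fin (n + 1) → ℂ) (i j : Fin (n + 1)) (h : i < j) :
    Matrix.diagonal t i j = 0 := Matrix.diagonal_apply_ne _ h.ne

theorem diagonal_upper {n : ℕ} (t : Fin (n + 1) → ℂ) (i j : Fin (n + 1)) (h : j < i) :
    Matrix.diagonal t i j = 0 := Matrix.diagonal_apply_ne _ h.ne'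

theorem kappa_ne_zero {n : ℕ} {t : Fin (n + 1) → ℂ} (ht : ∀ i, t i ≠ 0) : kappa (n := n) t ≠ 0 := by
  refine vPlus_lower_ne_zero (w0_conj_lower (diagonal_upper t)) fun i => ?_
  rw [w0_conj_diag, Matrix.diagonal_apply_eq]
  exact ht _

/-- Every matrix is the sum of an upper triangular and a strictly lower triangular one. -/
theorem exists_upper_add_strictLower {n : ℕ} (Y : Mx n) : ∃ U L : Mx n, Y = U + L ∧
    (∀ i j, j < i → U i j = 0) ∧ (∀ i j, i ≤ j → L i j = 0) := by
  refine ⟨Matrix.of fun i j => if i ≤ j then Y i j else 0,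
    Matrix.of fun i j => if i ≤ j then 0 else Y i j, ?_, ?_, ?_⟩
  · ext i j
    simp only [Matrix.add_apply, Matrix.of_apply]
    split_ifs <;> simp
  · intro i j hij
    simp [hij.not_ge]
  · intro i j hij
    simp [hij]

theorem exists_strictUpper_add_lower {n : ℕ} (Y : Mx n) : ∃ U L : Mx n, Y = U + L ∧
    (∀ i j, j ≤ i → U i j = 0) ∧ (∀ i j, i < j → L i j = 0) := by
  obtain ⟨U, L, h, hU, hL⟩ := exists_upper_add_strictLower Yᵀ
  refine ⟨Lᵀ, Uᵀ, ?_, fun i j hij => hL j i hij, fun i j hij => hU j i hij⟩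
  rw [← Matrix.transpose_transpose Y, h, Matrix.transpose_add, add_comm]

theorem one_add_smul_lower {n : ℕ} {L : Mx n} (hL : ∀ i j, i < j → L i j = 0) (s : ℂ)
    (i j : Fin (n + 1)) (h : i < j) : (1 + s • L) i j = 0 := by
  rw [Matrix.add_apply, Matrix.smul_apply, hL i j h, Matrix.one_apply_ne h.ne, smul_zero, add_zero]

theorem one_add_smul_upper {n : ℕ} {U : Mx n} (hU : ∀ i j, j < i → U i j = 0) (s : ℂ)
    (i j : Fin (n + 1)) (h : j < i) : (1 + s • U) i j = 0 := by
  rw [Matrix.add_apply, Matrix.smul_apply, hU i j h, Matrix.one_apply_ne h.ne', smul_zero, add_zero]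

theorem one_add_smul_diag {n : ℕ} {U : Mx n} (hU : ∀ i, U i i = 0) (s : ℂ)
    (i : Fin (n + 1)) : (1 + s • U) i i = 1 := by
  rw [Matrix.add_apply, Matrix.smul_apply, hU i, Matrix.one_apply_eq, smul_zero, add_zero]

theorem add_smul_mul {n : ℕ} (y Z : Mx n) (s : ℂ) : y + s • (y * Z) = y * (1 + s • Z) := by
  rw [Matrix.mul_add, Matrix.mul_one, Matrix.mul_smul]

theorem vMinus_mem_polyFun (n : ℕ) : vMinus n ∈ polyFun n :=
  act_mem_polyFun _ (vPlus_mem_polyFun n)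

namespace HasFactorization

variable {n : ℕ} {b u₁ u₂ : SLn n} {t : Fin (n + 1) → ℂ}

theorem vPlus_mul_half (x : Mx n) (u₁ : SLn n) (t : Fin (n + 1) → ℂ) :
    vPlus n (x * (mat u₁ * Matrix.diagonal t * mat (w0Dot n)⁻¹)) =
      kappa t * vMinus n (x * mat u₁) := by
  rw [← Matrix.mul_assoc, ← Matrix.mul_assoc, ← vMinus_apply, vMinus_mul_lower (diagonal_lower t),
    mul_comm]
  rfl

theorem vPlus_mul (h : HasFactorization b u₁ u₂ t) (x : Mx n) :
    vPlus n (x * mat b) = kappa t * vMinus n (x * mat u₁) := by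
  rw [h.eq, ← Matrix.mul_assoc, vPlus_mul_upper h.right.1,
    vPlus_upper_eq_one h.right.1 h.right.2, mul_one, vPlus_mul_half]

theorem act_vPlus (h : HasFactorization b u₁ u₂ t) :
    act b (vPlus n) = kappa t • act u₁ (vMinus n) := by
  funext x
  exact h.vPlus_mul x

theorem act_vPlus_mem (h : HasFactorization b u₁ u₂ t) : act b (vPlus n) ∈ goodVectors n := by
  rw [h.act_vPlus]
  exact Submodule.smul_mem _ _ (act_vMinus_mem h.left)

theorem vMinus_w0Dot_mul {u : SLn n} (hu : u ∈ upperUnipotent n) :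
    vMinus n (mat (w0Dot n) * mat u) = 1 := by
  rw [vMinus_apply]
  refine vPlus_lower_eq_one (w0_conj_lower hu.1) fun i => ?_
  rw [w0_conj_diag, hu.2]

theorem coeff_act_vPlus (h : HasFactorization b u₁ u₂ t) :
    coeff (act b (vPlus n)) (vMinus n) = kappa t := by
  rw [coeff_eq h.act_vPlus_mem, act_apply, h.vPlus_mul, vMinus_w0Dot_mul h.left, mul_one]

theorem act_lieAct_apply (h : HasFactorization b u₁ u₂ t) (x : Mx n) :
    act b (lieAct (fSum n) (vPlus n)) x =
      polyDeriv (vPlus n) (x * (mat u₁ * Matrix.diagonal t * mat (w0Dot n)⁻¹))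
        (x * (mat u₁ * Matrix.diagonal t * mat (w0Dot n)⁻¹) *
          (mat u₂ * fSum n * mat u₂⁻¹)) := by
  rw [act_apply, lieAct_eq (vPlus_mem_polyFun n), polyDeriv, polyDeriv]
  congr 1
  funext s
  rw [← mul_one (vPlus n (x * (_ * _) + _)), ← vPlus_upper_eq_one h.right.1 h.right.2,
    ← vPlus_mul_upper h.right.1, h.eq, Matrix.add_mul, Matrix.smul_mul]
  simp only [Matrix.mul_assoc]
  rw [mat_inv_mul_mat, Matrix.mul_one]

theorem act_lieAct_mem (h : HasFactorization b u₁ u₂ t) :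
    act b (lieAct (fSum n) (vPlus n)) ∈ goodVectors n := by
  set p := mat u₁ * Matrix.diagonal t * mat (w0Dot n)⁻¹ with hp
  obtain ⟨U, L, hY, hU, hL⟩ := exists_upper_add_strictLower (mat u₂ * fSum n * mat u₂⁻¹)
  have h1 : act b (lieAct (fSum n) (vPlus n)) =
      (fun x => polyDeriv (vPlus n) (x * p) (x * p * U)) +
        fun x => polyDeriv (vPlus n) (x * p) (x * p * L) := by
    funext x
    rw [h.act_lieAct_apply, hY, Matrix.mul_add, polyDeriv_add (vPlus_mem_polyFun n)]
    rfl
  rw [h1]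
  refine add_mem (mem_of_hasDerivAt (isClosed_goodVectors n)
    (g := fun s x => vPlus n (x * p + s • (x * p * U))) (fun s => ?_)
    fun x => hasDerivAt_polyDeriv (vPlus_mem_polyFun n) _ _)
    (mem_of_hasDerivAt (isClosed_goodVectors n)
    (g := fun s x => vPlus n (x * p + s • (x * p * L))) (fun s => ?_)
    fun x => hasDerivAt_polyDeriv (vPlus_mem_polyFun n) _ _)
  · have h2 : (fun x => vPlus n (x * p + s • (x * p * U))) =
        (kappa t * vPlus n (1 + s • U)) • act u₁ (vMinus n) := by
      funext x
      rw [add_smul_mul, vPlus_mul_upper (one_add_smul_upper hU s), hp, vPlus_mul_half,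
        Pi.smul_apply, smul_eq_mul, act_apply]
      ring
    rw [h2]
    exact Submodule.smul_mem _ _ (act_vMinus_mem h.left)
  · set N := mat (w0Dot n)⁻¹ * (1 + s • L) * mat (w0Dot n) with hN
    set N' := Matrix.diagonal t * N * Matrix.diagonal (fun i => (t i)⁻¹) with hN'
    have hL' : ∀ i j, i < j → (1 + s • L) i j = 0 :=
      one_add_smul_lower (fun i j hij => hL i j hij.le) s
    have hN1 : ∀ i j, j < i → N i j = 0 := by
      intro i j hij
      rw [hN, w0_inv_conj_apply, hL' _ _ (Fin.rev_lt_rev.mpr hij), mul_zero]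
    have hN2 : ∀ i, N i i = 1 := by
      intro i
      rw [hN, w0_inv_conj_apply, one_add_smul_diag fun i => hL i i le_rfl, ← mul_pow]
      simp
    have hN'1 : ∀ i j, j < i → N' i j = 0 := by
      intro i j hij
      rw [hN', Matrix.mul_diagonal, Matrix.diagonal_mul, hN1 i j hij, mul_zero, zero_mul]
    have hN'2 : ∀ i, N' i i = 1 := by
      intro i
      rw [hN', Matrix.mul_diagonal, Matrix.diagonal_mul, hN2, mul_one, mul_inv_cancel₀ (h.torus i)]
    have hNN : N' * Matrix.diagonal t = Matrix.diagonal t * N := by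
      rw [hN', Matrix.mul_assoc, Matrix.diagonal_mul_diagonal]
      simp [h.torus]
    have hu := upper_mul h.left.1 h.left.2 hN'1 hN'2
    have h2 : (fun x => vPlus n (x * p + s • (x * p * L))) =
        kappa t • fun x => vMinus n (x * (mat u₁ * N')) := by
      funext x
      have h3 : x * p * (1 + s • L) =
          x * (mat u₁ * N') * Matrix.diagonal t * mat (w0Dot n)⁻¹ := by
        simp only [Matrix.mul_assoc]
        rw [← Matrix.mul_assoc N', hNN, hN, hp]
        simp only [Matrix.mul_assoc]
        rw [mat_mul_mat_inv, Matrix.mul_one]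
      rw [add_smul_mul, h3, ← vMinus_apply, vMinus_mul_lower (diagonal_lower t), mul_comm]
      rfl
    rw [h2]
    exact Submodule.smul_mem _ _ (vMinus_mul_mem hu.1 hu.2)

theorem coeff_act_lieAct (h : HasFactorization b u₁ u₂ t) :
    coeff (act b (lieAct (fSum n) (vPlus n))) (vMinus n) = kappa t * superSum u₂ := by
  rw [coeff_eq h.act_lieAct_mem, h.act_lieAct_apply, ← trace_heightDiag_conj h.right]
  refine HasDerivAt.deriv ?_
  refine ((hasDerivAt_vPlus_one_add_smul _).const_mul (kappa t)).congr_of_eventuallyEq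
    (Filter.Eventually.of_forall fun s => ?_)
  have hl : ∀ i j, i < j → (mat (w0Dot n) * (mat u₁ * Matrix.diagonal t * mat (w0Dot n)⁻¹)) i j
      = 0 := by
    rw [← Matrix.mul_assoc]
    refine w0_conj_lower fun i j hij => ?_
    rw [Matrix.mul_diagonal, h.left.1 i j hij, zero_mul]
  simp only
  rw [add_smul_mul, vPlus_lower_mul hl, vPlus_mul_half, vMinus_w0Dot_mul h.left, mul_one]

theorem lieAct_act_apply (h : HasFactorization b u₁ u₂ t) (x : Mx n) :
    lieAct (fSum n) (act b (vPlus n)) x = kappa t * polyDeriv (vMinus n) (x * mat u₁)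
      (x * mat u₁ * (mat u₁⁻¹ * fSum n * mat u₁⁻¹⁻¹)) := by
  rw [lieAct_eq (act_mem_polyFun b (vPlus_mem_polyFun n))]
  refine HasDerivAt.deriv ?_
  refine ((hasDerivAt_polyDeriv (vMinus_mem_polyFun n) _ _).const_mul
    (kappa t)).congr_of_eventuallyEq (Filter.Eventually.of_forall fun s => ?_)
  simp only
  rw [act_apply, h.vPlus_mul, inv_inv]
  simp only [Matrix.add_mul, Matrix.smul_mul, Matrix.mul_assoc]
  rw [← Matrix.mul_assoc (mat u₁), mat_mul_mat_inv, Matrix.one_mul]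

theorem lieAct_act_mem (h : HasFactorization b u₁ u₂ t) :
    lieAct (fSum n) (act b (vPlus n)) ∈ goodVectors n := by
  obtain ⟨U, L, hY, hU, hL⟩ := exists_strictUpper_add_lower (mat u₁⁻¹ * fSum n * mat u₁⁻¹⁻¹)
  have h1 : lieAct (fSum n) (act b (vPlus n)) = kappa t •
      ((fun x => polyDeriv (vMinus n) (x * mat u₁) (x * mat u₁ * U)) +
        fun x => polyDeriv (vMinus n) (x * mat u₁) (x * mat u₁ * L)) := by
    funext x
    rw [h.lieAct_act_apply, hY, Matrix.mul_add, polyDeriv_add (vMinus_mem_polyFun n)]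
    rfl
  rw [h1]
  refine Submodule.smul_mem _ _ (add_mem (mem_of_hasDerivAt (isClosed_goodVectors n)
    (g := fun s x => vMinus n (x * mat u₁ + s • (x * mat u₁ * U))) (fun s => ?_)
    fun x => hasDerivAt_polyDeriv (vMinus_mem_polyFun n) _ _)
    (mem_of_hasDerivAt (isClosed_goodVectors n)
    (g := fun s x => vMinus n (x * mat u₁ + s • (x * mat u₁ * L))) (fun s => ?_)
    fun x => hasDerivAt_polyDeriv (vMinus_mem_polyFun n) _ _))
  · have hu := upper_mul h.left.1 h.left.2
      (one_add_smul_upper (fun i j hij => hU i j hij.le) s)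
      (one_add_smul_diag (fun i => hU i i le_rfl) s)
    have h2 : (fun x => vMinus n (x * mat u₁ + s • (x * mat u₁ * U))) =
        fun x => vMinus n (x * (mat u₁ * (1 + s • U))) := by
      funext x
      rw [add_smul_mul, Matrix.mul_assoc]
    rw [h2]
    exact vMinus_mul_mem hu.1 hu.2
  · have h2 : (fun x => vMinus n (x * mat u₁ + s • (x * mat u₁ * L))) =
        vPlus n (mat (w0Dot n) * (1 + s • L) * mat (w0Dot n)⁻¹) • act u₁ (vMinus n) := by
      funext x
      rw [add_smul_mul, vMinus_mul_lower (one_add_smul_lower hL s), mul_comm]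
      rfl
    rw [h2]
    exact Submodule.smul_mem _ _ (act_vMinus_mem h.left)

theorem coeff_lieAct_act (h : HasFactorization b u₁ u₂ t) :
    coeff (lieAct (fSum n) (act b (vPlus n))) (vMinus n) = kappa t * superSum u₁ := by
  rw [coeff_eq h.lieAct_act_mem, h.lieAct_act_apply]
  congr 1
  have hu := inv_mem_upperUnipotent h.left
  have htr : (mat u₁⁻¹ * fSum n * mat u₁⁻¹⁻¹).trace = 0 := by
    rw [Matrix.trace_mul_comm, ← Matrix.mul_assoc, inv_inv, mat_mul_mat_inv, trace_mul_fSum]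
    exact Finset.sum_eq_zero fun i _ => Matrix.one_apply_ne (Fin.castSucc_lt_succ).ne
  rw [← neg_neg (superSum u₁), ← superSum_inv h.left, ← trace_heightDiag_conj hu,
    ← trace_heightDiag_w0_conj _ htr]
  refine HasDerivAt.deriv ?_
  refine (hasDerivAt_vPlus_one_add_smul _).congr_of_eventuallyEq
    (Filter.Eventually.of_forall fun s => ?_)
  have hl : ∀ i j, i < j → (mat (w0Dot n) * mat u₁ * mat (w0Dot n)⁻¹) i j = 0 :=
    w0_conj_lower h.left.1
  have hl1 : vPlus n (mat (w0Dot n) * mat u₁ * mat (w0Dot n)⁻¹) = 1 := vMinus_w0Dot_mul h.left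
  simp only
  rw [add_smul_mul, vMinus_apply]
  have h3 : mat (w0Dot n) * mat u₁ * (1 + s • (mat u₁⁻¹ * fSum n * mat u₁⁻¹⁻¹)) *
      mat (w0Dot n)⁻¹ = mat (w0Dot n) * mat u₁ * mat (w0Dot n)⁻¹ *
        (1 + s • (mat (w0Dot n) * (mat u₁⁻¹ * fSum n * mat u₁⁻¹⁻¹) * mat (w0Dot n)⁻¹)) := by
    have h4 : mat (w0Dot n)⁻¹ * (1 + s • (mat (w0Dot n) * (mat u₁⁻¹ * fSum n * mat u₁⁻¹⁻¹) *
        mat (w0Dot n)⁻¹)) = (1 + s • (mat u₁⁻¹ * fSum n * mat u₁⁻¹⁻¹)) * mat (w0Dot n)⁻¹ := by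
      rw [Matrix.mul_add, Matrix.add_mul, Matrix.mul_one, Matrix.one_mul, Matrix.mul_smul,
        Matrix.smul_mul, Matrix.mul_assoc (mat (w0Dot n)), ← Matrix.mul_assoc (mat (w0Dot n)⁻¹),
        mat_inv_mul_mat, Matrix.one_mul]
    rw [Matrix.mul_assoc _ (mat (w0Dot n)⁻¹), h4, Matrix.mul_assoc _ _ (mat (w0Dot n)⁻¹)]
  rw [h3, vPlus_lower_mul hl, hl1, one_mul]

end HasFactorization

theorem exists_mat_eq_smul_of_toGd_eq {n : ℕ} {g h : SLn n} (hgh : toGd g = toGd h) :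
    ∃ r : ℂ, r ≠ 0 ∧ mat g = r • mat h := by
  have h1 : h⁻¹ * g ∈ Subgroup.center (SLn n) := QuotientGroup.eq.mp hgh.symm
  obtain ⟨r, hr, hr'⟩ := Matrix.SpecialLinearGroup.mem_center_iff.mp h1
  refine ⟨r, ?_, ?_⟩
  · rintro rfl
    simp at hr
  · have h2 : mat g = mat h * mat (h⁻¹ * g) := by rw [← mat_mul, mul_inv_cancel_left]
    rw [h2, show mat (h⁻¹ * g) = Matrix.scalar _ r from hr'.symm, Matrix.scalar_apply,
      ← Matrix.smul_one_eq_diagonal, Matrix.mul_smul, Matrix.mul_one]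

theorem phaseB_phiMap {n : ℕ} (T : Ztilde n) : phaseB (phiMap T) =
    superSum (xCNat n (cWeight (tExt T))) + superSum (xDNat n (dWeight (tExt T))) := by
  have h0 : toGd (Quotient.out (betaTilde T)) = toGd (betaSL T) := by
    rw [← betaTilde_eq]
    exact Quotient.out_eq _
  obtain ⟨r, hr, hb⟩ := exists_mat_eq_smul_of_toGd_eq h0
  have h : HasFactorization (Quotient.out (betaTilde T) : SLn n) (xCNat n (cWeight (tExt T)))
      (xDNat n (dWeight (tExt T))) (fun i => r * Complex.exp ((gamma T).1 i)) := by
    refine ⟨xCNat_mem _ _, xDNat_mem _ _, fun i => mul_ne_zero hr (Complex.exp_ne_zero _), ?_⟩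
    rw [hb, betaSL, mat_mul, mat_mul, mat_mul, mat_expSL,
      show (Matrix.diagonal fun i => r * Complex.exp ((gamma T).1 i)) =
        r • Matrix.diagonal fun i => Complex.exp ((gamma T).1 i) from
          by rw [← Matrix.diagonal_smul]; rfl]
    simp only [Matrix.mul_smul, Matrix.smul_mul]
  have hk := kappa_ne_zero h.torus
  change (coeff (lieAct (fSum n) (act (Quotient.out (betaTilde T) : SLn n) (vPlus n))) (vMinus n) +
    coeff (act (Quotient.out (betaTilde T) : SLn n) (lieAct (fSum n) (vPlus n))) (vMinus n)) /
      coeff (act (Quotient.out (betaTilde T) : SLn n) (vPlus n)) (vMinus n) = _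
  rw [h.coeff_act_vPlus, h.coeff_lieAct_act, h.coeff_act_lieAct]
  field_simp

/-! ### The phase functions -/

@[to_additive]
theorem prod_tri {M : Type*} [CommMonoid M] {n : ℕ} (f : ℕ → ℕ → M) :
    ∏ p : Tri n, f p.1.1 p.1.2 =
      ∏ j ∈ Finset.range n, ∏ k ∈ Finset.range n, if k ≤ j then f j k else 1 := by
  have h1 : ∏ p : Tri n, f p.1.1 p.1.2 =
      ∏ p : Fin n × Fin n with p.2 ≤ p.1, f p.1 p.2 :=
    (Finset.prod_subtype _ (by simp) fun p : Fin n × Fin n => f p.1 p.2).symm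
  rw [h1, Finset.prod_filter, Fintype.prod_prod_type,
    ← Fin.prod_univ_eq_prod_range fun j => ∏ k ∈ Finset.range n, if k ≤ j then f j k else 1]
  refine Finset.prod_congr rfl fun j _ => ?_
  rw [← Fin.prod_univ_eq_prod_range fun k => if k ≤ (j : ℕ) then f j k else 1]
  exact Finset.prod_congr rfl fun k _ => rfl

@[to_additive]
theorem prod_tri_level {M : Type*} [CommMonoid M] {n : ℕ} (f : ℕ → ℕ → M) :
    ∏ p : Tri n, f p.1.1 p.1.2 =
      ∏ k ∈ Finset.range n, ∏ j ∈ Finset.range (n - k), f (j + k) j := by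
  rw [prod_tri]
  simp only [← Finset.prod_filter]
  rw [Finset.prod_sigma', Finset.prod_sigma']
  refine Finset.prod_bij' (fun p _ => ⟨p.1 - p.2, p.2⟩) (fun p _ => ⟨p.2 + p.1, p.2⟩)
    ?_ ?_ ?_ ?_ ?_
  · rintro ⟨a, b⟩ h
    simp only [Finset.mem_sigma, Finset.mem_range, Finset.mem_filter] at h ⊢
    omega
  · rintro ⟨a, b⟩ h
    simp only [Finset.mem_sigma, Finset.mem_range, Finset.mem_filter] at h ⊢
    omega
  · rintro ⟨a, b⟩ h
    simp only [Finset.mem_sigma, Finset.mem_range, Finset.mem_filter] at h ⊢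
    rw [show b + (a - b) = a by omega]
  · rintro ⟨a, b⟩ h
    simp
  · rintro ⟨a, b⟩ h
    simp only [Finset.mem_sigma, Finset.mem_range, Finset.mem_filter] at h ⊢
    rw [show b + (a - b) = a by omega]

theorem givPhase_cMap {n : ℕ} (T : Ztilde n) : givPhase (cMap T) =
    superSum (xCNat n (cWeight (tExt T))) + superSum (xDNat n (dWeight (tExt T))) := by
  rw [givPhase, Fintype.sum_sum_type, superSum_xCNat, superSum_xDNat, Finset.sum_comm]
  simp only [cMap_inl, cMap_inr]
  rw [sum_tri, sum_tri]

/-- Summation by parts for the weights of Joe and Kim. -/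
theorem sum_weights_eq {n : ℕ} (l : ℕ → ℂ) (T : ℕ → ℕ → ℂ)
    (hl : ∑ m ∈ Finset.range (n + 1), l m = 0) :
    ∑ k ∈ Finset.range n, ∑ j ∈ Finset.range (n - k),
      ((1 / 2 * l k + if j = 0 then 1 / 2 * ∑ m ∈ Finset.range (k + 1), l m else 0) *
          (T (j + k) j - T (j + k + 1) j) -
        (1 / 2 * l k + if j = n - 1 - k then 1 / 2 * ∑ m ∈ Finset.range (k + 1), l m else 0) *
          (T (j + k + 1) j - T (j + k + 1) (j + 1))) =
      ∑ m ∈ Finset.range (n + 1), l m * (levelSum n T m - levelSum n T (m + 1)) := by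
  have h1 : ∀ k ∈ Finset.range n, ∑ j ∈ Finset.range (n - k),
      ((1 / 2 * l k + if j = 0 then 1 / 2 * ∑ m ∈ Finset.range (k + 1), l m else 0) *
          (T (j + k) j - T (j + k + 1) j) -
        (1 / 2 * l k + if j = n - 1 - k then 1 / 2 * ∑ m ∈ Finset.range (k + 1), l m else 0) *
          (T (j + k + 1) j - T (j + k + 1) (j + 1))) =
      l k * (levelSum n T k - levelSum n T (k + 1)) -
        1 / 2 * ((∑ m ∈ Finset.range (k + 1), l m) * (T (k + 1) 0 + T n (n - (k + 1))) -
          (∑ m ∈ Finset.range k, l m) * (T k 0 + T n (n - k))) := by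
    intro k hk
    have hk' := Finset.mem_range.mp hk
    simp only [add_mul, ite_mul, zero_mul]
    rw [Finset.sum_sub_distrib, Finset.sum_add_distrib, Finset.sum_add_distrib,
      Finset.sum_ite_eq', Finset.sum_ite_eq', if_pos (by simp; omega), if_pos (by simp; omega),
      ← Finset.mul_sum, ← Finset.mul_sum, Finset.sum_sub_distrib, Finset.sum_sub_distrib,
      Finset.sum_range_succ]
    have hA : ∑ j ∈ Finset.range (n - k), T (j + k) j = levelSum n T k - T n (n - k) := by
      rw [levelSum, show n + 1 - k = n - k + 1 by omega, Finset.sum_range_succ,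
        Nat.sub_add_cancel hk'.le]
      ring
    have hB : ∑ j ∈ Finset.range (n - k), T (j + k + 1) j = levelSum n T (k + 1) := by
      rw [levelSum, show n + 1 - (k + 1) = n - k by omega]
      rfl
    have hC : ∑ j ∈ Finset.range (n - k), T (j + k + 1) (j + 1) = levelSum n T k - T k 0 := by
      rw [levelSum, show n + 1 - k = n - k + 1 by omega, Finset.sum_range_succ', zero_add,
        add_sub_cancel_right]
      exact Finset.sum_congr rfl fun j _ => by rw [show j + k + 1 = j + 1 + k by omega]
    rw [hA, hB, hC, show n - 1 - k + k + 1 = n by omega, show n - 1 - k + 1 = n - k by omega,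
      show n - (k + 1) = n - 1 - k by omega, zero_add]
    ring
  rw [Finset.sum_congr rfl h1, Finset.sum_sub_distrib, ← Finset.mul_sum,
    Finset.sum_range_sub (fun k => (∑ m ∈ Finset.range k, l m) * (T k 0 + T n (n - k))),
    Finset.sum_range_succ, Finset.range_zero, Finset.sum_empty]
  have hS : levelSum n T n = T n 0 := by simp [levelSum]
  have hS' : levelSum n T (n + 1) = 0 := by simp [levelSum]
  rw [Finset.sum_range_succ] at hl
  rw [hS, hS', Nat.sub_self]
  linear_combination -(T n 0) * hl

theorem lam_succ {n : ℕ} (h : Cartan n) (m : Fin (n + 1)) : lam h (m + 1) = h.1 m := by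
  rw [lam, dif_pos ⟨by omega, by omega⟩]
  rfl

theorem sum_Ico_lam {n : ℕ} (h : Cartan n) (k : ℕ) :
    ∑ m ∈ Finset.Ico 1 (k + 1), lam h m = ∑ m ∈ Finset.range k, lam h (m + 1) := by
  rw [Finset.sum_Ico_eq_sum_range, Nat.add_sub_cancel]
  exact Finset.sum_congr rfl fun m _ => by rw [add_comm]

theorem sum_arrowWeight {n : ℕ} (T : Ztilde n) (h : Cartan n) :
    ∑ a, arrowWeight h a * (T.1 (head a) - T.1 (tail a)) = pairing h (gammaR T) := by
  have hl : ∑ m ∈ Finset.range (n + 1), lam h (m + 1) = 0 := by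
    rw [← Fin.sum_univ_eq_sum_range fun m => lam h (m + 1)]
    rw [Finset.sum_congr rfl fun m _ => lam_succ h m]
    exact h.2
  have hR : pairing h (gammaR T) = ∑ m ∈ Finset.range (n + 1),
      lam h (m + 1) * (levelSum n (tExt T) m - levelSum n (tExt T) (m + 1)) := by
    rw [← Fin.sum_univ_eq_sum_range fun m =>
      lam h (m + 1) * (levelSum n (tExt T) m - levelSum n (tExt T) (m + 1))]
    refine Finset.sum_congr rfl fun m _ => ?_
    rw [lam_succ, levelSum_tExt, levelSum_tExt]
    rfl
  rw [hR, ← sum_weights_eq _ _ hl, Fintype.sum_sum_type]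
  have hc : ∀ p : Tri n, arrowWeight h (Sum.inl p) *
      (T.1 (head (Sum.inl p)) - T.1 (tail (Sum.inl p))) =
      (fun i j : ℕ => weightC h (i + 1) (j + 1) * (tExt T i j - tExt T (i + 1) j)) p.1.1 p.1.2 := by
    intro p
    rw [← tExt_eq, ← tExt_eq]
    rfl
  have hd : ∀ p : Tri n, arrowWeight h (Sum.inr p) *
      (T.1 (head (Sum.inr p)) - T.1 (tail (Sum.inr p))) =
      (fun i j : ℕ => weightD h (i + 2) (j + 2) * (tExt T (i + 1) j - tExt T (i + 1) (j + 1)))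
        p.1.1 p.1.2 := by
    intro p
    rw [← tExt_eq, ← tExt_eq]
    rfl
  rw [Finset.sum_congr rfl fun p _ => hc p, Finset.sum_congr rfl fun p _ => hd p,
    sum_tri_level fun i j => weightC h (i + 1) (j + 1) * (tExt T i j - tExt T (i + 1) j),
    sum_tri_level fun i j =>
      weightD h (i + 2) (j + 2) * (tExt T (i + 1) j - tExt T (i + 1) (j + 1)),
    ← Finset.sum_add_distrib]
  refine Finset.sum_congr rfl fun k hk => ?_
  rw [← Finset.sum_add_distrib]
  refine Finset.sum_congr rfl fun j hj => ?_
  rw [Finset.mem_range] at hk hj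
  have h1 : weightC h (j + k + 1) (j + 1) = 1 / 2 * lam h (k + 1) +
      if j = 0 then 1 / 2 * ∑ m ∈ Finset.range (k + 1), lam h (m + 1) else 0 := by
    rw [weightC]
    by_cases h0 : j = 0
    · subst h0
      rw [if_pos rfl, if_pos rfl, zero_add, sum_Ico_lam, Finset.sum_range_succ]
      ring
    · rw [if_neg (by omega), if_neg h0, add_zero]
      congr 2
      omega
  have h2 : weightD h (j + k + 2) (j + 2) = -(1 / 2 * lam h (k + 1) +
      if j = n - 1 - k then 1 / 2 * ∑ m ∈ Finset.range (k + 1), lam h (m + 1) else 0) := by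
    rw [weightD]
    by_cases h0 : j = n - 1 - k
    · rw [if_pos (by omega), if_pos h0, show n + 2 - (j + 2) = k + 1 by omega, sum_Ico_lam,
        Finset.sum_range_succ]
      ring
    · rw [if_neg (by omega), if_neg h0, add_zero, show j + k + 2 - (j + 2) + 1 = k + 1 by omega]
  rw [h1, h2]
  ring

theorem exp_phaseB_mul_phiTilde {n : ℕ} (h : Cartan n) (T : Ztilde n) :
    Complex.exp (phaseB (phiMap T)) * phiTilde (phiMap T) h = Complex.exp (phaseJK T h) := by
  rw [phaseB_phiMap, ← givPhase_cMap, phiTilde, phaseJK, Complex.exp_add, sum_arrowWeight]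
  rfl

/-! ### Words in the simple transpositions -/

/-- A simple transposition. -/
def sPerm {n : ℕ} (i : Fin n) : Equiv.Perm (Fin (n + 1)) := Equiv.swap i.castSucc i.succ

/-- The permutation represented by a word. -/
def wordPerm {n : ℕ} (L : List (Fin n)) : Equiv.Perm (Fin (n + 1)) := (L.map sPerm).prod

theorem wordPerm_cons {n : ℕ} (i : Fin n) (L : List (Fin n)) :
    wordPerm (i :: L) = sPerm i * wordPerm L := by
  rw [wordPerm, List.map_cons, List.prod_cons]
  rfl

theorem sPerm_mul_self {n : ℕ} (i : Fin n) : sPerm i * sPerm i = 1 := Equiv.swap_mul_self _ _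

theorem sPerm_apply_val {n : ℕ} (i : Fin n) (a : Fin (n + 1)) :
    (sPerm i a : ℕ) = if (a : ℕ) = i then (i : ℕ) + 1 else if (a : ℕ) = i + 1 then (i : ℕ)
      else a := by
  rw [sPerm, Equiv.swap_apply_def]
  simp only [Fin.ext_iff, Fin.val_castSucc, Fin.val_succ]
  split_ifs <;> simp

/-- The inversions of a permutation. -/
def inversions {n : ℕ} (v : Equiv.Perm (Fin (n + 1))) : Finset (Fin (n + 1) × Fin (n + 1)) :=
  Finset.univ.filter fun p => p.1 < p.2 ∧ v p.2 < v p.1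

theorem mem_inversions {n : ℕ} {v : Equiv.Perm (Fin (n + 1))} {p : Fin (n + 1) × Fin (n + 1)} :
    p ∈ inversions v ↔ p.1 < p.2 ∧ v p.2 < v p.1 := by
  simp [inversions]

theorem card_inversions_mul_sPerm {n : ℕ} (v : Equiv.Perm (Fin (n + 1))) (i : Fin n)
    (h : v i.castSucc < v i.succ) :
    (inversions (v * sPerm i)).card = (inversions v).card + 1 := by
  have h1 : (i.castSucc, i.succ) ∉ inversions v := fun h' => absurd (mem_inversions.mp h').2 h.not_gt
  have hs1 : sPerm i i.castSucc = i.succ := Equiv.swap_apply_left _ _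
  have hs2 : sPerm i i.succ = i.castSucc := Equiv.swap_apply_right _ _
  have hss : ∀ a, sPerm i (sPerm i a) = a := fun a => by
    rw [← Equiv.Perm.mul_apply, sPerm_mul_self, Equiv.Perm.one_apply]
  have hord : ∀ a b : Fin (n + 1), a < b → (a, b) ≠ (i.castSucc, i.succ) →
      sPerm i a < sPerm i b := by
    intro a b hab hne
    have hne' : ¬((a : ℕ) = i ∧ (b : ℕ) = i + 1) := fun h' =>
      hne (Prod.ext (Fin.ext h'.1) (Fin.ext h'.2))
    rw [Fin.lt_def] at hab ⊢
    rw [sPerm_apply_val, sPerm_apply_val]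
    split_ifs <;> omega
  rw [← Finset.card_insert_of_notMem h1]
  symm
  have himg : ∀ a b : Fin (n + 1), (a, b) ≠ (i.castSucc, i.succ) → a < b →
      (sPerm i a, sPerm i b) ≠ (i.castSucc, i.succ) := by
    intro a b _ hab h'
    have h2 := congrArg (sPerm i) (Prod.ext_iff.mp h').1
    have h3 := congrArg (sPerm i) (Prod.ext_iff.mp h').2
    simp only [hss, hs1, hs2] at h2 h3
    rw [h2, h3, Fin.lt_def] at hab
    simp at hab
  refine Finset.card_bij' (fun p _ => if p = (i.castSucc, i.succ) then p else
      (sPerm i p.1, sPerm i p.2)) (fun p _ => if p = (i.castSucc, i.succ) then p else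
      (sPerm i p.1, sPerm i p.2)) ?_ ?_ ?_ ?_
  · rintro ⟨a, b⟩ hp
    split_ifs with hab
    · rw [hab, mem_inversions]
      refine ⟨Fin.castSucc_lt_succ, ?_⟩
      rw [Equiv.Perm.mul_apply, Equiv.Perm.mul_apply, hs1, hs2]
      exact h
    · obtain ⟨h3, h4⟩ := mem_inversions.mp (Finset.mem_of_mem_insert_of_ne hp hab)
      rw [mem_inversions]
      refine ⟨hord _ _ h3 hab, ?_⟩
      rw [Equiv.Perm.mul_apply, Equiv.Perm.mul_apply, hss, hss]
      exact h4
  · rintro ⟨a, b⟩ hp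
    split_ifs with hab
    · rw [hab]
      exact Finset.mem_insert_self _ _
    · obtain ⟨h3, h4⟩ := mem_inversions.mp hp
      refine Finset.mem_insert_of_mem (mem_inversions.mpr ⟨hord _ _ h3 hab, ?_⟩)
      rwa [Equiv.Perm.mul_apply, Equiv.Perm.mul_apply] at h4
  · rintro ⟨a, b⟩ hp
    by_cases hab : (a, b) = (i.castSucc, i.succ)
    · simp only [if_pos hab]
    · obtain ⟨h3, -⟩ := mem_inversions.mp (Finset.mem_of_mem_insert_of_ne hp hab)
      simp only [if_neg hab]
      rw [if_neg (himg a b hab h3)]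
      simp only [hss]
  · rintro ⟨a, b⟩ hp
    by_cases hab : (a, b) = (i.castSucc, i.succ)
    · simp only [if_pos hab]
    · obtain ⟨h3, -⟩ := mem_inversions.mp hp
      simp only [if_neg hab]
      rw [if_neg (himg a b hab h3)]
      simp only [hss]

/-- The length of a permutation. -/
def permLength {n : ℕ} (w : Equiv.Perm (Fin (n + 1))) : ℕ := (inversions w⁻¹).card

/-- The simple transposition `i` is a left descent of `w`. -/
def IsDescent {n : ℕ} (w : Equiv.Perm (Fin (n + 1))) (i : Fin n) : Prop :=
  w⁻¹ i.succ < w⁻¹ i.castSucc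

theorem sPerm_mul_inv {n : ℕ} (i : Fin n) (w : Equiv.Perm (Fin (n + 1))) :
    (sPerm i * w)⁻¹ = w⁻¹ * sPerm i := by
  rw [_root_.mul_inv_rev, sPerm, Equiv.swap_inv]

theorem permLength_sPerm_mul {n : ℕ} {w : Equiv.Perm (Fin (n + 1))} {i : Fin n}
    (h : ¬IsDescent w i) : permLength (sPerm i * w) = permLength w + 1 := by
  rw [permLength, sPerm_mul_inv]
  refine card_inversions_mul_sPerm _ _ (lt_of_le_of_ne (not_lt.mp h) fun h' => ?_)
  exact (Fin.castSucc_lt_succ (i := i)).ne (w⁻¹.injective h')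

theorem isDescent_sPerm_mul {n : ℕ} {w : Equiv.Perm (Fin (n + 1))} {i : Fin n} :
    IsDescent (sPerm i * w) i ↔ ¬IsDescent w i := by
  rw [IsDescent, IsDescent, sPerm_mul_inv, Equiv.Perm.mul_apply, Equiv.Perm.mul_apply, sPerm,
    Equiv.swap_apply_left, Equiv.swap_apply_right, not_lt]
  refine ⟨le_of_lt, fun h => lt_of_le_of_ne h fun h' => ?_⟩
  exact (Fin.castSucc_lt_succ (i := i)).ne (w⁻¹.injective h')

theorem permLength_sPerm_mul_add_one {n : ℕ} {w : Equiv.Perm (Fin (n + 1))} {i : Fin n}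
    (h : IsDescent w i) : permLength (sPerm i * w) + 1 = permLength w := by
  have h1 : sPerm i * (sPerm i * w) = w := by rw [← mul_assoc, sPerm_mul_self, one_mul]
  rw [← permLength_sPerm_mul (i := i) (w := sPerm i * w), h1]
  rw [isDescent_sPerm_mul, not_not]
  exact h

theorem permLength_le {n : ℕ} (L : List (Fin n)) : permLength (wordPerm L) ≤ L.length := by
  induction L with
  | nil =>
    refine (Finset.card_eq_zero.mpr (Finset.eq_empty_of_forall_notMem fun p hp => ?_)).le
    have h := mem_inversions.mp hp
    simp only [wordPerm, List.map_nil, List.prod_nil, inv_one, Equiv.Perm.one_apply] at h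
    exact absurd h.1 h.2.not_gt
  | cons i L ih =>
    rw [wordPerm_cons, List.length_cons]
    by_cases h : IsDescent (wordPerm L) i
    · have := permLength_sPerm_mul_add_one h
      omega
    · rw [permLength_sPerm_mul h]
      omega

theorem exists_isDescent {n : ℕ} {w : Equiv.Perm (Fin (n + 1))} (hw : w ≠ 1) :
    ∃ i, IsDescent w i := by
  by_contra! h
  have hm : StrictMono (w⁻¹ : Equiv.Perm (Fin (n + 1))) := Fin.strictMono_iff_lt_succ.mpr fun i =>
    lt_of_le_of_ne (not_lt.mp (h i)) fun h' => (Fin.castSucc_lt_succ (i := i)).ne (w⁻¹.injective h')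
  refine hw (inv_eq_one.mp (Equiv.ext fun a => ?_))
  have := Subsingleton.elim (OrderIso.ofRelIsoLT ⟨w⁻¹, hm.lt_iff_lt⟩) (OrderIso.refl _)
  exact congrArg (fun f : Fin (n + 1) ≃o Fin (n + 1) => f a) this

theorem exists_word {n : ℕ} (w : Equiv.Perm (Fin (n + 1))) :
    ∃ L : List (Fin n), wordPerm L = w ∧ L.length = permLength w := by
  induction hk : permLength w generalizing w with
  | zero =>
    refine ⟨[], ?_, rfl⟩
    by_contra h
    obtain ⟨i, hi⟩ := exists_isDescent (Ne.symm h)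
    have := permLength_sPerm_mul_add_one hi
    omega
  | succ k ih =>
    have h : w ≠ 1 := by
      rintro rfl
      have := permLength_le (n := n) []
      have h2 : permLength (1 : Equiv.Perm (Fin (n + 1))) ≤ 0 := this
      omega
    obtain ⟨i, hi⟩ := exists_isDescent h
    have h1 := permLength_sPerm_mul_add_one hi
    obtain ⟨L, hL, hL'⟩ := ih (sPerm i * w) (by omega)
    exact ⟨i :: L, by rw [wordPerm_cons, hL, ← mul_assoc, sPerm_mul_self, one_mul],
      by rw [List.length_cons, hL']⟩

theorem isDescent_of_isDescent_far {n : ℕ} {w : Equiv.Perm (Fin (n + 1))} {i j : Fin n}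
    (hij : (i : ℕ) + 1 < j ∨ (j : ℕ) + 1 < i) (hj : IsDescent w j) :
    IsDescent (sPerm i * w) j := by
  have h1 : sPerm i j.castSucc = j.castSucc := by
    refine Fin.ext ?_
    rw [sPerm_apply_val, Fin.val_castSucc]
    split_ifs <;> omega
  have h2 : sPerm i j.succ = j.succ := by
    refine Fin.ext ?_
    rw [sPerm_apply_val, Fin.val_succ]
    split_ifs <;> omega
  rw [IsDescent, sPerm_mul_inv, Equiv.Perm.mul_apply, Equiv.Perm.mul_apply, h1, h2]
  exact hj

theorem isDescent_of_isDescent_adjacent {n : ℕ} {w : Equiv.Perm (Fin (n + 1))} {i j : Fin n}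
    (hij : (i : ℕ) + 1 = j ∨ (j : ℕ) + 1 = i) (hi : IsDescent w i) (hj : IsDescent w j) :
    IsDescent (sPerm i * w) j ∧ IsDescent (sPerm j * (sPerm i * w)) i := by
  rw [IsDescent] at hi hj
  simp only [IsDescent, sPerm_mul_inv, Equiv.Perm.mul_apply]
  rcases hij with h | h
  · have e1 : j.castSucc = i.succ := Fin.ext h.symm
    have s1 : sPerm i j.succ = j.succ := Fin.ext (by
      rw [sPerm_apply_val, Fin.val_succ]; split_ifs <;> omega)
    have s2 : sPerm i i.succ = i.castSucc := Equiv.swap_apply_right _ _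
    have s3 : sPerm j i.succ = j.succ := by rw [← e1]; exact Equiv.swap_apply_left _ _
    have s4 : sPerm j i.castSucc = i.castSucc := Fin.ext (by
      rw [sPerm_apply_val, Fin.val_castSucc]; split_ifs <;> omega)
    have s5 : sPerm i i.castSucc = i.succ := Equiv.swap_apply_left _ _
    rw [e1] at hj ⊢
    rw [s1, s2, s3, s4, s1, s5]
    exact ⟨hj.trans hi, hj⟩
  · have e1 : i.castSucc = j.succ := Fin.ext h.symm
    have s1 : sPerm i j.castSucc = j.castSucc := Fin.ext (by
      rw [sPerm_apply_val, Fin.val_castSucc]; split_ifs <;> omega)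
    have s2 : sPerm i j.succ = i.succ := by rw [← e1]; exact Equiv.swap_apply_left _ _
    have s3 : sPerm j j.succ = j.castSucc := Equiv.swap_apply_right _ _
    have s4 : sPerm j i.succ = i.succ := Fin.ext (by
      rw [sPerm_apply_val, Fin.val_succ]; split_ifs <;> omega)
    have s5 : sPerm i i.succ = j.succ := by rw [← e1]; exact Equiv.swap_apply_right _ _
    rw [e1] at hi ⊢
    rw [s1, s2, s4, s3, s1, s5]
    exact ⟨hi.trans hj, hj⟩

theorem sPerm_far {n : ℕ} {i j : Fin n} (hij : (i : ℕ) + 1 < j ∨ (j : ℕ) + 1 < i) :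
    sPerm i * sPerm j = sPerm j * sPerm i := by
  refine Equiv.ext fun a => Fin.ext ?_
  simp only [Equiv.Perm.mul_apply, sPerm_apply_val]
  split_ifs <;> omega

theorem sPerm_braid {n : ℕ} {i j : Fin n} (hij : (i : ℕ) + 1 = j) :
    sPerm i * sPerm j * sPerm i = sPerm j * sPerm i * sPerm j := by
  have e : j.castSucc = i.succ := Fin.ext hij.symm
  have h1 : i.castSucc ≠ i.succ := (Fin.castSucc_lt_succ).ne
  have h2 : i.castSucc ≠ j.succ := fun h => by
    have := congrArg Fin.val h
    simp at this
    omega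
  have h3 : i.succ ≠ j.succ := by
    rw [← e]
    exact (Fin.castSucc_lt_succ).ne
  rw [sPerm, sPerm, e, Equiv.swap_mul_swap_mul_swap h1 h2, Equiv.swap_comm i.succ j.succ,
    Equiv.swap_comm i.castSucc i.succ, Equiv.swap_mul_swap_mul_swap h3.symm h2.symm,
    Equiv.swap_comm]

theorem sPerm_adjacent {n : ℕ} {i j : Fin n} (hij : (i : ℕ) + 1 = j ∨ (j : ℕ) + 1 = i) :
    sPerm i * sPerm j * sPerm i = sPerm j * sPerm i * sPerm j :=
  hij.elim sPerm_braid fun h => (sPerm_braid h).symm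

/-- Matsumoto's theorem: a property of words which is invariant under commutation and braid moves
passes from one reduced word of a permutation to the others. -/
theorem reduced_word_induction {n : ℕ} {Q : List (Fin n) → Prop}
    (hcomm : ∀ (A B : List (Fin n)) (i j : Fin n), ((i : ℕ) + 1 < j ∨ (j : ℕ) + 1 < i) →
      Q (A ++ i :: j :: B) → Q (A ++ j :: i :: B))
    (hbraid : ∀ (A B : List (Fin n)) (i j : Fin n), ((i : ℕ) + 1 = j ∨ (j : ℕ) + 1 = i) →
      Q (A ++ i :: j :: i :: B) → Q (A ++ j :: i :: j :: B)) :
    ∀ (k : ℕ) (L L' A : List (Fin n)), L.length = k → L'.length = k → wordPerm L = wordPerm L' →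
      permLength (wordPerm L) = k → Q (A ++ L) → Q (A ++ L') := by
  intro k
  induction k using Nat.strong_induction_on with
  | _ k ih =>
    intro L L' A hL hL' heq hred hQ
    match L, L' with
    | [], [] => exact hQ
    | [], j :: M' => simp at hL hL'; omega
    | i :: M, [] => simp at hL hL'; omega
    | i :: M, j :: M' =>
      rw [List.length_cons] at hL hL'
      have hk : M.length < k := by omega
      have hcancel : ∀ (i : Fin n) (w : Equiv.Perm (Fin (n + 1))), sPerm i * (sPerm i * w) = w :=
        fun i w => by rw [← mul_assoc, sPerm_mul_self, one_mul]
      have happ : ∀ (i : Fin n) (M : List (Fin n)), A ++ i :: M = A ++ [i] ++ M := fun i M => by simp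
      set w := wordPerm (i :: M) with hw
      have hM : wordPerm M = sPerm i * w := by rw [hw, wordPerm_cons, hcancel]
      have hM' : wordPerm M' = sPerm j * w := by rw [heq, wordPerm_cons, hcancel]
      have hdesc : ∀ (i : Fin n) (M : List (Fin n)), M.length + 1 = k → wordPerm M = sPerm i * w →
          IsDescent w i := by
        intro i M hMk hMw
        by_contra hn
        have h1 := permLength_sPerm_mul hn
        have h2 := permLength_le M
        rw [hMw] at h2
        omega
      have hdi := hdesc i M hL hM
      have hdj := hdesc j M' hL' hM'
      have hli := permLength_sPerm_mul_add_one hdi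
      have hlj := permLength_sPerm_mul_add_one hdj
      by_cases hij : i = j
      · subst hij
        rw [happ] at hQ ⊢
        exact ih M.length hk M M' _ rfl (by omega) (by rw [hM, hM']) (by rw [hM]; omega) hQ
      · by_cases hfar : (i : ℕ) + 1 < j ∨ (j : ℕ) + 1 < i
        · have hd := isDescent_of_isDescent_far hfar hdj
          have hl := permLength_sPerm_mul_add_one hd
          obtain ⟨N, hN, hN'⟩ := exists_word (sPerm j * (sPerm i * w))
          have h1 : Q (A ++ i :: j :: N) := by
            rw [happ] at hQ ⊢
            refine ih M.length hk M (j :: N) _ rfl ?_ ?_ (by rw [hM]; omega) hQ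
            · rw [List.length_cons]; omega
            · rw [wordPerm_cons, hN, hcancel, hM]
          have h2 := hcomm A N i j hfar h1
          rw [happ] at h2 ⊢
          have h3 : wordPerm (i :: N) = sPerm j * w := by
            rw [wordPerm_cons, hN, ← mul_assoc, ← mul_assoc, sPerm_far hfar, mul_assoc, mul_assoc,
              hcancel]
          refine ih M.length hk (i :: N) M' _ ?_ (by omega) ?_ ?_ h2
          · rw [List.length_cons]; omega
          · rw [h3, hM']
          · rw [h3]; omega
        · have hadj : (i : ℕ) + 1 = j ∨ (j : ℕ) + 1 = i := by
            have : (i : ℕ) ≠ j := fun h => hij (Fin.ext h)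
            omega
          obtain ⟨hd1, hd2⟩ := isDescent_of_isDescent_adjacent hadj hdi hdj
          have hl1 := permLength_sPerm_mul_add_one hd1
          have hl2 := permLength_sPerm_mul_add_one hd2
          obtain ⟨N, hN, hN'⟩ := exists_word (sPerm i * (sPerm j * (sPerm i * w)))
          have h1 : Q (A ++ i :: j :: i :: N) := by
            rw [happ] at hQ ⊢
            refine ih M.length hk M (j :: i :: N) _ rfl ?_ ?_ (by rw [hM]; omega) hQ
            · simp only [List.length_cons]; omega
            · rw [wordPerm_cons, wordPerm_cons, hN, hcancel, hcancel, hM]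
          have h2 := hbraid A N i j hadj h1
          rw [happ] at h2 ⊢
          have h3 : wordPerm (i :: j :: N) = sPerm j * w := by
            have h4 := sPerm_adjacent hadj
            rw [wordPerm_cons, wordPerm_cons, hN]
            calc sPerm i * (sPerm j * (sPerm i * (sPerm j * (sPerm i * w))))
                = (sPerm i * sPerm j * sPerm i) * (sPerm j * (sPerm i * w)) := by
                  simp only [mul_assoc]
              _ = sPerm j * w := by
                  rw [h4]
                  simp only [mul_assoc, hcancel]
          refine ih M.length hk (i :: j :: N) M' _ ?_ (by omega) ?_ ?_ h2
          · simp only [List.length_cons]; omega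
          · rw [h3, hM']
          · rw [h3]; omega

/-! ### The standard word -/

/-- The positions of the standard reduced word, in order. -/
def stdList (n : ℕ) : List (Tri n) :=
  (List.finRange n).flatMap fun k => (List.finRange n).reverse.filterMap fun j =>
    if h : k ≤ j then some ⟨(j, k), h⟩ else none

theorem stdProd_eq_prod_map {n : ℕ} (F : ∀ j k : Fin n, k ≤ j → SLn n) :
    stdProd F = ((stdList n).map fun p => F p.1.1 p.1.2 p.2).prod := by
  have hinner : ∀ (k : Fin n) (L : List (Fin n)),
      (L.map fun j => if hkj : k ≤ j then F j k hkj else 1).prod =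
        ((L.filterMap fun j => if h : k ≤ j then some (⟨(j, k), h⟩ : Tri n) else none).map
          fun p => F p.1.1 p.1.2 p.2).prod := by
    intro k L
    induction L with
    | nil => rfl
    | cons j L ih =>
      by_cases h : k ≤ j
      · rw [List.filterMap_cons_some (b := (⟨(j, k), h⟩ : Tri n)) (by rw [dif_pos h]),
          List.map_cons, List.map_cons, List.prod_cons, List.prod_cons, ih, dif_pos h]
      · rw [List.filterMap_cons_none (by rw [dif_neg h]), List.map_cons, List.prod_cons, ih,
          dif_neg h, one_mul]
  have houter : ∀ L : List (Fin n),
      (L.map fun k => ((List.finRange n).reverse.map fun j =>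
        if hkj : k ≤ j then F j k hkj else 1).prod).prod =
      ((L.flatMap fun k => (List.finRange n).reverse.filterMap fun j =>
        if h : k ≤ j then some (⟨(j, k), h⟩ : Tri n) else none).map
          fun p => F p.1.1 p.1.2 p.2).prod := by
    intro L
    induction L with
    | nil => rfl
    | cons k L ih =>
      rw [List.map_cons, List.prod_cons, ih, List.flatMap_cons, List.map_append, List.prod_append,
        hinner]
  exact houter _

theorem mem_stdList {n : ℕ} (p : Tri n) : p ∈ stdList n := by
  rw [stdList, List.mem_flatMap]
  refine ⟨p.1.2, List.mem_finRange _, List.mem_filterMap.mpr ⟨p.1.1, ?_, ?_⟩⟩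
  · rw [List.mem_reverse]
    exact List.mem_finRange _
  · rw [dif_pos p.2]

theorem nodup_stdList (n : ℕ) : (stdList n).Nodup := by
  rw [stdList, List.nodup_flatMap]
  have hval : ∀ (k j : Fin n) (p : Tri n),
      p ∈ (if h : k ≤ j then some (⟨(j, k), h⟩ : Tri n) else none) → p.1 = (j, k) := by
    intro k j p hp
    split_ifs at hp with h
    · rw [← Option.mem_some_iff.mp hp]
    · simp at hp
  refine ⟨fun k _ => ?_, ?_⟩
  · refine List.Nodup.filterMap (fun j j' p hp hp' => ?_) (List.nodup_reverse.mpr (List.nodup_finRange n))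
    have h1 := hval _ _ _ hp
    rw [hval _ _ _ hp'] at h1
    exact (Prod.ext_iff.mp h1).1.symm
  · refine List.Pairwise.imp ?_ (List.nodup_finRange n)
    intro k k' hk p hp hp'
    obtain ⟨j, -, hj⟩ := List.mem_filterMap.mp hp
    obtain ⟨j', -, hj'⟩ := List.mem_filterMap.mp hp'
    have h1 := hval k j p hj
    rw [hval k' j' p hj'] at h1
    exact hk (Prod.ext_iff.mp h1).2.symm

theorem card_tri (n : ℕ) : Fintype.card (Tri n) = nB n := by
  have h1 : Fintype.card (Tri n) = ∑ j : Fin n, ((j : ℕ) + 1) := by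
    rw [Fintype.card_subtype, ← Finset.univ_product_univ, Finset.card_filter, Finset.sum_product]
    refine Finset.sum_congr rfl fun j _ => ?_
    rw [← Finset.card_filter]
    rw [← Fin.card_Iic j]
    congr 1
    ext k
    simp
  rw [h1, Fin.sum_univ_eq_sum_range (fun j => j + 1) n]
  have h2 := Finset.sum_range_succ' (fun j => j) n
  rw [add_zero] at h2
  rw [← h2, Finset.sum_range_id]
  simp [nB, mul_comm]

theorem length_stdList (n : ℕ) : (stdList n).length = nB n := by
  rw [← card_tri, ← List.toFinset_card_of_nodup (nodup_stdList n), ← Finset.card_univ]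
  congr 1
  ext p
  simp [mem_stdList]

/-- The enumeration of the letters of the standard word. -/
def stdEquiv (n : ℕ) : Fin (nB n) ≃ Tri n :=
  (finCongr (length_stdList n).symm).trans
    ((nodup_stdList n).getEquivOfForallMemList _ mem_stdList)

theorem ofFn_stdEquiv {n : ℕ} : (List.ofFn fun l => stdEquiv n l) = stdList n := by
  refine List.ext_getElem (by rw [List.length_ofFn, length_stdList]) fun i h1 h2 => ?_
  rw [List.getElem_ofFn]
  rfl

theorem prod_ofFn_stdEquiv {n : ℕ} {M : Type*} [Monoid M] (g : Tri n → M) :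
    (List.ofFn fun l => g (stdEquiv n l)).prod = ((stdList n).map g).prod := by
  rw [← ofFn_stdEquiv, List.map_ofFn]
  rfl

/-- The standard reduced word `(n, …, 1, n, …, 2, …, n)`. -/
def stdWord (n : ℕ) (l : Fin (nB n)) : Fin n := (stdEquiv n l).1.1

theorem mat_prod_sDot_ne_zero {n : ℕ} (L : List (Fin n)) (p q : Fin (n + 1)) :
    mat ((L.map sDot).prod) p q ≠ 0 ↔ p = wordPerm L q := by
  induction L using List.reverseRecOn generalizing q with
  | nil =>
    simp only [wordPerm, List.map_nil, List.prod_nil, mat_one, Equiv.Perm.one_apply,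
      Matrix.one_apply]
    simp
  | append_singleton L i ih =>
    have h1 : wordPerm (L ++ [i]) q = wordPerm L (sPerm i q) := by
      simp [wordPerm]
    have h2 : ((L ++ [i]).map sDot).prod = (L.map sDot).prod * sDot i := by simp
    rw [h1, h2, ← ih, mat_mul]
    have h3 := ent_mul_sd (n := n) i.2 (mat (L.map sDot).prod) p q
    rw [sd, dif_pos i.2, ent_val] at h3
    rw [show (⟨(i : ℕ), i.2⟩ : Fin n) = i from rfl] at h3
    rw [h3, ← ent_val (mat (L.map sDot).prod) p (sPerm i q), sPerm_apply_val]
    split_ifs <;> simp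

theorem isReducedW0_iff {n : ℕ} (w : Fin (nB n) → Fin n) :
    IsReducedW0 w ↔ wordPerm (List.ofFn w) = Fin.revPerm := by
  rw [IsReducedW0, wordPerm, List.map_ofFn]
  rfl

theorem isReducedW0_stdWord (n : ℕ) : IsReducedW0 (stdWord n) := by
  rw [isReducedW0_iff]
  refine Equiv.ext fun q => ?_
  have h1 : (List.ofFn (stdWord n)).map sDot = (stdList n).map fun p => sDot p.1.1 := by
    rw [← ofFn_stdEquiv, List.map_ofFn, List.map_ofFn]
    rfl
  have h2 : w0Dot n = ((List.ofFn (stdWord n)).map sDot).prod := by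
    rw [h1, w0Dot, stdProd_eq_prod_map]
  have h3 := mat_prod_sDot_ne_zero (List.ofFn (stdWord n)) (Fin.rev q) q
  rw [← h2, mat_w0Dot_apply, if_pos (Fin.rev_rev q).symm] at h3
  exact (h3.mp (by simp)).symm

theorem permLength_revPerm (n : ℕ) :
    permLength (Fin.revPerm : Equiv.Perm (Fin (n + 1))) = nB n := by
  rw [permLength, ← card_tri, ← Fintype.card_coe]
  refine Fintype.card_congr ⟨fun p => ⟨(⟨p.1.2 - 1, ?_⟩, ⟨p.1.1, ?_⟩), ?_⟩,
    fun p => ⟨(p.1.2.castSucc, p.1.1.succ), ?_⟩, ?_, ?_⟩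
  · have := (mem_inversions.mp p.2).1
    omega
  · have := (mem_inversions.mp p.2).1
    omega
  · have := (mem_inversions.mp p.2).1
    rw [Fin.le_def]
    simp only
    omega
  · have h := p.2
    refine mem_inversions.mpr ⟨?_, ?_⟩
    · rw [Fin.lt_def, Fin.val_castSucc, Fin.val_succ]
      exact Nat.lt_succ_of_le h
    · rw [show (Fin.revPerm : Equiv.Perm (Fin (n + 1)))⁻¹ = Fin.revPerm from Fin.revPerm_symm,
        Fin.revPerm_apply, Fin.revPerm_apply, Fin.rev_lt_rev, Fin.lt_def, Fin.val_castSucc,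
        Fin.val_succ]
      exact Nat.lt_succ_of_le h
  · rintro ⟨⟨a, b⟩, hp⟩
    have := (mem_inversions.mp hp).1
    refine Subtype.ext (Prod.ext (Fin.ext ?_) (Fin.ext ?_))
    · simp
    · simp only [Fin.val_succ]
      simp only at this
      omega
  · rintro ⟨⟨a, b⟩, hp⟩
    refine Subtype.ext (Prod.ext (Fin.ext ?_) (Fin.ext ?_)) <;> simp

/-- A property of words which is invariant under commutation and braid moves and holds for the
standard reduced word of `w₀` holds for all of them. -/
theorem reducedW0_induction {n : ℕ} {Q : List (Fin n) → Prop}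
    (hcomm : ∀ (A B : List (Fin n)) (i j : Fin n), ((i : ℕ) + 1 < j ∨ (j : ℕ) + 1 < i) →
      Q (A ++ i :: j :: B) → Q (A ++ j :: i :: B))
    (hbraid : ∀ (A B : List (Fin n)) (i j : Fin n), ((i : ℕ) + 1 = j ∨ (j : ℕ) + 1 = i) →
      Q (A ++ i :: j :: i :: B) → Q (A ++ j :: i :: j :: B))
    (hstd : Q (List.ofFn (stdWord n))) (w : Fin (nB n) → Fin n) (hw : IsReducedW0 w) :
    Q (List.ofFn w) := by
  rw [isReducedW0_iff] at hw
  have h := (isReducedW0_iff _).mp (isReducedW0_stdWord n)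
  exact reduced_word_induction hcomm hbraid (nB n) (List.ofFn (stdWord n)) (List.ofFn w) []
    (List.length_ofFn) (List.length_ofFn) (h.trans hw.symm) (by rw [h, permLength_revPerm]) hstd

/-! ### Charts given by words -/

/-- `x_{i_1}(t_1) ⋯ x_{i_N}(t_N)` for a word `(i_1, …, i_N)`. -/
def wordProd {n : ℕ} : List (Fin n) → (ℕ → ℂ) → SLn n
  | [], _ => 1
  | i :: L, t => xRoot i (t 0) * wordProd L fun k => t (k + 1)

theorem wordProd_append {n : ℕ} (A B : List (Fin n)) (t : ℕ → ℂ) :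
    wordProd (A ++ B) t = wordProd A t * wordProd B fun k => t (k + A.length) := by
  induction A generalizing t with
  | nil => simp [wordProd]
  | cons i A ih =>
    rw [List.cons_append, wordProd, wordProd, ih, mul_assoc]
    congr 3

theorem wordProd_congr {n : ℕ} {L : List (Fin n)} {s t : ℕ → ℂ} (h : ∀ k < L.length, s k = t k) :
    wordProd L s = wordProd L t := by
  induction L generalizing s t with
  | nil => rfl
  | cons i L ih =>
    rw [wordProd, wordProd, h 0 (by simp), ih fun k hk => h (k + 1) (by simpa using hk)]

theorem wordProd_ofFn {n N : ℕ} (w : Fin N → Fin n) (t : ℕ → ℂ) :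
    (List.ofFn fun l : Fin N => xRoot (w l) (t l)).prod = wordProd (List.ofFn w) t := by
  induction N generalizing t with
  | zero => simp [wordProd]
  | succ N ih =>
    rw [List.ofFn_succ, List.prod_cons, List.ofFn_succ, wordProd, ← ih]
    rfl

theorem wordProd_mem {n : ℕ} (L : List (Fin n)) (t : ℕ → ℂ) :
    wordProd L t ∈ upperUnipotent n := by
  induction L generalizing t with
  | nil => exact one_mem _
  | cons i L ih => exact mul_mem (xRoot_mem i _) (ih _)

/-- Extension by zero. -/
def extN {N : ℕ} (t : Fin N → ℂ) (k : ℕ) : ℂ := if h : k < N then t ⟨k, h⟩ else 0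

theorem extN_of_lt {N : ℕ} (t : Fin N → ℂ) {k : ℕ} (h : k < N) : extN t k = t ⟨k, h⟩ := dif_pos h

theorem extN_val {N : ℕ} (t : Fin N → ℂ) (l : Fin N) : extN t l = t l := dif_pos l.2

theorem contDiff_extN {N : ℕ} (k : ℕ) : ContDiff ℂ 1 fun t : Fin N → ℂ => extN t k := by
  by_cases h : k < N
  · simp only [extN_of_lt _ h]
    fun_prop
  · simp only [extN, dif_neg h]
    fun_prop

theorem contDiff_wordProd {n N : ℕ} (L : List (Fin n)) (f : (Fin N → ℂ) → ℕ → ℂ)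
    (hf : ∀ k, ContDiff ℂ 1 fun t => f t k) (i j : Fin (n + 1)) :
    ContDiff ℂ 1 fun t => mat (wordProd L (f t)) i j := by
  induction L generalizing f i j with
  | nil => exact contDiff_const
  | cons m L ih =>
    have ih' := ih (fun t k => f t (k + 1)) fun k => hf (k + 1)
    simp only [wordProd, mat_mul, Matrix.mul_apply]
    refine ContDiff.sum fun k _ => ContDiff.mul ?_ (ih' k j)
    simp only [mat_xRoot, Matrix.add_apply]
    refine contDiff_const.add ?_
    by_cases h : m.castSucc = i ∧ m.succ = k
    · obtain ⟨rfl, rfl⟩ := h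
      simp only [Matrix.single_apply_same]
      exact hf 0
    · simp only [Matrix.single_apply_of_ne _ _ _ _ _ h]
      exact contDiff_const

/-- The chart attached to a word. -/
def chartList {n : ℕ} (L : List (Fin n)) (t : Fin (nB n) → ℂ) : Pos n → ℂ :=
  fun p => mat (wordProd L (extN t)) p.1.1 p.1.2

theorem contDiff_chartList {n : ℕ} (L : List (Fin n)) : ContDiff ℂ 1 (chartList L) :=
  contDiff_pi' fun p => contDiff_wordProd L extN (fun k => contDiff_extN k) p.1.1 p.1.2

theorem differentiableAt_chartList {n : ℕ} (L : List (Fin n)) (t : Fin (nB n) → ℂ) :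
    DifferentiableAt ℂ (chartList L) t :=
  (contDiff_chartList L).differentiable one_ne_zero t

theorem mat_unip {n : ℕ} (a : Pos n → ℂ) (i j : Fin (n + 1)) :
    mat (unip a) i j = if h : i < j then a ⟨(i, j), h⟩ else if i = j then 1 else 0 := rfl

theorem unip_mem {n : ℕ} (a : Pos n → ℂ) : unip a ∈ upperUnipotent n := by
  refine ⟨fun i j h => ?_, fun i => ?_⟩
  · rw [mat_unip, dif_neg h.not_gt, if_neg h.ne']
  · rw [mat_unip, dif_neg (lt_irrefl i), if_pos rfl]

theorem unip_eq {n : ℕ} {u : SLn n} (hu : u ∈ upperUnipotent n) :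
    unip (fun p => mat u p.1.1 p.1.2) = u := by
  refine mat_injective ?_
  ext i j
  rw [mat_unip]
  split_ifs with h1 h2
  · rfl
  · rw [h2, hu.2]
  · exact (hu.1 i j (lt_of_le_of_ne (not_lt.mp h1) (Ne.symm h2))).symm

theorem eq_one_of_upper_lower {n : ℕ} {u : SLn n} (hu : u ∈ upperUnipotent n)
    (hl : ∀ i j, i < j → mat u i j = 0) : u = 1 := by
  refine mat_injective ?_
  ext i j
  rw [mat_one]
  rcases lt_trichotomy i j with h | rfl | h
  · rw [hl i j h, Matrix.one_apply_ne h.ne]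
  · rw [hu.2, Matrix.one_apply_eq]
  · rw [hu.1 i j h, Matrix.one_apply_ne h.ne']

theorem mat_lower_of_toGd_mem {n : ℕ} {g : SLn n} (hg : toGd g ∈ Bminus n) (i j : Fin (n + 1))
    (hij : i < j) : mat g i j = 0 := by
  obtain ⟨b, hb, hbg⟩ := hg
  obtain ⟨r, hr, h⟩ := exists_mat_eq_smul_of_toGd_eq hbg.symm
  have hb' : mat b i j = 0 := hb i j hij
  rw [h, Matrix.smul_apply, hb', smul_zero]

theorem mk_toGd_injOn {n : ℕ} {u u' : SLn n} (hu : u ∈ upperUnipotent n)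
    (hu' : u' ∈ upperUnipotent n)
    (h : (QuotientGroup.mk (toGd u) : Flag n) = QuotientGroup.mk (toGd u')) : u = u' := by
  have h1 : (toGd u)⁻¹ * toGd u' ∈ Bminus n := QuotientGroup.eq.mp h
  rw [← map_inv, ← map_mul] at h1
  have h2 := eq_one_of_upper_lower (mul_mem (inv_mem_upperUnipotent hu) hu')
    (mat_lower_of_toGd_mem h1)
  exact inv_mul_eq_one.mp h2

theorem cell_injective {n : ℕ} : Function.Injective (cell (n := n)) := by
  intro a a' h
  have h1 := mk_toGd_injOn (unip_mem a) (unip_mem a') h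
  funext p
  have h2 := congrArg (fun u => mat u p.1.1 p.1.2) h1
  simp only [mat_unip, dif_pos p.2] at h2
  exact h2

theorem cellCoord_mk {n : ℕ} {u : SLn n} (hu : u ∈ upperUnipotent n) :
    cellCoord (QuotientGroup.mk (toGd u)) = fun p : Pos n => mat u p.1.1 p.1.2 := by
  have h : (QuotientGroup.mk (toGd u) : Flag n) = cell fun p : Pos n => mat u p.1.1 p.1.2 := by
    rw [cell, unip_eq hu]
  rw [h, cellCoord, Function.leftInverse_invFun cell_injective]

theorem stratumChart_eq {n : ℕ} (w : Fin (nB n) → Fin n) :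
    stratumChart w = chartList (List.ofFn w) := by
  funext t
  have h := wordProd_ofFn w (extN t)
  simp only [extN_val] at h
  rw [stratumChart, h, cellCoord_mk (wordProd_mem _ _)]
  rfl

theorem unip_chartList {n : ℕ} (L : List (Fin n)) (t : Fin (nB n) → ℂ) :
    unip (chartList L t) = wordProd L (extN t) := unip_eq (wordProd_mem _ _)

/-- The product of the lower left minors of a unipotent matrix. -/
def cellDelta {n : ℕ} (a : Pos n → ℂ) : ℂ := vPlus n (mat (unip a) * mat (w0Dot n)⁻¹)

theorem contDiff_cellDelta (n : ℕ) : ContDiff ℂ 1 (cellDelta (n := n)) := by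
  have h1 : ∀ i j : Fin (n + 1), ContDiff ℂ 1 fun a : Pos n → ℂ =>
      (mat (unip a) * mat (w0Dot n)⁻¹) i j := by
    intro i j
    simp only [Matrix.mul_apply]
    refine ContDiff.sum fun k _ => ContDiff.mul ?_ contDiff_const
    simp only [mat_unip]
    split_ifs <;> fun_prop
  unfold cellDelta
  simp only [vPlus, Matrix.det_apply, Matrix.submatrix_apply]
  refine contDiff_prod fun k _ => ContDiff.sum fun σ _ => ?_
  exact (contDiff_prod fun i _ => h1 _ _).const_smul _

theorem mat_lower {n : ℕ} {l : SLn n} (hl : l ∈ borelSL n) (i j : Fin (n + 1)) (hij : i < j) :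
    mat l i j = 0 := hl i j hij

theorem mat_apply_self_ne_zero {n : ℕ} {l : SLn n} (hl : l ∈ borelSL n) (i : Fin (n + 1)) :
    mat l i i ≠ 0 := by
  intro hi
  have h6 := det_mat l
  rw [Matrix.det_of_isLowerTriangular _ fun i j hij => mat_lower hl i j hij] at h6
  exact zero_ne_one ((Finset.prod_eq_zero (f := fun i => mat l i i) (Finset.mem_univ i)
    hi).symm.trans h6)

theorem cellDelta_ne_zero {n : ℕ} {a : Pos n → ℂ} (ha : cell a ∈ Rcell n) : cellDelta a ≠ 0 := by
  obtain ⟨-, b, ⟨b', hb', rfl⟩, hb⟩ := ha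
  have h1 : (toGd (unip a))⁻¹ * (toGd b' * toGd (w0Dot n)) ∈ Bminus n := QuotientGroup.eq.mp hb
  rw [← map_inv, ← map_mul, ← map_mul] at h1
  have h2 := mat_lower_of_toGd_mem h1
  set l := (unip a)⁻¹ * (b' * w0Dot n) with hl
  have hb'0 : ∀ i j, i < j → mat b' i j = 0 := hb'
  have h3 : mat (unip a) * mat (w0Dot n)⁻¹ * (mat (w0Dot n) * mat l * mat (w0Dot n)⁻¹) =
      mat b' := by
    simp only [← mat_mul]
    congr 1
    rw [hl]
    group
  have h4 := congrArg (vPlus n) h3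
  rw [vPlus_mul_upper (w0_conj_upper h2)] at h4
  intro h5
  rw [cellDelta] at h5
  rw [h5, zero_mul] at h4
  exact vPlus_lower_ne_zero hb'0 (mat_apply_self_ne_zero hb') h4.symm

/-- Positions of the standard word and positions above the diagonal. -/
def triPos (n : ℕ) : Tri n ≃ Pos n where
  toFun p := ⟨(⟨p.1.1 - p.1.2, by omega⟩, p.1.1.succ), by
    rw [Fin.lt_def, Fin.val_succ]
    exact Nat.lt_succ_of_le (Nat.sub_le _ _)⟩
  invFun q := ⟨(⟨q.1.2 - 1, by have := q.2; omega⟩, ⟨q.1.2 - 1 - q.1.1, by have := q.2; omega⟩), by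
    rw [Fin.le_def]
    exact Nat.sub_le _ _⟩
  left_inv p := by
    have := p.2
    rw [Fin.le_def] at this
    refine Subtype.ext (Prod.ext (Fin.ext ?_) (Fin.ext ?_)) <;> simp
    omega
  right_inv q := by
    have := q.2
    rw [Fin.lt_def] at this
    refine Subtype.ext (Prod.ext (Fin.ext ?_) (Fin.ext ?_)) <;> simp <;> omega

/-- The enumeration of the matrix entries above the diagonal. -/
def posEquiv (n : ℕ) : Fin (nB n) ≃ Pos n := (stdEquiv n).trans (triPos n)

/-- The volume form of the affine chart. -/
def volForm (n : ℕ) : (Pos n → ℂ) [⋀^Fin (nB n)]→L[ℂ] ℂ :=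
  { (Matrix.detRowAlternating (R := ℂ) (n := Fin (nB n))).compLinearMap
      (LinearMap.funLeft ℂ ℂ (posEquiv n)) with
    cont := by
      change Continuous fun u : Fin (nB n) → Pos n → ℂ =>
        Matrix.det (Matrix.of fun m l => u m (posEquiv n l))
      exact Continuous.matrix_det (by fun_prop) }

theorem volForm_apply {n : ℕ} (u : Fin (nB n) → Pos n → ℂ) :
    volForm n u = Matrix.det (Matrix.of fun l m => u m (posEquiv n l)) := by
  rw [← Matrix.det_transpose]
  rfl

/-! ### Invariance under commutation and braid moves -/

/-- The logarithmic Jacobian of the chart of a word. -/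
def HasLogJacobian {n : ℕ} (L : List (Fin n)) (ε : ℂ) (t : Fin (nB n) → ℂ) : Prop :=
  ∀ v : Fin (nB n) → Fin (nB n) → ℂ,
    volForm n (fun m => fderiv ℂ (chartList L) t (v m)) =
      ε * cellDelta (chartList L t) * Matrix.det (Matrix.of fun l m => v m l / t l)

theorem HasLogJacobian.transfer {n : ℕ} {L L' : List (Fin n)} {ε η : ℂ} {t : Fin (nB n) → ℂ}
    {φ : (Fin (nB n) → ℂ) → Fin (nB n) → ℂ} {φ' : (Fin (nB n) → ℂ) →L[ℂ] Fin (nB n) → ℂ}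
    (hL : HasLogJacobian L ε (φ t)) (hφ : HasFDerivAt φ φ' t)
    (heq : ∀ᶠ s in 𝓝 t, chartList L' s = chartList L (φ s))
    (hdet : ∀ v : Fin (nB n) → Fin (nB n) → ℂ,
      Matrix.det (Matrix.of fun l m => φ' (v m) l / φ t l) =
        η * Matrix.det (Matrix.of fun l m => v m l / t l)) : HasLogJacobian L' (ε * η) t := by
  intro v
  have h1 : HasFDerivAt (chartList L') ((fderiv ℂ (chartList L) (φ t)).comp φ') t :=
    ((differentiableAt_chartList L (φ t)).hasFDerivAt.comp t hφ).congr_of_eventuallyEq heq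
  rw [h1.fderiv, heq.self_of_nhds]
  have h2 := hL fun m => φ' (v m)
  rw [hdet] at h2
  refine h2.trans ?_
  ring

theorem HasLogJacobian.of_punctured {n : ℕ} {L : List (Fin n)} {ε : ℂ} {t u : Fin (nB n) → ℂ}
    (ht : ∀ l, t l ≠ 0) (h : ∀ᶠ s : ℂ in 𝓝[≠] 0, HasLogJacobian L ε (t + s • u)) :
    HasLogJacobian L ε t := by
  intro v
  have hγ : ContinuousAt (fun s : ℂ => t + s • u) 0 := by fun_prop
  have hγ0 : t + (0 : ℂ) • u = t := by simp
  have hl : Filter.Tendsto (fun s : ℂ => volForm n fun m => fderiv ℂ (chartList L) (t + s • u) (v m))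
      (𝓝[≠] 0) (𝓝 (volForm n fun m => fderiv ℂ (chartList L) t (v m))) := by
    have h1 : Continuous fun s : ℂ =>
        volForm n fun m => fderiv ℂ (chartList L) (t + s • u) (v m) := by
      refine (volForm n).cont.comp (continuous_pi fun m => ?_)
      have h2 := (contDiff_chartList L).continuous_fderiv one_ne_zero
      exact (h2.comp (by fun_prop : Continuous fun s : ℂ => t + s • u)).clm_apply continuous_const
    have h3 := h1.tendsto 0
    simp only [hγ0] at h3
    exact h3.mono_left nhdsWithin_le_nhds
  have hr : Filter.Tendsto (fun s : ℂ => ε * cellDelta (chartList L (t + s • u)) *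
      Matrix.det (Matrix.of fun l m => v m l / (t + s • u) l)) (𝓝[≠] 0)
      (𝓝 (ε * cellDelta (chartList L t) * Matrix.det (Matrix.of fun l m => v m l / t l))) := by
    have h1 : ContinuousAt (fun s : Fin (nB n) → ℂ => ε * cellDelta (chartList L s) *
        Matrix.det (Matrix.of fun l m => v m l / s l)) t := by
      refine ContinuousAt.mul ?_ ?_
      · exact (continuous_const.mul ((contDiff_cellDelta n).continuous.comp
          (contDiff_chartList L).continuous)).continuousAt
      · simp only [Matrix.det_apply, Matrix.of_apply]
        refine tendsto_finsetSum _ fun σ _ => Filter.Tendsto.const_smul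
          (tendsto_finsetProd _ fun i _ => ?_) _
        exact tendsto_const_nhds.div (continuous_apply _).continuousAt (ht _)
    have h2 : ContinuousAt (fun s : ℂ => ε * cellDelta (chartList L (t + s • u)) *
      Matrix.det (Matrix.of fun l m => v m l / (t + s • u) l)) 0 :=
      ContinuousAt.comp_of_eq h1 hγ hγ0
    have h3 := h2.tendsto
    simp only [hγ0] at h3
    exact h3.mono_left nhdsWithin_le_nhds
  exact tendsto_nhds_unique (hl.congr' (h.mono fun s hs => hs v)) hr

theorem exists_hasFDerivAt_mul_div {N : ℕ} {t : Fin N → ℂ} (x y p r : Fin N) (hx : t x ≠ 0)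
    (hy : t y ≠ 0) (hpr : t p + t r ≠ 0) : ∃ D : (Fin N → ℂ) →L[ℂ] ℂ,
      HasFDerivAt (fun s : Fin N → ℂ => s x * s y / (s p + s r)) D t ∧
      ∀ v, D v = t x * t y / (t p + t r) *
        (v x / t x + v y / t y - (v p + v r) / (t p + t r)) := by
  have hd : DifferentiableAt ℂ (fun s : Fin N → ℂ => s x * s y / (s p + s r)) t := by
    have h1 : DifferentiableAt ℂ (fun s : Fin N → ℂ => s x * s y) t := by fun_prop
    have h2 : DifferentiableAt ℂ (fun s : Fin N → ℂ => s p + s r) t := by fun_prop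
    simp only [div_eq_mul_inv]
    exact h1.mul (h2.inv hpr)
  refine ⟨_, hd.hasFDerivAt, fun v => ?_⟩
  have hline : ∀ i : Fin N, HasDerivAt (fun s : ℂ => (t + s • v) i) (v i) 0 := fun i => by
    have := ((hasDerivAt_id (0 : ℂ)).mul_const (v i)).const_add (t i)
    rwa [one_mul] at this
  have h0 : t + (0 : ℂ) • v = t := by simp
  have h1 : HasDerivAt (fun s : ℂ => t + s • v) v 0 := hasDerivAt_pi.mpr hline
  have h2 := HasFDerivAt.comp_hasDerivAt (f := fun s : ℂ => t + s • v)
    (l := fun s : Fin N → ℂ => s x * s y / (s p + s r)) 0 (by rw [h0]; exact hd.hasFDerivAt) h1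
  have h3 := ((hline x).mul (hline y)).div ((hline p).add (hline r)) (by
    simp only [Pi.add_apply, zero_smul, Pi.zero_apply, add_zero]
    exact hpr)
  rw [h2.unique h3]
  simp only [Pi.mul_apply, Pi.add_apply, zero_smul, Pi.zero_apply, add_zero]
  field_simp

theorem det_braid_rows {N : ℕ} (A B : Matrix (Fin N) (Fin N) ℂ) {p q r : Fin N} (hpq : p ≠ q)
    (hpr : p ≠ r) (hqr : q ≠ r) (s : ℂ) (hB : ∀ l, l ≠ p → l ≠ q → l ≠ r → B l = A l)
    (hp : B p = A q + s • A r - s • A p) (hq : B q = s • A p + (1 - s) • A r)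
    (hr : B r = (1 - s) • A p + A q - (1 - s) • A r) : B.det = A.det := by
  set σ : Equiv.Perm (Fin N) := Equiv.swap p q * Equiv.swap q r with hσ
  have hσp : σ p = q := by
    rw [hσ, Equiv.Perm.mul_apply, Equiv.swap_apply_of_ne_of_ne hpq hpr, Equiv.swap_apply_left]
  have hσq : σ q = r := by
    rw [hσ, Equiv.Perm.mul_apply, Equiv.swap_apply_left, Equiv.swap_apply_of_ne_of_ne hpr.symm
      hqr.symm]
  have hσr : σ r = p := by
    rw [hσ, Equiv.Perm.mul_apply, Equiv.swap_apply_right, Equiv.swap_apply_right]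
  have hσl : ∀ l, l ≠ p → l ≠ q → l ≠ r → σ l = l := by
    intro l h1 h2 h3
    rw [hσ, Equiv.Perm.mul_apply, Equiv.swap_apply_of_ne_of_ne h2 h3,
      Equiv.swap_apply_of_ne_of_ne h1 h2]
  set A0 : Matrix (Fin N) (Fin N) ℂ := A.submatrix σ id with hA0
  have hd0 : A0.det = A.det := by
    rw [hA0, Matrix.det_permute, hσ, map_mul, Equiv.Perm.sign_swap hpq, Equiv.Perm.sign_swap hqr]
    simp
  set A1 := A0.updateRow p (A0 p + s • A0 q) with hA1
  set A2 := A1.updateRow p (A1 p + (-s) • A1 r) with hA2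
  set A3 := A2.updateRow r (A2 r + (-1 : ℂ) • A2 q) with hA3
  set A4 := A3.updateRow q (A3 q + s • A3 r) with hA4
  set A5 := A4.updateRow r (A4 r + (1 : ℂ) • A4 p) with hA5
  have hB5 : B = A5 := by
    have e0 : ∀ l, A0 l = A (σ l) := fun l => rfl
    funext l
    by_cases h1 : l = p
    · subst h1
      rw [hp]
      simp only [hA5, hA4, hA3, hA2, hA1, Matrix.updateRow_self, Matrix.updateRow_ne hpq,
        Matrix.updateRow_ne hpr, Matrix.updateRow_ne hpr.symm, Matrix.updateRow_ne hqr.symm,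
        Matrix.updateRow_ne hpq.symm, Matrix.updateRow_ne hqr, e0, hσp, hσq, hσr]
      module
    · by_cases h2 : l = q
      · subst h2
        rw [hq]
        simp only [hA5, hA4, hA3, hA2, hA1, Matrix.updateRow_self, Matrix.updateRow_ne hpq,
          Matrix.updateRow_ne hpr, Matrix.updateRow_ne hpr.symm, Matrix.updateRow_ne hqr.symm,
          Matrix.updateRow_ne hpq.symm, Matrix.updateRow_ne hqr, e0, hσp, hσq, hσr]
        module
      · by_cases h3 : l = r
        · subst h3
          rw [hr]
          simp only [hA5, hA4, hA3, hA2, hA1, Matrix.updateRow_self, Matrix.updateRow_ne hpq,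
            Matrix.updateRow_ne hpr, Matrix.updateRow_ne hpr.symm, Matrix.updateRow_ne hqr.symm,
            Matrix.updateRow_ne hpq.symm, Matrix.updateRow_ne hqr, e0, hσp, hσq, hσr]
          module
        · rw [hB l h1 h2 h3]
          simp only [hA5, hA4, hA3, hA2, hA1, Matrix.updateRow_ne h1, Matrix.updateRow_ne h2,
            Matrix.updateRow_ne h3, e0, hσl l h1 h2 h3]
  rw [hB5, hA5, Matrix.det_updateRow_add_smul_self _ hpr.symm, hA4,
    Matrix.det_updateRow_add_smul_self _ hqr, hA3, Matrix.det_updateRow_add_smul_self _ hqr.symm,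
    hA2, Matrix.det_updateRow_add_smul_self _ hpr, hA1, Matrix.det_updateRow_add_smul_self _ hpq,
    hd0]

theorem xRoot_commute {n : ℕ} {i j : Fin n} (hij : (i : ℕ) + 1 < j ∨ (j : ℕ) + 1 < i) (a b : ℂ) :
    xRoot i a * xRoot j b = xRoot j b * xRoot i a := by
  have h : ∀ (i : Fin n) (a : ℂ), xRoot i a = xr n i a := fun i a => by rw [xr, dif_pos i.2]
  rw [h, h]
  rcases hij with h | h
  · exact xr_commute (by omega) a b
  · exact (xr_commute (by omega) b a).symm

theorem xRoot_braid {n : ℕ} {i j : Fin n} (hij : (i : ℕ) + 1 = j ∨ (j : ℕ) + 1 = i) (a b c : ℂ)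
    (hac : a + c ≠ 0) : xRoot i a * xRoot j b * xRoot i c =
      xRoot j (b * c / (a + c)) * xRoot i (a + c) * xRoot j (a * b / (a + c)) := by
  have hj : b * c / (a + c) + a * b / (a + c) = b := by
    field_simp
    ring
  refine mat_injective ?_
  simp only [mat_mul, mat_xRoot]
  have hii : ∀ k : Fin n, k.succ ≠ k.castSucc := fun k => (Fin.castSucc_lt_succ).ne'
  rcases hij with h | h
  · have e : j.castSucc = i.succ := Fin.ext h.symm
    have e2 : j.succ ≠ i.castSucc := fun h' => by
      have := congrArg Fin.val h'
      simp at this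
      omega
    have e3 : j.succ ≠ i.succ := e ▸ hii j
    simp only [e, mul_add, add_mul, mul_one, one_mul, Matrix.single_mul_single_same,
      Matrix.single_mul_single_of_ne _ _ _ _ (hii i), Matrix.single_mul_single_of_ne _ _ _ _ e2,
      Matrix.single_mul_single_of_ne _ _ _ _ e3, add_zero]
    have h2 : a * (a * b / (a + c)) + c * (a * b / (a + c)) = a * b := by field_simp
    have hb : Matrix.single i.succ j.succ b = Matrix.single i.succ j.succ (b * c / (a + c)) +
        Matrix.single i.succ j.succ (a * b / (a + c)) := by rw [← Matrix.single_add, hj]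
    rw [h2, hb]
    simp only [Matrix.single_add]
    abel
  · have e : i.castSucc = j.succ := Fin.ext h.symm
    have e2 : i.succ ≠ j.castSucc := fun h' => by
      have := congrArg Fin.val h'
      simp at this
      omega
    have e3 : i.succ ≠ j.succ := e ▸ hii i
    simp only [e, mul_add, add_mul, mul_one, one_mul, Matrix.single_mul_single_same,
      Matrix.single_mul_single_of_ne _ _ _ _ (hii j), Matrix.single_mul_single_of_ne _ _ _ _ e2,
      Matrix.single_mul_single_of_ne _ _ _ _ e3, add_zero]
    have h2 : b * c / (a + c) * a + b * c / (a + c) * c = b * c := by field_simp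
    have hb : Matrix.single j.castSucc j.succ b =
        Matrix.single j.castSucc j.succ (b * c / (a + c)) +
          Matrix.single j.castSucc j.succ (a * b / (a + c)) := by rw [← Matrix.single_add, hj]
    rw [h2, hb]
    simp only [Matrix.single_add]
    abel

/-- The chart of a word has logarithmic Jacobian `±cellDelta`. -/
def IsLogUnimodular {n : ℕ} (L : List (Fin n)) : Prop :=
  L.length = nB n → ∃ ε : ℂ, (ε = 1 ∨ ε = -1) ∧
    ∀ t : Fin (nB n) → ℂ, (∀ l, t l ≠ 0) → HasLogJacobian L ε t

theorem wordProd_append_two {n : ℕ} (A B : List (Fin n)) (i j : Fin n) (f : ℕ → ℂ) :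
    wordProd (A ++ i :: j :: B) f = wordProd A f * (xRoot i (f A.length) *
      xRoot j (f (A.length + 1))) * wordProd B fun k => f (k + (A.length + 2)) := by
  rw [wordProd_append, wordProd, wordProd, mul_assoc, mul_assoc]
  simp only [zero_add, add_assoc, add_comm 1, add_comm 2]

theorem wordProd_append_three {n : ℕ} (A B : List (Fin n)) (i j k : Fin n) (f : ℕ → ℂ) :
    wordProd (A ++ i :: j :: k :: B) f = wordProd A f * (xRoot i (f A.length) *
      xRoot j (f (A.length + 1)) * xRoot k (f (A.length + 2))) *
      wordProd B fun k => f (k + (A.length + 3)) := by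
  rw [wordProd_append, wordProd, wordProd, wordProd]
  have e1 : 1 + A.length = A.length + 1 := by omega
  have e2 : 1 + 1 + A.length = A.length + 2 := by omega
  have e3 : ∀ k, k + 1 + 1 + 1 + A.length = k + (A.length + 3) := by omega
  simp only [zero_add, mul_assoc, e1, e2, e3]

theorem IsLogUnimodular.comm {n : ℕ} (A B : List (Fin n)) (i j : Fin n)
    (hij : (i : ℕ) + 1 < j ∨ (j : ℕ) + 1 < i) (h : IsLogUnimodular (A ++ i :: j :: B)) :
    IsLogUnimodular (A ++ j :: i :: B) := by
  intro hlen
  have hN : A.length + 2 ≤ nB n := by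
    rw [← hlen]
    simp
  obtain ⟨ε, hε, hL⟩ := h (by rw [← hlen]; simp)
  refine ⟨-ε, by rcases hε with rfl | rfl <;> simp, fun t ht => ?_⟩
  have hp : A.length < nB n := by omega
  have hq : A.length + 1 < nB n := by omega
  set p : Fin (nB n) := ⟨A.length, hp⟩ with hpdef
  set q : Fin (nB n) := ⟨A.length + 1, hq⟩ with hqdef
  have hpq : p ≠ q := by simp [hpdef, hqdef]
  set φ' : (Fin (nB n) → ℂ) →L[ℂ] Fin (nB n) → ℂ :=
    ContinuousLinearMap.pi fun l => ContinuousLinearMap.proj (Equiv.swap p q l) with hφ'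
  have hφ'v : ∀ v l, φ' v l = v (Equiv.swap p q l) := fun v l => rfl
  rw [← mul_neg_one]
  refine HasLogJacobian.transfer (φ := fun t => φ' t) (φ' := φ') (hL _ fun l => ht _) φ'.hasFDerivAt
    (Filter.Eventually.of_forall fun s => ?_) fun v => ?_
  · have hs : wordProd (A ++ j :: i :: B) (extN s) = wordProd (A ++ i :: j :: B) (extN (φ' s)) := by
      rw [wordProd_append_two, wordProd_append_two, extN_of_lt _ hp, extN_of_lt _ hq,
        extN_of_lt _ hp, extN_of_lt _ hq, ← hpdef, ← hqdef, hφ'v, hφ'v, Equiv.swap_apply_left,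
        Equiv.swap_apply_right, xRoot_commute hij]
      have hout : ∀ k, k ≠ A.length → k ≠ A.length + 1 → extN s k = extN (φ' s) k := by
        intro k h1 h2
        by_cases hk : k < nB n
        · rw [extN_of_lt _ hk, extN_of_lt _ hk, hφ'v, Equiv.swap_apply_of_ne_of_ne] <;>
            simpa [hpdef, hqdef]
        · rw [extN, extN, dif_neg hk, dif_neg hk]
      congr 1
      · congr 1
        exact wordProd_congr fun k hk => hout k (by omega) (by omega)
      · exact wordProd_congr fun k hk => hout _ (by omega) (by omega)
    funext x
    rw [chartList, chartList, hs]
  · have h1 := Matrix.det_permute (Equiv.swap p q)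
      (Matrix.of fun l m => v m l / t l : Matrix (Fin (nB n)) (Fin (nB n)) ℂ)
    rw [Equiv.Perm.sign_swap hpq] at h1
    simp only [Units.val_neg, Units.val_one, Int.cast_neg, Int.cast_one] at h1
    rw [← h1]
    rfl

theorem IsLogUnimodular.braid {n : ℕ} (A B : List (Fin n)) (i j : Fin n)
    (hij : (i : ℕ) + 1 = j ∨ (j : ℕ) + 1 = i) (h : IsLogUnimodular (A ++ i :: j :: i :: B)) :
    IsLogUnimodular (A ++ j :: i :: j :: B) := by
  intro hlen
  have hN : A.length + 3 ≤ nB n := by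
    rw [← hlen]
    simp
  obtain ⟨ε, hε, hL⟩ := h (by rw [← hlen]; simp)
  refine ⟨ε, hε, ?_⟩
  have hp : A.length < nB n := by omega
  have hq : A.length + 1 < nB n := by omega
  have hr : A.length + 2 < nB n := by omega
  set p : Fin (nB n) := ⟨A.length, hp⟩ with hpdef
  set q : Fin (nB n) := ⟨A.length + 1, hq⟩ with hqdef
  set r : Fin (nB n) := ⟨A.length + 2, hr⟩ with hrdef
  have hpq : p ≠ q := by simp [hpdef, hqdef]
  have hpr : p ≠ r := by simp [hpdef, hrdef]
  have hqr : q ≠ r := by simp [hrdef, hqdef]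
  have key : ∀ t : Fin (nB n) → ℂ, (∀ l, t l ≠ 0) → t p + t r ≠ 0 →
      HasLogJacobian (A ++ j :: i :: j :: B) ε t := by
    intro t ht hac
    set φ : (Fin (nB n) → ℂ) → Fin (nB n) → ℂ := fun s l =>
      if l = p then s q * s r / (s p + s r) else if l = q then s p + s r else
        if l = r then s p * s q / (s p + s r) else s l with hφ
    have hφp : ∀ s, φ s p = s q * s r / (s p + s r) := fun s => if_pos rfl
    have hφq : ∀ s, φ s q = s p + s r := fun s => by
      rw [hφ]
      simp only [if_neg hpq.symm, if_pos]
    have hφr : ∀ s, φ s r = s p * s q / (s p + s r) := fun s => by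
      rw [hφ]
      simp only [if_neg hpr.symm, if_neg hqr.symm, if_pos]
    have hφl : ∀ s l, l ≠ p → l ≠ q → l ≠ r → φ s l = s l := fun s l h1 h2 h3 => by
      rw [hφ]
      simp only [if_neg h1, if_neg h2, if_neg h3]
    obtain ⟨D1, hD1, hD1v⟩ := exists_hasFDerivAt_mul_div q r p r (ht q) (ht r) hac
    obtain ⟨D2, hD2, hD2v⟩ := exists_hasFDerivAt_mul_div p q p r (ht p) (ht q) hac
    set pr : Fin (nB n) → (Fin (nB n) → ℂ) →L[ℂ] ℂ := fun l => ContinuousLinearMap.proj l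
    have hprv : ∀ l v, pr l v = v l := fun l v => rfl
    have hprd : ∀ l, HasFDerivAt (fun s : Fin (nB n) → ℂ => s l) (pr l) t := fun l =>
      hasFDerivAt_apply (𝕜 := ℂ) l t
    set φ' : (Fin (nB n) → ℂ) →L[ℂ] Fin (nB n) → ℂ :=
      ContinuousLinearMap.pi fun l => if l = p then D1 else if l = q then
        pr p + pr r else if l = r then D2 else pr l with hφ'
    have hd : HasFDerivAt φ φ' t := by
      refine hasFDerivAt_pi'.mpr fun l => ?_
      change HasFDerivAt (fun s => φ s l) (if l = p then D1 else if l = q then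
        pr p + pr r else if l = r then D2 else pr l) t
      by_cases h1 : l = p
      · simp only [h1, hφp, if_pos]
        exact hD1
      · by_cases h2 : l = q
        · simp only [h2, hφq, if_neg hpq.symm, if_pos]
          exact (hprd p).add (hprd r)
        · by_cases h3 : l = r
          · simp only [h3, hφr, if_neg hpr.symm, if_neg hqr.symm, if_pos]
            exact hD2
          · simp only [hφl _ l h1 h2 h3, if_neg h1, if_neg h2, if_neg h3]
            exact hprd l
    have hφ0 : ∀ l, φ t l ≠ 0 := by
      intro l
      by_cases h1 : l = p
      · rw [h1, hφp]
        exact div_ne_zero (mul_ne_zero (ht q) (ht r)) hac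
      · by_cases h2 : l = q
        · rw [h2, hφq]
          exact hac
        · by_cases h3 : l = r
          · rw [h3, hφr]
            exact div_ne_zero (mul_ne_zero (ht p) (ht q)) hac
          · rw [hφl _ l h1 h2 h3]
            exact ht l
    have hev : ∀ᶠ s : Fin (nB n) → ℂ in 𝓝 t, s p + s r ≠ 0 := by
      have hc : ContinuousAt (fun s : Fin (nB n) → ℂ => s p + s r) t := by fun_prop
      exact hc.eventually_ne hac
    rw [← mul_one ε]
    refine HasLogJacobian.transfer (φ := φ) (φ' := φ') (hL _ hφ0) hd (hev.mono fun s hs => ?_)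
      fun v => ?_
    · have hs' : wordProd (A ++ j :: i :: j :: B) (extN s) =
          wordProd (A ++ i :: j :: i :: B) (extN (φ s)) := by
        rw [wordProd_append_three, wordProd_append_three, extN_of_lt _ hp, extN_of_lt _ hq,
          extN_of_lt _ hr, extN_of_lt _ hp, extN_of_lt _ hq, extN_of_lt _ hr, ← hpdef, ← hqdef,
          ← hrdef, hφp, hφq, hφr, xRoot_braid hij.symm _ _ _ hs]
        have hout : ∀ k, k ≠ A.length → k ≠ A.length + 1 → k ≠ A.length + 2 →
            extN s k = extN (φ s) k := by
          intro k h1 h2 h3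
          by_cases hk : k < nB n
          · rw [extN_of_lt _ hk, extN_of_lt _ hk, hφl] <;> simpa [hpdef, hqdef, hrdef]
          · rw [extN, extN, dif_neg hk, dif_neg hk]
        congr 1
        · congr 1
          exact wordProd_congr fun k hk => hout k (by omega) (by omega) (by omega)
        · exact wordProd_congr fun k hk => hout _ (by omega) (by omega) (by omega)
      funext x
      rw [chartList, chartList, hs']
    · rw [one_mul]
      have hsub : 1 - t p / (t p + t r) = t r / (t p + t r) := by
        field_simp
        ring
      have htp := ht p
      have htq := ht q
      have htr := ht r
      refine det_braid_rows _ _ hpq hpr hqr (t p / (t p + t r)) ?_ ?_ ?_ ?_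
      · intro l h1 h2 h3
        funext m
        simp only [Matrix.of_apply, hφl _ l h1 h2 h3, hφ', ContinuousLinearMap.pi_apply, if_neg h1,
          if_neg h2, if_neg h3, hprv]
      · funext m
        simp only [Matrix.of_apply, Pi.add_apply, Pi.sub_apply, Pi.smul_apply, smul_eq_mul, hφp,
          hφ', ContinuousLinearMap.pi_apply, if_pos, hD1v]
        field_simp
        ring
      · funext m
        simp only [Matrix.of_apply, Pi.add_apply, Pi.smul_apply, smul_eq_mul, hφq,
          hφ', ContinuousLinearMap.pi_apply, if_pos, if_neg hpq.symm, hsub,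
          _root_.add_apply, hprv]
        field_simp
      · funext m
        simp only [Matrix.of_apply, Pi.add_apply, Pi.sub_apply, Pi.smul_apply, smul_eq_mul, hφr,
          hφ', ContinuousLinearMap.pi_apply, if_pos, if_neg hpr.symm, if_neg hqr.symm, hsub, hD2v]
        field_simp
        ring
  intro t ht
  by_cases hac : t p + t r = 0
  · refine HasLogJacobian.of_punctured (u := Pi.single p 1) ht ?_
    have h1 : ∀ᶠ s : ℂ in 𝓝 0, t p + s ≠ 0 := by
      have hc : ContinuousAt (fun s : ℂ => t p + s) 0 := by fun_prop
      exact hc.eventually_ne (by rw [add_zero]; exact ht p)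
    filter_upwards [h1.filter_mono nhdsWithin_le_nhds, self_mem_nhdsWithin] with s hs hs0
    refine key _ (fun l => ?_) ?_
    · by_cases hl : l = p
      · subst hl
        simpa using hs
      · simpa [Pi.single_apply, hl] using ht l
    · have h2 : (t + s • (Pi.single p 1 : Fin (nB n) → ℂ)) p +
          (t + s • (Pi.single p 1 : Fin (nB n) → ℂ)) r = s := by
        simp only [Pi.add_apply, Pi.smul_apply, Pi.single_eq_same, Pi.single_eq_of_ne hpr.symm,
          smul_eq_mul, mul_one, mul_zero, add_zero]
        linear_combination hac
      rw [h2]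
      exact hs0
  · exact key t ht hac

/-! ### The standard chart -/

/-- `C_{r-1} ⋯ C_0`, where `C_m` collects the factors with `j - k = m`. -/
def lowLevels (n : ℕ) (c : ℕ → ℕ → ℂ) : ℕ → SLn n
  | 0 => 1
  | r + 1 => levelC n c r * lowLevels n c r

theorem xCNat_eq_mul_lowLevels (n : ℕ) (c : ℕ → ℕ → ℂ) (r : ℕ) :
    xCNat n c = upperProd n (fun j k => xr n j (c j k)) r * lowLevels n c r := by
  induction r with
  | zero => rw [lowLevels, mul_one, xCNat]
  | succ r ih => rw [ih, upperProd_xr_step, lowLevels, mul_assoc]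

theorem ent_upperProd_mul {n : ℕ} (c : ℕ → ℕ → ℂ) (d : ℕ) :
    ∀ (r : ℕ) (_ : n ≤ r + d) (A : Matrix (Fin (n + 1)) (Fin (n + 1)) ℂ) (i j : ℕ) (_ : i < r),
      ent (mat (upperProd n (fun j k => xr n j (c j k)) r) * A) i j = ent A i j := by
  induction d with
  | zero =>
    intro r hr A i j _
    have h1 : upperProd n (fun j k => xr n j (c j k)) r = 1 :=
      ascProd_eq_one fun _ _ => descProd_eq_one fun _ _ => if_neg (by omega)
    rw [h1, mat_one, Matrix.one_mul]
  | succ d ih =>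
    intro r hr A i j hi
    rw [upperProd_xr_step, mat_mul, Matrix.mul_assoc, ih (r + 1) (by omega) _ i j (by omega),
      ent_levelC_mul, if_neg (by omega), add_zero]

theorem ent_xCNat {n : ℕ} (c : ℕ → ℕ → ℂ) (i j : ℕ) :
    ent (mat (xCNat n c)) i j = ent (mat (lowLevels n c (i + 1))) i j := by
  rw [xCNat_eq_mul_lowLevels n c (i + 1), mat_mul, ent_upperProd_mul c n _ (by omega) _ _ _ (by omega)]

theorem lowLevels_congr {n : ℕ} {c c' : ℕ → ℕ → ℂ} {r : ℕ}
    (h : ∀ a b, b ≤ a → a - b < r → c a b = c' a b) : lowLevels n c r = lowLevels n c' r := by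
  induction r with
  | zero => rfl
  | succ r ih =>
    rw [lowLevels, lowLevels, ih fun a b h1 h2 => h a b h1 (by omega), levelC, levelC]
    congr 1
    exact ascProd_congr fun k _ => by rw [h (k + r) k (by omega) (by omega)]

theorem levelC_mem {n : ℕ} (c : ℕ → ℕ → ℂ) (r : ℕ) : levelC n c r ∈ upperUnipotent n :=
  ascProd_mem fun _ _ => xr_mem _ _ _

theorem lowLevels_mem {n : ℕ} (c : ℕ → ℕ → ℂ) (r : ℕ) : lowLevels n c r ∈ upperUnipotent n := by
  induction r with
  | zero => exact one_mem _
  | succ r ih => exact mul_mem (levelC_mem c r) ih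

theorem ent_lowLevels_sub {n : ℕ} {c c' : ℕ → ℕ → ℂ} {i j : ℕ} (hj : j < n)
    (hlow : ∀ a b, b ≤ a → a - b < i → c a b = c' a b)
    (heq : ∀ a, i ≤ a → a < j → c a (a - i) = c' a (a - i)) (d : ℕ) :
    ∀ m, i ≤ m → m + d = j → ent (mat (lowLevels n c' (i + 1))) m (j + 1) -
      ent (mat (lowLevels n c (i + 1))) m (j + 1) =
        (∏ a ∈ Finset.Ico m j, c a (a - i)) * (c' j (j - i) - c j (j - i)) := by
  have hstep : ∀ (c : ℕ → ℕ → ℂ) (m : ℕ), i ≤ m → m < n →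
      ent (mat (lowLevels n c (i + 1))) m (j + 1) = ent (mat (lowLevels n c i)) m (j + 1) +
        c m (m - i) * ent (mat (lowLevels n c (i + 1))) (m + 1) (j + 1) := by
    intro c m h1 h2
    rw [lowLevels, mat_mul, ent_levelC_mul, if_pos ⟨h1, h2⟩]
  have hlow' := lowLevels_congr (n := n) hlow
  induction d with
  | zero =>
    intro m hm hmj
    rw [add_zero] at hmj
    subst hmj
    have h1 : ∀ c, ent (mat (lowLevels n c (i + 1))) (m + 1) (m + 1) = 1 := fun c => by
      have := (lowLevels_mem (n := n) c (i + 1)).2 ⟨m + 1, by omega⟩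
      rwa [← ent_val (mat (lowLevels n c (i + 1)))] at this
    rw [hstep c m hm hj, hstep c' m hm hj, h1, h1, hlow', Finset.Ico_self, Finset.prod_empty]
    ring
  | succ d ih =>
    intro m hm hmj
    have h1 := ih (m + 1) (by omega) (by omega)
    rw [hstep c m hm (by omega), hstep c' m hm (by omega), hlow', ← heq m hm (by omega),
      Finset.prod_eq_prod_Ico_succ_bot (by omega)]
    linear_combination c m (m - i) * h1

/-- The coordinates of the standard chart, indexed by pairs of natural numbers. -/
def stdCoord {n : ℕ} (t : Fin (nB n) → ℂ) (j k : ℕ) : ℂ :=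
  if h : j < n ∧ k ≤ j then t ((stdEquiv n).symm ⟨(⟨j, h.1⟩, ⟨k, by omega⟩), h.2⟩) else 1

theorem stdCoord_stdEquiv {n : ℕ} (t : Fin (nB n) → ℂ) (l : Fin (nB n)) :
    stdCoord t (stdEquiv n l).1.1 (stdEquiv n l).1.2 = t l := by
  rw [stdCoord, dif_pos ⟨(stdEquiv n l).1.1.2, (stdEquiv n l).2⟩]
  exact congrArg t ((stdEquiv n).symm_apply_apply l)

theorem wordProd_stdWord {n : ℕ} (t : Fin (nB n) → ℂ) :
    wordProd (List.ofFn (stdWord n)) (extN t) = xCNat n (stdCoord t) := by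
  rw [← wordProd_ofFn]
  simp only [extN_val]
  have h1 := prod_ofFn_stdEquiv (n := n) fun p => xRoot p.1.1 (stdCoord t p.1.1 p.1.2)
  simp only [stdCoord_stdEquiv] at h1
  refine h1.trans ?_
  rw [← stdProd_eq_prod_map fun j k _ => xRoot j (stdCoord t j k)]
  refine stdProd_eq _ _ fun j k h => ?_
  rw [xr, dif_pos j.2]

theorem stdCoord_add_single {n : ℕ} (t : Fin (nB n) → ℂ) (l : Fin (nB n)) (s : ℂ) (a b : ℕ)
    (h : ¬(a = (stdEquiv n l).1.1 ∧ b = (stdEquiv n l).1.2)) :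
    stdCoord (t + s • Pi.single l 1) a b = stdCoord t a b := by
  unfold stdCoord
  split_ifs with hab
  · rw [Pi.add_apply, Pi.smul_apply, Pi.single_eq_of_ne, smul_zero, add_zero]
    intro h'
    rw [Equiv.symm_apply_eq] at h'
    exact h (by rw [← h']; exact ⟨rfl, rfl⟩)
  · rfl

theorem stdCoord_add_single_self {n : ℕ} (t : Fin (nB n) → ℂ) (l : Fin (nB n)) (s : ℂ) :
    stdCoord (t + s • Pi.single l 1) (stdEquiv n l).1.1 (stdEquiv n l).1.2 = t l + s := by
  rw [stdCoord_stdEquiv]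
  simp

/-- The coefficient of a coordinate of the standard chart in the corresponding entry. -/
def stdCoeff {n : ℕ} (t : Fin (nB n) → ℂ) (p : Tri n) : ℂ :=
  ∏ a ∈ Finset.Ico ((p.1.1 : ℕ) - p.1.2) p.1.1, stdCoord t a (a - (p.1.1 - p.1.2))

theorem chartList_stdWord {n : ℕ} (t : Fin (nB n) → ℂ) (p : Tri n) :
    chartList (List.ofFn (stdWord n)) t (triPos n p) =
      ent (mat (lowLevels n (stdCoord t) (p.1.1 - p.1.2 + 1))) (p.1.1 - p.1.2) (p.1.1 + 1) := by
  rw [chartList, wordProd_stdWord, ← ent_xCNat, ← ent_val (mat (xCNat n (stdCoord t)))]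
  rfl

theorem chartList_add_single_of_lt {n : ℕ} (t : Fin (nB n) → ℂ) (l l' : Fin (nB n)) (s : ℂ)
    (h : toLex (posEquiv n l').1 < toLex (posEquiv n l).1) :
    chartList (List.ofFn (stdWord n)) (t + s • Pi.single l 1) (posEquiv n l') =
      chartList (List.ofFn (stdWord n)) t (posEquiv n l') := by
  have e : ∀ l, posEquiv n l = triPos n (stdEquiv n l) := fun _ => rfl
  rw [Prod.Lex.toLex_lt_toLex, e, e] at h
  simp only [triPos, Equiv.coe_fn_mk, Fin.lt_def, Fin.ext_iff, Fin.val_succ] at h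
  rw [e, chartList_stdWord, chartList_stdWord, ← sub_eq_zero]
  have hp := (stdEquiv n l).2
  have hp' := (stdEquiv n l').2
  rw [Fin.le_def] at hp hp'
  generalize stdEquiv n l' = p' at *
  have hc : ∀ a b, b ≤ a → (a - b < (p'.1.1 : ℕ) - p'.1.2 ∨
      (a - b = (p'.1.1 : ℕ) - p'.1.2 ∧ a ≤ p'.1.1)) →
      stdCoord t a b = stdCoord (t + s • Pi.single l 1) a b := by
    intro a b h1 h2
    rw [stdCoord_add_single]
    rintro ⟨rfl, rfl⟩
    omega
  have hle : (p'.1.1 : ℕ) - p'.1.2 ≤ p'.1.1 := Nat.sub_le _ _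
  rw [ent_lowLevels_sub p'.1.1.2 (fun a b h1 h2 => hc a b h1 (Or.inl h2))
    (fun a h1 h2 => hc a _ (by omega) (Or.inr (by omega))) _ _ le_rfl (Nat.add_sub_cancel' hle),
    hc p'.1.1 (p'.1.1 - (p'.1.1 - p'.1.2)) (by omega) (Or.inr (by omega)), sub_self, mul_zero]

theorem chartList_add_single_self {n : ℕ} (t : Fin (nB n) → ℂ) (l : Fin (nB n)) (s : ℂ) :
    chartList (List.ofFn (stdWord n)) (t + s • Pi.single l 1) (posEquiv n l) =
      chartList (List.ofFn (stdWord n)) t (posEquiv n l) + stdCoeff t (stdEquiv n l) * s := by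
  have e : posEquiv n l = triPos n (stdEquiv n l) := rfl
  rw [e, chartList_stdWord, chartList_stdWord, ← sub_eq_iff_eq_add']
  have hp := (stdEquiv n l).2
  rw [Fin.le_def] at hp
  have hself := stdCoord_add_single_self t l s
  have hself0 := stdCoord_stdEquiv t l
  have hc : ∀ a b, b ≤ a → (a - b < ((stdEquiv n l).1.1 : ℕ) - (stdEquiv n l).1.2 ∨
      (a - b = ((stdEquiv n l).1.1 : ℕ) - (stdEquiv n l).1.2 ∧ a < (stdEquiv n l).1.1)) →
      stdCoord t a b = stdCoord (t + s • Pi.single l 1) a b := by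
    intro a b h1 h2
    rw [stdCoord_add_single]
    rintro ⟨rfl, rfl⟩
    omega
  generalize stdEquiv n l = p at *
  have hle : (p.1.1 : ℕ) - p.1.2 ≤ p.1.1 := Nat.sub_le _ _
  rw [ent_lowLevels_sub p.1.1.2 (fun a b h1 h2 => hc a b h1 (Or.inl h2))
    (fun a h1 h2 => hc a _ (by omega) (Or.inr (by omega))) _ _ le_rfl (Nat.add_sub_cancel' hle),
    show (p.1.1 : ℕ) - (p.1.1 - p.1.2) = p.1.2 by omega, hself, hself0, stdCoeff]
  ring

/-- The Jacobian matrix of the standard chart. -/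
def stdJacobian {n : ℕ} (t : Fin (nB n) → ℂ) : Matrix (Fin (nB n)) (Fin (nB n)) ℂ :=
  Matrix.of fun l' l => fderiv ℂ (chartList (List.ofFn (stdWord n))) t (Pi.single l 1)
    (posEquiv n l')

theorem hasDerivAt_chartList {n : ℕ} (L : List (Fin n)) (t v : Fin (nB n) → ℂ) (p : Pos n) :
    HasDerivAt (fun s : ℂ => chartList L (t + s • v) p) (fderiv ℂ (chartList L) t v p) 0 := by
  have hline : HasDerivAt (fun s : ℂ => t + s • v) v 0 := by
    have := ((hasDerivAt_id (0 : ℂ)).smul_const v).const_add t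
    rwa [one_smul] at this
  have h1 := HasFDerivAt.comp_hasDerivAt (f := fun s : ℂ => t + s • v) (l := chartList L) 0
    (by rw [zero_smul, add_zero]; exact (differentiableAt_chartList L t).hasFDerivAt) hline
  exact hasDerivAt_pi.mp h1 p

/-- The determinant of a matrix which is lower triangular for some ordering of the indices. -/
theorem det_of_lower_of_injective {m α : Type*} [Fintype m] [DecidableEq m] [LinearOrder α]
    (M : Matrix m m ℂ) {b : m → α} (hb : Function.Injective b)
    (h : ∀ i j, b i < b j → M i j = 0) : M.det = ∏ i, M i i := by
  have htri : Matrix.BlockTriangular Mᵀ b := fun i j hij => h j i hij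
  rw [← Matrix.det_transpose, htri.det, Finset.prod_image fun l _ l' _ h => hb h]
  refine Finset.prod_congr rfl fun l _ => ?_
  have hu : Unique {l' // b l' = b l} := ⟨⟨⟨l, rfl⟩⟩, fun l' => Subtype.ext (hb l'.2)⟩
  rw [Matrix.det_eq_elem_of_subsingleton _ ⟨l, rfl⟩]
  rfl

theorem det_stdJacobian {n : ℕ} (t : Fin (nB n) → ℂ) :
    (stdJacobian t).det = ∏ p : Tri n, stdCoeff t p := by
  have hinj : Function.Injective fun l => toLex (posEquiv n l).1 := fun l l' h =>
    (posEquiv n).injective (Subtype.ext (toLex.injective h))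
  rw [det_of_lower_of_injective _ hinj fun l' l h => ?_, ← Equiv.prod_comp (stdEquiv n)]
  · refine Finset.prod_congr rfl fun l _ => ?_
    refine (hasDerivAt_chartList _ t (Pi.single l 1) (posEquiv n l)).unique ?_
    simp only [chartList_add_single_self]
    have := ((hasDerivAt_id (0 : ℂ)).const_mul (stdCoeff t (stdEquiv n l))).const_add
      (chartList (List.ofFn (stdWord n)) t (posEquiv n l))
    rwa [mul_one] at this
  · refine (hasDerivAt_chartList _ t (Pi.single l 1) (posEquiv n l')).unique ?_
    simp only [chartList_add_single_of_lt t l l' _ h]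
    exact hasDerivAt_const _ _

theorem prod_tri_range {M : Type*} [CommMonoid M] {n : ℕ} (f : ℕ → ℕ → M) :
    ∏ p : Tri n, f p.1.1 p.1.2 =
      ∏ j ∈ Finset.range n, ∏ k ∈ Finset.range (j + 1), f j k := by
  rw [prod_tri]
  refine Finset.prod_congr rfl fun j hj => ?_
  have hj' := Finset.mem_range.mp hj
  rw [← Finset.prod_filter]
  congr 1
  ext k
  simp only [Finset.mem_filter, Finset.mem_range]
  omega

theorem prod_range_Ico_comm {M : Type*} [CommMonoid M] (m : ℕ) (g : ℕ → ℕ → M) :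
    ∏ i ∈ Finset.range m, ∏ a ∈ Finset.Ico i m, g a i =
      ∏ a ∈ Finset.range m, ∏ i ∈ Finset.range (a + 1), g a i := by
  refine Finset.prod_comm' fun i a => ?_
  simp only [Finset.mem_range, Finset.mem_Ico]
  omega

/-- Regrouping of the coordinates of the standard chart. -/
theorem prod_tri_Ico_mul {n : ℕ} (c : ℕ → ℕ → ℂ) :
    (∏ p : Tri n, ∏ a ∈ Finset.Ico ((p.1.1 : ℕ) - p.1.2) p.1.1, c a (a - (p.1.1 - p.1.2))) *
      ∏ p : Tri n, c p.1.1 p.1.2 =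
      ∏ p : Tri n, ∏ a ∈ Finset.Ico (p.1.2 : ℕ) (p.1.1 + 1), c a p.1.2 := by
  rw [← Finset.prod_mul_distrib]
  have h1 : ∀ p : Tri n, (∏ a ∈ Finset.Ico ((p.1.1 : ℕ) - p.1.2) p.1.1,
      c a (a - (p.1.1 - p.1.2))) * c p.1.1 p.1.2 =
      (fun j k => ∏ a ∈ Finset.Ico (j - k) (j + 1), c a (a - (j - k))) p.1.1 p.1.2 := by
    intro p
    have hp := p.2
    rw [Fin.le_def] at hp
    simp only
    rw [Finset.prod_Ico_succ_top (by omega), show (p.1.1 : ℕ) - (p.1.1 - p.1.2) = p.1.2 by omega]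
  rw [Finset.prod_congr rfl fun p _ => h1 p,
    prod_tri_range fun j k => ∏ a ∈ Finset.Ico (j - k) (j + 1), c a (a - (j - k)),
    prod_tri_range fun j k => ∏ a ∈ Finset.Ico k (j + 1), c a k]
  refine Finset.prod_congr rfl fun j _ => ?_
  have h2 := Finset.prod_range_reflect
    (fun i => ∏ a ∈ Finset.Ico i (j + 1), c a (a - i)) (j + 1)
  simp only [Nat.add_sub_cancel] at h2
  rw [h2, prod_range_Ico_comm (j + 1) fun a i => c a (a - i),
    prod_range_Ico_comm (j + 1) fun a i => c a i]
  refine Finset.prod_congr rfl fun a _ => ?_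
  have h3 := Finset.prod_range_reflect (fun i => c a i) (a + 1)
  simpa only [Nat.add_sub_cancel] using h3

theorem xCNat_congr {n : ℕ} {c c' : ℕ → ℕ → ℂ} (h : ∀ j k, k ≤ j → j < n → c j k = c' j k) :
    xCNat n c = xCNat n c' := by
  refine ascProd_congr fun k _ => descProd_congr fun j hj => ?_
  split_ifs with h1
  · simp only [h j k (by omega) hj]
  · rfl

theorem vPlus_xCNat_mul {n : ℕ} (T : ℕ → ℕ → ℂ) (hT : ∀ i, T i i = 0) :
    vPlus n (mat (xCNat n (cWeight T)) * mat (w0Dot n)⁻¹) =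
      ∏ p : Tri n, Complex.exp (-T (p.1.1 + 1) p.1.2) := by
  have h0 := isPartlyReduced_factorization n T
  have h1 : (Matrix.diagonal fun i : Fin (n + 1) => Complex.exp (T i i)) = 1 := by
    simp [hT]
  rw [h1, Matrix.one_mul] at h0
  have hd := xDNat_mem n (dWeight T)
  have h2 : vPlus n (mat (xCNat n (cWeight T)) * mat (w0Dot n)⁻¹) =
      vPlus n (mat (xCNat n (cWeight T)) * mat (w0Dot n)⁻¹ * mat (xDNat n (dWeight T))) := by
    rw [vPlus_mul_upper hd.1, vPlus_upper_eq_one hd.1 hd.2, mul_one]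
  rw [h2, vPlus_lower fun i j hij => ?_]
  · have h3 : ∀ k : Fin n, ∀ i : Fin (k.val + 1), (mat (xCNat n (cWeight T)) * mat (w0Dot n)⁻¹ *
        mat (xDNat n (dWeight T))) (Fin.castLE (show k.val + 1 ≤ n + 1 by omega) i)
          (Fin.castLE (show k.val + 1 ≤ n + 1 by omega) i) =
        Complex.exp (levelSum n T i - levelSum n T (i + 1)) := by
      intro k i
      have := h0.diag i (by omega)
      rw [← this, ← ent_val (mat (xCNat n (cWeight T)) * mat (w0Dot n)⁻¹ *
        mat (xDNat n (dWeight T)))]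
      rfl
    have hS : levelSum n T 0 = 0 := Finset.sum_eq_zero fun i _ => hT i
    simp only [h3]
    rw [prod_tri_level fun j k => Complex.exp (-T (j + 1) k),
      ← Fin.prod_univ_eq_prod_range fun k =>
        ∏ j ∈ Finset.range (n - k), Complex.exp (-T (j + k + 1) j)]
    refine Finset.prod_congr rfl fun k _ => ?_
    rw [← Complex.exp_sum, ← Complex.exp_sum,
      Fin.sum_univ_eq_sum_range (fun i => levelSum n T i - levelSum n T (i + 1)),
      Finset.sum_range_sub', hS, zero_sub, levelSum, Finset.sum_neg_distrib,
      show n + 1 - ((k : ℕ) + 1) = n - k by omega]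
    rfl
  · have := h0.above i j (by omega) hij
    rw [ent_val] at this
    exact this

theorem cellDelta_stdWord {n : ℕ} {t : Fin (nB n) → ℂ} (ht : ∀ l, t l ≠ 0) :
    cellDelta (chartList (List.ofFn (stdWord n)) t) =
      ∏ p : Tri n, ∏ a ∈ Finset.Ico (p.1.2 : ℕ) (p.1.1 + 1), stdCoord t a p.1.2 := by
  have hc : ∀ j k, stdCoord t j k ≠ 0 := by
    intro j k
    rw [stdCoord]
    split_ifs
    exacts [ht _, one_ne_zero]
  set T : ℕ → ℕ → ℂ := fun i k => -∑ a ∈ Finset.Ico k i, Complex.log (stdCoord t a k) with hT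
  have h1 : wordProd (List.ofFn (stdWord n)) (extN t) = xCNat n (cWeight T) := by
    rw [wordProd_stdWord]
    refine xCNat_congr fun j k hjk _ => ?_
    rw [cWeight, hT]
    simp only
    rw [Finset.sum_Ico_succ_top hjk, neg_sub_neg, add_sub_cancel_left, Complex.exp_log (hc j k)]
  rw [cellDelta, unip_chartList, h1, vPlus_xCNat_mul T fun i => by simp [hT]]
  refine Finset.prod_congr rfl fun p _ => ?_
  rw [hT]
  simp only [neg_neg]
  rw [Complex.exp_sum]
  exact Finset.prod_congr rfl fun a _ => Complex.exp_log (hc _ _)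

theorem det_stdJacobian_mul_prod {n : ℕ} {t : Fin (nB n) → ℂ} (ht : ∀ l, t l ≠ 0) :
    (stdJacobian t).det * ∏ l, t l = cellDelta (chartList (List.ofFn (stdWord n)) t) := by
  have h1 : ∏ l, t l = ∏ p : Tri n, stdCoord t p.1.1 p.1.2 := by
    rw [← Equiv.prod_comp (stdEquiv n)]
    exact Finset.prod_congr rfl fun l _ => (stdCoord_stdEquiv t l).symm
  rw [cellDelta_stdWord ht, det_stdJacobian, h1, ← prod_tri_Ico_mul]
  rfl

theorem isLogUnimodular_stdWord (n : ℕ) : IsLogUnimodular (List.ofFn (stdWord n)) := by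
  refine fun _ => ⟨1, Or.inl rfl, fun t ht v => ?_⟩
  have h1 : (Matrix.of fun l m => fderiv ℂ (chartList (List.ofFn (stdWord n))) t (v m)
      (posEquiv n l)) = stdJacobian t * Matrix.of fun l m => v m l := by
    ext l m
    have h2 : v m = ∑ l, v m l • (Pi.single l 1 : Fin (nB n) → ℂ) := (pi_eq_sum_univ' (v m))
    rw [Matrix.of_apply, Matrix.mul_apply]
    conv_lhs => rw [h2]
    rw [map_sum, Finset.sum_apply]
    refine Finset.sum_congr rfl fun l' _ => ?_
    rw [map_smul, Pi.smul_apply, smul_eq_mul, mul_comm]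
    rfl
  have h2 : (Matrix.of fun l m => v m l / t l) =
      Matrix.diagonal (fun l => (t l)⁻¹) * Matrix.of fun l m => v m l := by
    ext l m
    rw [Matrix.diagonal_mul, Matrix.of_apply, Matrix.of_apply, div_eq_inv_mul]
  have h3 : (∏ l, t l) ≠ 0 := Finset.prod_ne_zero_iff.mpr fun l _ => ht l
  rw [volForm_apply, h1, Matrix.det_mul, h2, Matrix.det_mul, Matrix.det_diagonal, one_mul,
    ← det_stdJacobian_mul_prod ht, Finset.prod_inv_distrib]
  field_simp

/-- The Jacobian of the chart of a reduced word of `w₀`. -/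
theorem exists_hasLogJacobian {n : ℕ} {w : Fin (nB n) → Fin n} (hw : IsReducedW0 w) :
    ∃ ε : ℂ, (ε = 1 ∨ ε = -1) ∧ ∀ t : Fin (nB n) → ℂ, (∀ l, t l ≠ 0) →
      HasLogJacobian (List.ofFn w) ε t :=
  reducedW0_induction IsLogUnimodular.comm IsLogUnimodular.braid (isLogUnimodular_stdWord n) w hw
    List.length_ofFn

/-! ### Bruhat cells -/

/-- The nonzero entries of the matrix are those of the permutation matrix of `w`. -/
def IsMonomial {n : ℕ} (w : Equiv.Perm (Fin (n + 1))) (M : SLn n) : Prop :=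
  ∀ p q, mat M p q ≠ 0 ↔ p = w q

theorem IsMonomial.apply_eq_zero {n : ℕ} {w : Equiv.Perm (Fin (n + 1))} {M : SLn n}
    (h : IsMonomial w M) {p q : Fin (n + 1)} (hpq : p ≠ w q) : mat M p q = 0 := by
  by_contra h'
  exact hpq ((h p q).mp h')

theorem IsMonomial.mul_apply {n : ℕ} {w : Equiv.Perm (Fin (n + 1))} {M : SLn n}
    (h : IsMonomial w M) (A : Mx n) (p q : Fin (n + 1)) :
    (mat M * A) (w p) q = mat M (w p) p * A p q := by
  rw [Matrix.mul_apply, Finset.sum_eq_single p]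
  · intro k _ hk
    rw [h.apply_eq_zero fun h' => hk (w.injective h').symm, zero_mul]
  · simp

theorem IsMonomial.apply_mul {n : ℕ} {w : Equiv.Perm (Fin (n + 1))} {M : SLn n}
    (h : IsMonomial w M) (A : Mx n) (p q : Fin (n + 1)) :
    (A * mat M) p q = A p (w q) * mat M (w q) q := by
  rw [Matrix.mul_apply, Finset.sum_eq_single (w q)]
  · intro k _ hk
    rw [h.apply_eq_zero hk, mul_zero]
  · simp

theorem IsMonomial.mul {n : ℕ} {w w' : Equiv.Perm (Fin (n + 1))} {M M' : SLn n}
    (h : IsMonomial w M) (h' : IsMonomial w' M') : IsMonomial (w * w') (M * M') := by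
  intro p q
  rw [mat_mul, h'.apply_mul, mul_ne_zero_iff, h, h', Equiv.Perm.mul_apply]
  simp

/-- `y_i(-1/t) x_i(t) y_i(-1/t)`. -/
def mRoot {n : ℕ} (i : Fin n) (t : ℂ) : SLn n := yRoot i (-t⁻¹) * xRoot i t * yRoot i (-t⁻¹)

theorem yRoot_inv {n : ℕ} (i : Fin n) (t : ℂ) : (yRoot i t)⁻¹ = yRoot i (-t) := by
  simp only [yRoot]
  rw [SpecialLinearGroup.transvection_inv]

theorem xRoot_inv {n : ℕ} (i : Fin n) (t : ℂ) : (xRoot i t)⁻¹ = xRoot i (-t) := by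
  simp only [xRoot]
  rw [SpecialLinearGroup.transvection_inv]

theorem mRoot_inv {n : ℕ} (i : Fin n) (t : ℂ) : (mRoot i t)⁻¹ = mRoot i (-t) := by
  rw [mRoot, mRoot, _root_.mul_inv_rev, _root_.mul_inv_rev, yRoot_inv, xRoot_inv, mul_assoc,
    inv_neg]

theorem isMonomial_mRoot {n : ℕ} (i : Fin n) {t : ℂ} (ht : t ≠ 0) :
    IsMonomial (sPerm i) (mRoot i t) := by
  have h1 : mat (mRoot i t) = 1 - single i.castSucc i.castSucc 1 - single i.succ i.succ 1 +
      single i.castSucc i.succ t - single i.succ i.castSucc t⁻¹ := by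
    have h2 : (i.castSucc : Fin (n + 1)) ≠ i.succ := (Fin.castSucc_lt_succ).ne
    rw [mRoot, mat_mul, mat_mul, mat_xRoot, mat_yRoot]
    simp only [mul_add, add_mul, mul_one, one_mul, Matrix.single_mul_single_same,
      Matrix.single_mul_single_of_ne _ _ _ _ h2, mul_neg, neg_mul,
      inv_mul_cancel₀ ht, mul_inv_cancel₀ ht, ← Matrix.single_neg, one_mul]
    abel
  intro p q
  rw [h1]
  simp only [Matrix.sub_apply, Matrix.add_apply, Matrix.one_apply, Matrix.single_apply, Fin.ext_iff,
    sPerm_apply_val, Fin.val_castSucc, Fin.val_succ]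
  by_cases hp : (p : ℕ) = i
  · by_cases hq : (q : ℕ) = i
    · simp [hp, hq]
    · by_cases hq' : (q : ℕ) = i + 1
      · simp [hp, hq', ht]
      · simp [hp, hq, hq', Ne.symm hq, Ne.symm hq']
  · by_cases hp' : (p : ℕ) = i + 1
    · by_cases hq : (q : ℕ) = i
      · simp [hp', hq, ht]
      · by_cases hq' : (q : ℕ) = i + 1
        · simp [hp', hq']
        · simp [hp', hq, hq', Ne.symm hq, Ne.symm hq']
    · by_cases hq : (q : ℕ) = i
      · simp [hp, hp', hq, Ne.symm hp, Ne.symm hp']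
      · by_cases hq' : (q : ℕ) = i + 1
        · simp [hp, hp', hq', Ne.symm hp, Ne.symm hp']
        · simp [hq, hq', Ne.symm hp, Ne.symm hp']

/-- The double coset `B_- w B_-`. -/
def InBruhatCell {n : ℕ} (w : Equiv.Perm (Fin (n + 1))) (x : SLn n) : Prop :=
  ∃ l ∈ borelSL n, ∃ M, IsMonomial w M ∧ ∃ l' ∈ borelSL n, x = l * M * l'

theorem yRoot_mem {n : ℕ} (i : Fin n) (t : ℂ) : yRoot i t ∈ borelSL n := by
  intro p q hpq
  change mat (yRoot i t) p q = 0
  rw [mat_yRoot, Matrix.add_apply, Matrix.one_apply_ne hpq.ne, Matrix.single_apply_of_ne, add_zero]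
  rintro ⟨rfl, rfl⟩
  exact absurd hpq (Fin.castSucc_lt_succ).not_gt

theorem InBruhatCell.xRoot_mul {n : ℕ} {w : Equiv.Perm (Fin (n + 1))} {x : SLn n}
    (h : InBruhatCell w x) {i : Fin n} (hi : ¬IsDescent w i) {t : ℂ} (ht : t ≠ 0) :
    InBruhatCell (sPerm i * w) (xRoot i t * x) := by
  obtain ⟨l, hl, M, hM, l', hl', rfl⟩ := h
  have hlt : (i.castSucc : Fin (n + 1)) < i.succ := Fin.castSucc_lt_succ
  set k := yRoot i t⁻¹ * l with hk
  have hkm : k ∈ borelSL n := mul_mem (yRoot_mem _ _) hl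
  set a := mat k i.succ i.castSucc / mat k i.succ i.succ with ha
  set l₀ := k * yRoot i (-a) with hl₀
  have hl₀m : l₀ ∈ borelSL n := mul_mem hkm (yRoot_mem _ _)
  have hl₀z : mat l₀ i.succ i.castSucc = 0 := by
    rw [hl₀, mat_mul, mat_yRoot, Matrix.mul_add, Matrix.mul_one, Matrix.add_apply,
      Matrix.mul_single_apply_same, ha]
    field_simp [mat_apply_self_ne_zero hkm i.succ]
    ring
  set l₁ := mRoot i t * l₀ * (mRoot i t)⁻¹ with hl₁
  have hs := isMonomial_mRoot i ht
  have hs' : IsMonomial (sPerm i) (mRoot i t)⁻¹ := by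
    rw [mRoot_inv]
    exact isMonomial_mRoot i (neg_ne_zero.mpr ht)
  have hl₁m : l₁ ∈ borelSL n := by
    intro p q hpq
    change mat l₁ p q = 0
    have hpp : sPerm i (sPerm i p) = p := by
      rw [← Equiv.Perm.mul_apply, sPerm_mul_self, Equiv.Perm.one_apply]
    rw [hl₁, mat_mul, mat_mul, hs'.apply_mul]
    nth_rewrite 1 [← hpp]
    rw [hs.mul_apply]
    have h0 : mat l₀ (sPerm i p) (sPerm i q) = 0 := by
      by_cases hpi : p = i.castSucc ∧ q = i.succ
      · rw [hpi.1, hpi.2, sPerm, Equiv.swap_apply_left, Equiv.swap_apply_right]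
        exact hl₀z
      · refine hl₀m _ _ ?_
        rw [Fin.lt_def] at hpq ⊢
        rw [Fin.ext_iff, Fin.ext_iff, Fin.val_castSucc, Fin.val_succ] at hpi
        rw [sPerm_apply_val, sPerm_apply_val]
        split_ifs <;> omega
    rw [h0, mul_zero, zero_mul]
  set y := M⁻¹ * yRoot i a * M with hy
  have hym : y ∈ borelSL n := by
    intro p q hpq
    change mat y p q = 0
    have h1 : mat M * mat y = mat (yRoot i a) * mat M := by
      rw [← mat_mul, ← mat_mul, hy]
      congr 1
      group
    have h2 := congrFun (congrFun h1 (w p)) q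
    rw [hM.mul_apply, hM.apply_mul] at h2
    have h3 : mat (yRoot i a) (w p) (w q) = 0 := by
      rw [mat_yRoot, Matrix.add_apply, Matrix.one_apply_ne fun h' => hpq.ne (w.injective h'),
        Matrix.single_apply_of_ne, add_zero]
      rintro ⟨h4, h5⟩
      refine hi ?_
      rw [IsDescent, h4, h5, ← Equiv.Perm.mul_apply, ← Equiv.Perm.mul_apply, inv_mul_cancel]
      exact hpq
    rw [h3, zero_mul] at h2
    exact (mul_eq_zero.mp h2).resolve_left ((hM _ _).mpr rfl)
  refine ⟨yRoot i t⁻¹ * l₁, mul_mem (yRoot_mem _ _) hl₁m, mRoot i t * M, hs.mul hM, y * l',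
    mul_mem hym hl', ?_⟩
  have h1 : xRoot i t = yRoot i t⁻¹ * mRoot i t * yRoot i t⁻¹ := by
    rw [mRoot, ← yRoot_inv]
    group
  have h2 : k = l₀ * yRoot i a := by
    rw [hl₀, ← yRoot_inv]
    group
  calc xRoot i t * (l * M * l') = yRoot i t⁻¹ * mRoot i t * k * M * l' := by
        rw [h1, hk]
        group
    _ = _ := by
        rw [h2, hl₁, hy]
        group

theorem inBruhatCell_wordProd {n : ℕ} (L : List (Fin n)) (t : ℕ → ℂ) (ht : ∀ k < L.length, t k ≠ 0)
    (hL : permLength (wordPerm L) = L.length) : InBruhatCell (wordPerm L) (wordProd L t) := by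
  induction L generalizing t with
  | nil =>
    refine ⟨1, one_mem _, 1, fun p q => ?_, 1, one_mem _, by simp [wordProd]⟩
    rw [mat_one, wordPerm, List.map_nil, List.prod_nil, Equiv.Perm.one_apply, Matrix.one_apply]
    simp
  | cons i L ih =>
    rw [List.length_cons, wordPerm_cons] at hL
    have h1 := permLength_le L
    have h2 : ¬IsDescent (wordPerm L) i := fun h => by
      have := permLength_sPerm_mul_add_one h
      omega
    have h3 := permLength_sPerm_mul h2
    rw [wordPerm_cons]
    exact (ih _ (fun k hk => ht (k + 1) (by simpa using hk)) (by omega)).xRoot_mul h2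
      (ht 0 (by simp))

theorem cellDelta_chartList_ne_zero {n : ℕ} {w : Fin (nB n) → Fin n} (hw : IsReducedW0 w)
    {t : Fin (nB n) → ℂ} (ht : ∀ l, t l ≠ 0) : cellDelta (chartList (List.ofFn w) t) ≠ 0 := by
  rw [isReducedW0_iff] at hw
  obtain ⟨l, hl, M, hM, l', hl', hx⟩ := inBruhatCell_wordProd (List.ofFn w) (extN t)
    (fun k hk => by
      rw [List.length_ofFn] at hk
      rw [extN_of_lt _ hk]
      exact ht _) (by rw [hw, permLength_revPerm, List.length_ofFn])
  rw [hw] at hM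
  have hlow := w0_conj_upper (mat_lower hl')
  have h1 : mat (wordProd (List.ofFn w) (extN t)) * mat (w0Dot n)⁻¹ =
      mat l * (mat M * mat (w0Dot n)⁻¹) * (mat (w0Dot n) * mat l' * mat (w0Dot n)⁻¹) := by
    simp only [← mat_mul]
    congr 1
    rw [hx]
    group
  have hw0 : IsMonomial (Fin.revPerm (n := n + 1)) (w0Dot n)⁻¹ := by
    intro p q
    rw [mat_w0Dot_inv_apply, Fin.revPerm_apply]
    by_cases h : q = p.rev
    · rw [if_pos h, h, Fin.rev_rev]
      simp
    · rw [if_neg h]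
      have : p ≠ q.rev := fun h' => h (by rw [h', Fin.rev_rev])
      simp [this]
  have hD := hM.mul hw0
  have hrr : (Fin.revPerm : Equiv.Perm (Fin (n + 1))) * Fin.revPerm = 1 :=
    Equiv.ext fun a => Fin.rev_rev a
  rw [hrr] at hD
  rw [cellDelta, unip_chartList, h1, vPlus_mul_upper hlow, vPlus_lower_mul (mat_lower hl)]
  refine mul_ne_zero (mul_ne_zero (vPlus_lower_ne_zero (mat_lower hl) fun i =>
    mat_apply_self_ne_zero hl i) ?_) (vPlus_upper_ne_zero hlow fun i => ?_)
  · rw [← mat_mul]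
    exact vPlus_lower_ne_zero (fun i j hij => hD.apply_eq_zero hij.ne) fun i => (hD i i).mpr rfl
  · rw [w0_conj_diag]
    exact mat_apply_self_ne_zero hl' _

/-! ### The holomorphic form -/

theorem exists_isMirrorForm {n : ℕ} {i₀ : Fin (nB n) → Fin n} (h₀ : IsReducedW0 i₀) :
    ∃ ω, IsMirrorForm i₀ ω := by
  obtain ⟨ε₀, hε₀, h₀'⟩ := exists_hasLogJacobian h₀
  have hsq : ε₀ * ε₀ = 1 := by rcases hε₀ with rfl | rfl <;> norm_num
  refine ⟨fun a => (ε₀ * (cellDelta a)⁻¹) • volForm n, ?_, fun w hw => ?_⟩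
  · refine DifferentiableOn.smul_const (fun a ha => ?_) _
    have hd : DifferentiableAt ℂ (cellDelta (n := n)) a :=
      (contDiff_cellDelta n).differentiable one_ne_zero a
    exact ((hd.inv (cellDelta_ne_zero ha)).const_mul ε₀).differentiableWithinAt
  · have key : ∀ ε : ℂ, (∀ t : Fin (nB n) → ℂ, (∀ l, t l ≠ 0) → HasLogJacobian (List.ofFn w) ε t) →
        ∀ t : Fin (nB n) → ℂ, (∀ l, t l ≠ 0) → ∀ v : Fin (nB n) → (Fin (nB n) → ℂ),
          ((ε₀ * (cellDelta (stratumChart w t))⁻¹) • volForm n)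
            (fun m => fderiv ℂ (stratumChart w) t (v m)) =
          (ε₀ * ε) * Matrix.det (Matrix.of fun l m => v m l / t l) := by
      intro ε hw' t ht v
      have h1 := cellDelta_chartList_ne_zero hw ht
      have h2 := hw' t ht v
      rw [stratumChart_eq, ContinuousAlternatingMap.smul_apply, h2, smul_eq_mul]
      field_simp
    by_cases hww : w = i₀
    · exact ⟨ε₀ * ε₀, Or.inl hsq, fun _ => hsq, key ε₀ (by rw [hww]; exact h₀')⟩
    · obtain ⟨ε, hε, hw'⟩ := exists_hasLogJacobian hw
      refine ⟨ε₀ * ε, ?_, fun h => absurd h hww, key ε hw'⟩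
      rcases hε₀ with rfl | rfl <;> rcases hε with rfl | rfl <;> simp

theorem isMirrorForm_mirrorForm {n : ℕ} {i₀ : Fin (nB n) → Fin n} (h₀ : IsReducedW0 i₀) :
    IsMirrorForm i₀ (mirrorForm i₀) := by
  have h := exists_isMirrorForm h₀
  rw [mirrorForm, dif_pos h]
  exact h.choose_spec

/-! ### The comparison map in coordinates -/

theorem toR_phiMap_eq {n : ℕ} (T : Ztilde n) : toR (phiMap T) =
    fun p : Pos n => mat (xCNat n (cWeight (tExt T))) p.1.1 p.1.2 := by
  change cellCoord (QuotientGroup.mk (betaTilde T * toGd (w0Dot n))) = _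
  have h1 : (QuotientGroup.mk (betaTilde T * toGd (w0Dot n)) : Flag n) =
      QuotientGroup.mk (toGd (xCNat n (cWeight (tExt T)))) := by
    refine (QuotientGroup.eq.mpr ?_).symm
    rw [betaTilde_eq, ← map_inv, ← map_mul, ← map_mul]
    refine ⟨_, ?_, rfl⟩
    have h2 : (xCNat n (cWeight (tExt T)))⁻¹ * (betaSL T * w0Dot n) =
        expSL (gamma T) * ((w0Dot n)⁻¹ * xDNat n (dWeight (tExt T)) * w0Dot n) := by
      rw [betaSL]
      group
    rw [h2]
    refine mul_mem (fun i j hij => Matrix.diagonal_apply_ne _ hij.ne) fun i j hij => ?_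
    change mat ((w0Dot n)⁻¹ * xDNat n (dWeight (tExt T)) * w0Dot n) i j = 0
    rw [mat_mul, mat_mul]
    exact w0_inv_conj_lower (xDNat_mem n _).1 i j hij
  rw [h1, cellCoord_mk (xCNat_mem n _)]

/-- The logarithm `T_{h_a} - T_{t_a}` of the coordinate of the vertical arrow `a`. -/
def logCoord {n : ℕ} (l : Fin (nB n)) : Ztilde n →ₗ[ℂ] ℂ where
  toFun T := T.1 (head (Sum.inl (stdEquiv n l))) - T.1 (tail (Sum.inl (stdEquiv n l)))
  map_add' S T := by
    simp only [Submodule.coe_add, Pi.add_apply]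
    ring
  map_smul' r T := by
    simp only [Submodule.coe_smul, Pi.smul_apply, smul_eq_mul, RingHom.id_apply]
    ring

theorem logCoord_eq {n : ℕ} (l : Fin (nB n)) (T : Ztilde n) :
    logCoord l T = tExt T (stdEquiv n l).1.1 (stdEquiv n l).1.2 -
      tExt T ((stdEquiv n l).1.1 + 1) (stdEquiv n l).1.2 := by
  change T.1 (head (Sum.inl (stdEquiv n l))) - T.1 (tail (Sum.inl (stdEquiv n l))) = _
  rw [← tExt_eq, ← tExt_eq]
  rfl

/-- The projection to the diagonal vertices and the logarithms of the vertical arrows. -/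
def logMap (n : ℕ) : Ztilde n →ₗ[ℂ] Cartan n × (Fin (nB n) → ℂ) where
  toFun T := (gamma T, fun l => logCoord l T)
  map_add' S T := Prod.ext rfl (funext fun l => map_add (logCoord l) S T)
  map_smul' r T := Prod.ext rfl (funext fun l => map_smul (logCoord l) r T)

theorem tExt_self {n : ℕ} (T : Ztilde n) (k : ℕ) (hk : k < n + 1) :
    tExt T k k = (gamma T).1 ⟨k, hk⟩ := dif_pos ⟨hk, le_rfl⟩

theorem eq_zero_of_logMap_eq_zero {n : ℕ} {T : Ztilde n} (h : logMap n T = 0) : T = 0 := by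
  have h1 : gamma T = 0 := congrArg Prod.fst h
  have h2 : ∀ l, logCoord l T = 0 := fun l => congrFun (congrArg Prod.snd h) l
  have key : ∀ d k, k + d < n + 1 → tExt T (k + d) k = 0 := by
    intro d
    induction d with
    | zero =>
      intro k hk
      rw [add_zero] at hk ⊢
      rw [tExt_self T k hk, h1]
      rfl
    | succ d ih =>
      intro k hk
      have h3 := h2 ((stdEquiv n).symm ⟨(⟨k + d, by omega⟩, ⟨k, by omega⟩), by
        rw [Fin.le_def]
        exact Nat.le_add_right _ _⟩)
      rw [logCoord_eq, Equiv.apply_symm_apply] at h3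
      simp only [ih k (by omega), zero_sub, neg_eq_zero] at h3
      exact h3
  refine Subtype.ext (funext fun v => ?_)
  have h3 := v.2
  rw [Fin.le_def] at h3
  rw [← tExt_eq, ← Nat.add_sub_cancel' h3, key _ _ (by omega)]
  rfl

theorem logMap_surjective (n : ℕ) : Function.Surjective (logMap n) := by
  rintro ⟨h, c⟩
  set T : Ztilde n := ⟨fun v => h.1 v.1.2 - ∑ a ∈ Finset.Ico (v.1.2 : ℕ) v.1.1,
    stdCoord c a v.1.2, by
      change ∑ i, (h.1 i - ∑ a ∈ Finset.Ico (i : ℕ) i, stdCoord c a i) = 0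
      simp only [Finset.Ico_self, Finset.sum_empty, sub_zero]
      exact h.2⟩ with hT
  refine ⟨T, Prod.ext (Subtype.ext (funext fun i => ?_)) (funext fun l => ?_)⟩
  · change h.1 i - ∑ a ∈ Finset.Ico (i : ℕ) i, stdCoord c a i = h.1 i
    rw [Finset.Ico_self, Finset.sum_empty, sub_zero]
  · have hp := (stdEquiv n l).2
    rw [Fin.le_def] at hp
    have h1 := stdCoord_stdEquiv c l
    change (h.1 (stdEquiv n l).1.2.castSucc - ∑ a ∈ Finset.Ico ((stdEquiv n l).1.2 : ℕ)
      (stdEquiv n l).1.1, stdCoord c a (stdEquiv n l).1.2) -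
      (h.1 (stdEquiv n l).1.2.castSucc - ∑ a ∈ Finset.Ico ((stdEquiv n l).1.2 : ℕ)
        ((stdEquiv n l).1.1 + 1), stdCoord c a (stdEquiv n l).1.2) = c l
    rw [Finset.sum_Ico_succ_top hp, h1]
    ring

/-- Linear coordinates on `Ztilde n`. -/
def logEquiv (n : ℕ) : Ztilde n ≃L[ℂ] Cartan n × (Fin (nB n) → ℂ) :=
  (LinearEquiv.ofBijective (logMap n) ⟨(injective_iff_map_eq_zero _).mpr fun _ =>
    eq_zero_of_logMap_eq_zero, logMap_surjective n⟩).toContinuousLinearEquiv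

theorem toR_phiMap {n : ℕ} (T : Ztilde n) : toR (phiMap T) =
    chartList (List.ofFn (stdWord n)) fun l => Complex.exp (logCoord l T) := by
  rw [toR_phiMap_eq]
  funext p
  rw [chartList, wordProd_stdWord, xCNat_congr fun j k hjk hj => ?_]
  rw [stdCoord, dif_pos ⟨hj, hjk⟩, logCoord_eq, Equiv.apply_symm_apply, cWeight]

theorem chartZB_phiMap {n : ℕ} (T : Ztilde n) : chartZB (phiMap T) = (gamma T,
    chartList (List.ofFn (stdWord n)) fun l => Complex.exp ((logEquiv n T).2 l)) :=
  Prod.ext rfl (toR_phiMap T)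

/-- The derivative of `exp` in logarithmic coordinates. -/
def expDeriv {n : ℕ} (T : Ztilde n) : Ztilde n →L[ℂ] Fin (nB n) → ℂ :=
  ContinuousLinearMap.pi fun l => Complex.exp (logCoord l T) • LinearMap.toContinuousLinearMap
    (logCoord l)

theorem hasFDerivAt_exp_logCoord {n : ℕ} (T : Ztilde n) :
    HasFDerivAt (fun S : Ztilde n => fun l => Complex.exp (logCoord l S)) (expDeriv T) T := by
  refine hasFDerivAt_pi'.mpr fun l => ?_
  exact (LinearMap.toContinuousLinearMap (logCoord l)).hasFDerivAt.cexp

theorem hasFDerivAt_toR {n : ℕ} (T : Ztilde n) : HasFDerivAt (fun S => toR (phiMap S))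
    ((fderiv ℂ (chartList (List.ofFn (stdWord n))) fun l => Complex.exp (logCoord l T)).comp
      (expDeriv T)) T := by
  simp only [toR_phiMap]
  exact (differentiableAt_chartList (List.ofFn (stdWord n)) _).hasFDerivAt.comp T
    (hasFDerivAt_exp_logCoord T)

/-- The bottom vertex of a vertical arrow. -/
def tailEquiv (n : ℕ) : Tri n ≃ LowerVertex n where
  toFun p := ⟨tail (Sum.inl p), by
    change p.1.2.castSucc < p.1.1.succ
    rw [Fin.lt_def]
    exact Nat.lt_succ_of_le p.2⟩
  invFun v := ⟨(⟨v.1.1.1 - 1, by have := v.2; rw [Fin.lt_def] at this; omega⟩,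
    ⟨v.1.1.2, by have := v.2; rw [Fin.lt_def] at this; omega⟩), by
      have := v.2
      rw [Fin.lt_def] at this
      rw [Fin.le_def]
      simp only
      omega⟩
  left_inv p := Subtype.ext (Prod.ext (Fin.ext (by simp [tail])) (Fin.ext (by simp [tail])))
  right_inv v := by
    have := v.2
    rw [Fin.lt_def] at this
    refine Subtype.ext (Subtype.ext (Prod.ext (Fin.ext ?_) (Fin.ext ?_)))
    · simp only [tail, Fin.val_succ]
      omega
    · simp only [tail, Fin.val_castSucc]

open Classical in
theorem det_logCoord {n : ℕ} (e : Fin (nB n) ≃ LowerVertex n) : ∃ ε : ℂ, (ε = 1 ∨ ε = -1) ∧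
    ∀ v : Fin (nB n) → Ztilde n, (∀ m, IsVertical (v m)) →
      Matrix.det (Matrix.of fun l m => logCoord l (v m)) =
        ε * Matrix.det (Matrix.of fun l m => (v m).1 (e l).1) := by
  set e₀ : Fin (nB n) ≃ LowerVertex n := (stdEquiv n).trans (tailEquiv n) with he₀
  set σ : Equiv.Perm (Fin (nB n)) := e₀.trans e.symm with hσ
  set K : Matrix (Fin (nB n)) (Fin (nB n)) ℂ := Matrix.of fun l l' =>
    (if head (Sum.inl (stdEquiv n l)) = (e₀ l').1 then 1 else 0) - if l = l' then 1 else 0 with hK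
  have hKdet : K.det = ∏ _l : Fin (nB n), (-1 : ℂ) := by
    rw [det_of_lower_of_injective K (b := fun l => toLex (stdEquiv n l).1) fun l l' h =>
      (stdEquiv n).injective (Subtype.ext (toLex.injective h))]
    · refine Finset.prod_congr rfl fun l _ => ?_
      rw [hK, Matrix.of_apply, if_pos rfl, if_neg, zero_sub]
      intro h
      have := congrArg (fun v : Vertex n => (v.1.1 : ℕ)) h
      simp [he₀, tailEquiv, tail, head] at this
    · intro l l' h
      rw [hK, Matrix.of_apply, if_neg, if_neg, sub_zero]
      · rintro rfl
        exact lt_irrefl _ h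
      · intro h'
        have h1 := congrArg (fun v : Vertex n => (v.1.1 : ℕ)) h'
        rw [Prod.Lex.toLex_lt_toLex, Fin.lt_def, Fin.ext_iff] at h
        simp [he₀, tailEquiv, tail, head] at h1
        omega
  refine ⟨K.det * (Equiv.Perm.sign σ : ℤ), ?_, fun v hv => ?_⟩
  · have h1 : K.det = 1 ∨ K.det = -1 := by
      rw [hKdet, Finset.prod_const]
      exact neg_one_pow_eq_or ℂ _
    rcases h1 with h1 | h1 <;> rcases Int.units_eq_one_or (Equiv.Perm.sign σ) with h2 | h2 <;>
      simp [h1, h2]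
  · have h1 : (Matrix.of fun l m => logCoord l (v m)) =
        K * (Matrix.of fun l m => (v m).1 (e l).1).submatrix σ id := by
      ext l m
      have hV : ∀ l' : Fin (nB n), ((Matrix.of fun l m => (v m).1 (e l).1 :
          Matrix (Fin (nB n)) (Fin (nB n)) ℂ).submatrix σ id) l' m = (v m).1 (e₀ l').1 := by
        intro l'
        rw [Matrix.submatrix_apply, Matrix.of_apply, hσ, Equiv.trans_apply, Equiv.apply_symm_apply]
        rfl
      rw [Matrix.mul_apply, Finset.sum_congr rfl fun l' _ => by rw [hV l']]
      simp only [hK, Matrix.of_apply, sub_mul, ite_mul, one_mul, zero_mul]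
      rw [Finset.sum_sub_distrib, Finset.sum_ite_eq, if_pos (Finset.mem_univ l)]
      change (v m).1 (head (Sum.inl (stdEquiv n l))) - (v m).1 (tail (Sum.inl (stdEquiv n l))) = _
      congr 1
      by_cases hd : (head (Sum.inl (stdEquiv n l))).1.2 < (head (Sum.inl (stdEquiv n l))).1.1
      · obtain ⟨l₁, hl₁⟩ := e₀.surjective ⟨_, hd⟩
        rw [Finset.sum_eq_single l₁, hl₁, if_pos rfl]
        · intro l' _ hl'
          rw [if_neg]
          intro h
          exact hl' (e₀.injective (by rw [hl₁]; exact Subtype.ext h.symm))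
        · simp
      · rw [Finset.sum_eq_zero fun l' _ => if_neg fun h => hd (by rw [h]; exact (e₀ l').2)]
        have h2 := (head (Sum.inl (stdEquiv n l))).2
        have h3 : head (Sum.inl (stdEquiv n l)) =
            diagVertex (head (Sum.inl (stdEquiv n l))).1.1 :=
          Subtype.ext (Prod.ext rfl (le_antisymm h2 (not_lt.mp hd)))
        rw [h3]
        exact hv m _
    rw [h1, Matrix.det_mul, Matrix.det_permute]
    ring

theorem exists_pullbackForm_eq {n : ℕ} {i₀ : Fin (nB n) → Fin n} (h₀ : IsReducedW0 i₀)
    (e : Fin (nB n) ≃ LowerVertex n) : ∃ ε : ℂ, (ε = 1 ∨ ε = -1) ∧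
      ∀ (T : Ztilde n) (v : Fin (nB n) → Ztilde n), (∀ m, IsVertical (v m)) →
        pullbackForm i₀ phiMap T v = ε * Matrix.det (Matrix.of fun l m => (v m).1 (e l).1) := by
  obtain ⟨ε₁, hε₁, -, h₁⟩ := (isMirrorForm_mirrorForm h₀).2 _ (isReducedW0_stdWord n)
  obtain ⟨ε₂, hε₂, h₂⟩ := det_logCoord e
  refine ⟨ε₁ * ε₂, ?_, fun T v hv => ?_⟩
  · rcases hε₁ with rfl | rfl <;> rcases hε₂ with rfl | rfl <;> simp
  · have h3 := h₁ (fun l => Complex.exp (logCoord l T)) (fun l => Complex.exp_ne_zero _)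
      fun m => expDeriv T (v m)
    rw [stratumChart_eq] at h3
    rw [pullbackForm, (hasFDerivAt_toR T).fderiv, toR_phiMap]
    refine h3.trans ?_
    rw [mul_assoc, ← h₂ v hv]
    congr 2
    ext l m
    rw [Matrix.of_apply, Matrix.of_apply]
    change Complex.exp (logCoord l T) * logCoord l (v m) / Complex.exp (logCoord l T) = _
    rw [mul_div_cancel_left₀ _ (Complex.exp_ne_zero _)]

theorem fderiv_chartList_injective {n : ℕ} {t : Fin (nB n) → ℂ} (ht : ∀ l, t l ≠ 0)
    {v : Fin (nB n) → ℂ} (hv : fderiv ℂ (chartList (List.ofFn (stdWord n))) t v = 0) : v = 0 := by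
  have hdet : (stdJacobian t).det ≠ 0 := by
    intro h
    have h1 := det_stdJacobian_mul_prod ht
    rw [h, zero_mul] at h1
    exact cellDelta_chartList_ne_zero (isReducedW0_stdWord n) ht h1.symm
  refine Matrix.eq_zero_of_mulVec_eq_zero hdet (funext fun l => ?_)
  have h2 : v = ∑ l, v l • (Pi.single l 1 : Fin (nB n) → ℂ) := pi_eq_sum_univ' v
  have h3 := congrFun hv (posEquiv n l)
  rw [h2, map_sum, Finset.sum_apply] at h3
  rw [Matrix.mulVec, dotProduct]
  refine Eq.trans (Finset.sum_congr rfl fun l' _ => ?_) h3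
  rw [map_smul, Pi.smul_apply, smul_eq_mul, mul_comm]
  rfl

theorem exists_hasFDerivAt_chartZB {n : ℕ} (T : Ztilde n) :
    ∃ L : Ztilde n ≃L[ℂ] Cartan n × (Pos n → ℂ),
      HasFDerivAt (fun S => chartZB (phiMap S)) (L : Ztilde n →L[ℂ] Cartan n × (Pos n → ℂ)) T := by
  set D : Ztilde n →L[ℂ] Cartan n × (Pos n → ℂ) :=
    ((ContinuousLinearMap.fst ℂ _ _).comp (logEquiv n : Ztilde n →L[ℂ] Cartan n × (Fin (nB n) → ℂ))).prod
      ((fderiv ℂ (chartList (List.ofFn (stdWord n))) fun l => Complex.exp (logCoord l T)).comp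
        (expDeriv T)) with hD
  have hd : HasFDerivAt (fun S => chartZB (phiMap S)) D T :=
    HasFDerivAt.prodMk ((ContinuousLinearMap.fst ℂ _ _).comp
      (logEquiv n : Ztilde n →L[ℂ] Cartan n × (Fin (nB n) → ℂ))).hasFDerivAt (hasFDerivAt_toR T)
  have hinj : Function.Injective D := by
    refine (injective_iff_map_eq_zero D).mpr fun v hv => eq_zero_of_logMap_eq_zero ?_
    have h1 : gamma v = 0 := congrArg Prod.fst hv
    have h2 : expDeriv T v = 0 :=
      fderiv_chartList_injective (fun l => Complex.exp_ne_zero _) (congrArg Prod.snd hv)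
    refine Prod.ext h1 (funext fun l => ?_)
    have h3 : Complex.exp (logCoord l T) * logCoord l v = 0 := congrFun h2 l
    exact (mul_eq_zero.mp h3).resolve_left (Complex.exp_ne_zero _)
  have hrank : Module.finrank ℂ (Ztilde n) = Module.finrank ℂ (Cartan n × (Pos n → ℂ)) := by
    rw [(logEquiv n).toLinearEquiv.finrank_eq, Module.finrank_prod, Module.finrank_prod,
      Module.finrank_fintype_fun_eq_card, Module.finrank_fintype_fun_eq_card,
      Fintype.card_congr (posEquiv n)]
  have hbij : Function.Bijective (D : Ztilde n →ₗ[ℂ] Cartan n × (Pos n → ℂ)) :=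
    ⟨hinj, (LinearMap.injective_iff_surjective_of_finrank_eq_finrank hrank).mp hinj⟩
  refine ⟨(LinearEquiv.ofBijective _ hbij).toContinuousLinearEquiv, ?_⟩
  have hco : ((LinearEquiv.ofBijective _ hbij).toContinuousLinearEquiv : Ztilde n →L[ℂ] _) = D :=
    ContinuousLinearMap.ext fun v => rfl
  rw [hco]
  exact hd

/-! ### Coordinates of the big cell -/

/-- The block of a matrix formed by the rows and columns from `j` on. -/
def trailing {n : ℕ} (j : Fin (n + 1)) (x : Matrix (Fin (n + 1)) (Fin (n + 1)) ℂ) :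
    Matrix {k // j ≤ k} {k // j ≤ k} ℂ :=
  x.submatrix Subtype.val Subtype.val

/-- The entries of the upper unipotent factor of a matrix in the big cell. -/
def cellFactor {n : ℕ} (x : Matrix (Fin (n + 1)) (Fin (n + 1)) ℂ) (p : Pos n) : ℂ :=
  ((fun c : {k // p.1.2 ≤ k} => x p.1.1 c) ᵥ* (trailing p.1.2 x)⁻¹) ⟨p.1.2, le_rfl⟩

theorem cellFactor_smul {n : ℕ} {r : ℂ} (hr : r ≠ 0) (x : Matrix (Fin (n + 1)) (Fin (n + 1)) ℂ)
    (p : Pos n) : cellFactor (r • x) p = cellFactor x p := by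
  have h1 : (trailing p.1.2 (r • x))⁻¹ = r⁻¹ • (trailing p.1.2 x)⁻¹ := by
    change (r • trailing p.1.2 x)⁻¹ = _
    by_cases h : IsUnit (trailing p.1.2 x).det
    · have := Matrix.inv_smul' (trailing p.1.2 x)
        (Units.mk0 r hr) h
      exact this
    · rw [Matrix.nonsing_inv_apply_not_isUnit _ h, smul_zero, Matrix.nonsing_inv_apply_not_isUnit]
      change ¬ IsUnit (r • trailing p.1.2 x).det
      rw [isUnit_iff_ne_zero, not_not] at h
      rw [Matrix.det_smul, h, mul_zero, isUnit_iff_ne_zero, not_not]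
  rw [cellFactor, cellFactor, h1, Matrix.vecMul_smul]
  have h2 : (fun c : {k // p.1.2 ≤ k} => (r • x) p.1.1 c) =
    r • fun c : {k // p.1.2 ≤ k} => x p.1.1 c := rfl
  rw [h2, Matrix.smul_vecMul, smul_smul, inv_mul_cancel₀ hr, one_smul]

theorem mul_apply_trailing {n : ℕ} {l : SLn n} (hl : l ∈ borelSL n)
    (u : Matrix (Fin (n + 1)) (Fin (n + 1)) ℂ) (i j : Fin (n + 1)) (b : {k // j ≤ k}) :
    (u * mat l) i b = ∑ c : {k // j ≤ k}, u i c * mat l c b := by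
  rw [Matrix.mul_apply, ← Finset.sum_subtype (Finset.univ.filter (j ≤ ·)) (by simp)
    (fun c => u i c * mat l c b)]
  refine (Finset.sum_subset (Finset.subset_univ _) fun c _ hc => ?_).symm
  rw [mat_lower hl c b (lt_of_lt_of_le (by simpa using hc) b.2), mul_zero]

theorem det_trailing_ne_zero {n : ℕ} {l : SLn n} (hl : l ∈ borelSL n) (j : Fin (n + 1)) :
    (trailing j (mat l)).det ≠ 0 := by
  rw [Matrix.det_of_isLowerTriangular]
  · exact Finset.prod_ne_zero_iff.mpr fun c _ => mat_apply_self_ne_zero hl _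
  · intro a b hab
    exact mat_lower hl _ _ hab

theorem det_trailing_upper {n : ℕ} {u : SLn n} (hu : u ∈ upperUnipotent n) (j : Fin (n + 1)) :
    (trailing j (mat u)).det = 1 := by
  rw [Matrix.det_of_isUpperTriangular]
  · exact Finset.prod_eq_one fun c _ => hu.2 _
  · intro a b hab
    exact hu.1 _ _ hab

theorem trailing_mul {n : ℕ} {u l : SLn n} (hl : l ∈ borelSL n) (j : Fin (n + 1)) :
    trailing j (mat (u * l)) = trailing j (mat u) * trailing j (mat l) := by
  ext a b
  rw [mat_mul]
  exact mul_apply_trailing hl _ _ _ _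

theorem det_trailing_mul_ne_zero {n : ℕ} {u l : SLn n} (hu : u ∈ upperUnipotent n)
    (hl : l ∈ borelSL n) (j : Fin (n + 1)) :
    (trailing j (mat (u * l))).det ≠ 0 := by
  rw [trailing_mul hl, Matrix.det_mul, det_trailing_upper hu, one_mul]
  exact det_trailing_ne_zero hl j

theorem cellFactor_mul {n : ℕ} {u l : SLn n} (hu : u ∈ upperUnipotent n) (hl : l ∈ borelSL n)
    (p : Pos n) : cellFactor (mat (u * l)) p = mat u p.1.1 p.1.2 := by
  set U := trailing p.1.2 (mat u) with hU
  set L := trailing p.1.2 (mat l) with hL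
  have hU1 : IsUnit U.det := by rw [hU, det_trailing_upper hu]; exact isUnit_one
  have hL1 : IsUnit L.det := isUnit_iff_ne_zero.mpr (det_trailing_ne_zero hl _)
  have h1 : (fun c : {k // p.1.2 ≤ k} => mat (u * l) p.1.1 c) =
      (fun c : {k // p.1.2 ≤ k} => mat u p.1.1 c) ᵥ* L := by
    funext b
    rw [mat_mul, mul_apply_trailing hl]
    rfl
  have h2 : U *ᵥ Pi.single ⟨p.1.2, le_rfl⟩ 1 = Pi.single ⟨p.1.2, le_rfl⟩ 1 := by
    funext c
    rw [Matrix.mulVec_single_one]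
    change mat u c p.1.2 = _
    rcases eq_or_ne c ⟨p.1.2, le_rfl⟩ with rfl | hc
    · rw [Pi.single_eq_same]
      exact hu.2 _
    · rw [Pi.single_eq_of_ne hc]
      exact hu.1 _ _ (lt_of_le_of_ne c.2 fun h => hc (Subtype.ext h.symm))
  have h3 : U⁻¹ *ᵥ Pi.single ⟨p.1.2, le_rfl⟩ 1 = Pi.single ⟨p.1.2, le_rfl⟩ 1 := by
    nth_rewrite 1 [← h2]
    rw [Matrix.mulVec_mulVec, Matrix.nonsing_inv_mul _ hU1, Matrix.one_mulVec]
  rw [cellFactor, trailing_mul hl, h1, ← hU, ← hL, Matrix.vecMul_vecMul,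
    Matrix.mul_inv_rev, ← Matrix.mul_assoc, Matrix.mul_nonsing_inv _ hL1, Matrix.one_mul]
  have h4 := Matrix.dotProduct_mulVec (fun c : {k // p.1.2 ≤ k} => mat u p.1.1 c) U⁻¹
    (Pi.single ⟨p.1.2, le_rfl⟩ 1)
  rw [h3, dotProduct_single_one, dotProduct_single_one] at h4
  exact h4.symm

theorem continuousAt_cellFactor {n : ℕ} {x : Matrix (Fin (n + 1)) (Fin (n + 1)) ℂ} (p : Pos n)
    (hx : (trailing p.1.2 x).det ≠ 0) :
    ContinuousAt (fun y => cellFactor y p) x := by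
  have hs : Continuous fun y : Matrix (Fin (n + 1)) (Fin (n + 1)) ℂ => trailing p.1.2 y :=
    Continuous.matrix_submatrix continuous_id _ _
  have h1 : (fun y => cellFactor y p) = fun y : Matrix (Fin (n + 1)) (Fin (n + 1)) ℂ =>
      (trailing p.1.2 y).det⁻¹ *
      ((fun c : {k // p.1.2 ≤ k} => y p.1.1 c) ᵥ* (trailing p.1.2 y).adjugate) ⟨p.1.2, le_rfl⟩ := by
    funext y
    rw [cellFactor, Matrix.inv_def, Matrix.vecMul_smul, Ring.inverse_eq_inv']
    rfl
  rw [h1]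
  refine ContinuousAt.mul (ContinuousAt.inv₀ hs.matrix_det.continuousAt hx) (Continuous.continuousAt ?_)
  refine (continuous_apply _).comp (Continuous.matrix_vecMul ?_ hs.matrix_adjugate)
  exact continuous_pi fun c => continuous_id.matrix_elem _ _

/-! ### The chart of `ZB` is continuous -/

theorem exists_upper_factors {n : ℕ} (z : ZB n) : ∃ u₁ ∈ upperUnipotent n,
    ∃ u₂ ∈ upperUnipotent n, z.1.2.1 = toGd (u₁ * expSL z.1.1 * (w0Dot n)⁻¹ * u₂) := by
  obtain ⟨_, ⟨u₁, h₁, rfl⟩, _, ⟨u₂, h₂, rfl⟩, h⟩ := z.2.2.1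
  refine ⟨u₁, h₁, u₂, h₂, ?_⟩
  rw [h, expT]
  simp only [map_mul]

theorem expSL_mul_conj_mem {n : ℕ} (h : Cartan n) {u : SLn n} (hu : u ∈ upperUnipotent n) :
    expSL h * ((w0Dot n)⁻¹ * u * w0Dot n) ∈ borelSL n := by
  refine mul_mem (fun i j hij => Matrix.diagonal_apply_ne _ hij.ne) fun i j hij => ?_
  change mat ((w0Dot n)⁻¹ * u * w0Dot n) i j = 0
  rw [mat_mul, mat_mul]
  exact w0_inv_conj_lower hu.1 i j hij

theorem mul_w0Dot_eq {n : ℕ} (u₁ u₂ : SLn n) (h : Cartan n) :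
    u₁ * expSL h * (w0Dot n)⁻¹ * u₂ * w0Dot n =
      u₁ * (expSL h * ((w0Dot n)⁻¹ * u₂ * w0Dot n)) := by group

theorem toR_of_factor {n : ℕ} {z : ZB n} {u₁ u₂ : SLn n} (h₁ : u₁ ∈ upperUnipotent n)
    (h₂ : u₂ ∈ upperUnipotent n) (h : z.1.2.1 = toGd (u₁ * expSL z.1.1 * (w0Dot n)⁻¹ * u₂)) :
    toR z = fun p => mat u₁ p.1.1 p.1.2 := by
  rw [← cellCoord_mk h₁, toR, h, ← map_mul, mul_w0Dot_eq, map_mul]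
  congr 1
  refine (QuotientGroup.eq.mpr ?_).symm
  rw [inv_mul_cancel_left]
  exact ⟨_, expSL_mul_conj_mem z.1.1 h₂, rfl⟩

theorem toR_eq_cellFactor {n : ℕ} (z : ZB n) {g : SLn n} (hg : toGd g = z.1.2.1) :
    toR z = cellFactor (mat (g * w0Dot n)) := by
  obtain ⟨u₁, h₁, u₂, h₂, h⟩ := exists_upper_factors z
  rw [toR_of_factor h₁ h₂ h]
  obtain ⟨r, hr, hr'⟩ := exists_mat_eq_smul_of_toGd_eq (hg.trans h)
  funext p
  rw [mat_mul, hr', Matrix.smul_mul, cellFactor_smul hr, ← mat_mul, mul_w0Dot_eq,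
    cellFactor_mul h₁ (expSL_mul_conj_mem z.1.1 h₂)]

theorem continuous_mat {n : ℕ} : Continuous (mat (n := n)) := continuous_subtype_val

theorem continuous_toGd {n : ℕ} : Continuous (toGd (n := n)) := continuous_quot_mk

theorem isOpenMap_toGd {n : ℕ} : IsOpenMap (toGd (n := n)) := QuotientGroup.isOpenMap_coe

theorem continuous_toR {n : ℕ} : Continuous (toR (n := n)) := by
  refine continuous_iff_continuousAt.mpr fun z => ?_
  obtain ⟨u₁, h₁, u₂, h₂, h⟩ := exists_upper_factors z
  set g := u₁ * expSL z.1.1 * (w0Dot n)⁻¹ * u₂ with hg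
  have hF : ContinuousAt (fun x : SLn n => cellFactor (mat (x * w0Dot n))) g := by
    refine continuousAt_pi.mpr fun p => ?_
    have h3 : Continuous fun x : SLn n => mat (x * w0Dot n) :=
      continuous_mat.comp (continuous_mul_const _)
    refine ContinuousAt.comp (f := fun x : SLn n => mat (x * w0Dot n)) (x := g)
      (g := fun y => cellFactor y p) (continuousAt_cellFactor p ?_) h3.continuousAt
    rw [hg, mul_w0Dot_eq]
    exact det_trailing_mul_ne_zero h₁ (expSL_mul_conj_mem z.1.1 h₂) _
  intro N hN
  rw [toR_eq_cellFactor z h.symm] at hN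
  have h4 : toGd '' ((fun x : SLn n => cellFactor (mat (x * w0Dot n))) ⁻¹' N) ∈ 𝓝 z.1.2.1 := by
    rw [h]
    exact isOpenMap_toGd.image_mem_nhds (hF hN)
  have h5 : ContinuousAt (fun z : ZB n => z.1.2.1) z := by fun_prop
  change ∀ᶠ z' in 𝓝 z, toR z' ∈ N
  filter_upwards [h5.eventually_mem h4] with z' hz'
  obtain ⟨x, hx, hx'⟩ := hz'
  rw [toR_eq_cellFactor z' hx']
  exact hx

theorem continuous_chartZB {n : ℕ} : Continuous (chartZB (n := n)) :=
  (continuous_fst.comp continuous_subtype_val).prodMk continuous_toR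

/-! ### The comparison map is continuous -/

theorem continuous_gamma (n : ℕ) : Continuous (gamma (n := n)) := by
  have h : Continuous fun (T : Ztilde n) i => T.1 (diagVertex i) :=
    continuous_pi fun i => (continuous_apply (diagVertex i)).comp continuous_subtype_val
  exact h.subtype_mk _

theorem continuous_diagSum {n : ℕ} (k : ℕ) : Continuous fun T : Ztilde n => diagSum T k := by
  refine continuous_finsetSum _ fun v _ => ?_
  split_ifs
  · exact (continuous_apply _).comp continuous_subtype_val
  · exact continuous_const

theorem continuous_gammaR (n : ℕ) : Continuous (gammaR (n := n)) :=
  Continuous.subtype_mk (continuous_pi fun _ =>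
    (continuous_diagSum _).sub (continuous_diagSum _)) _

theorem continuous_expSL (n : ℕ) : Continuous (expSL (n := n)) := by
  refine Continuous.subtype_mk (Continuous.matrix_diagonal ?_) _
  exact continuous_pi fun i =>
    Complex.continuous_exp.comp ((continuous_apply i).comp continuous_subtype_val)

theorem continuous_xRoot {n : ℕ} (i : Fin n) : Continuous (xRoot i) := by
  refine continuous_induced_rng.mpr ?_
  change Continuous fun t => mat (xRoot i t)
  simp only [mat_xRoot]
  refine continuous_const.add (continuous_matrix fun a b => ?_)
  simp only [Matrix.single_apply]
  split_ifs
  · exact continuous_id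
  · exact continuous_const

theorem continuous_xr (n m : ℕ) : Continuous (xr n m) := by
  unfold xr
  split_ifs
  · exact continuous_xRoot _
  · exact continuous_const

theorem continuous_tExt {n : ℕ} (i j : ℕ) : Continuous fun T : Ztilde n => tExt T i j := by
  unfold tExt
  split_ifs
  · exact (continuous_apply _).comp continuous_subtype_val
  · exact continuous_const

theorem continuous_betaSL (n : ℕ) : Continuous (betaSL (n := n)) := by
  have hc : Continuous fun T : Ztilde n => xCNat n (cWeight (tExt T)) := by
    refine continuous_list_prod _ fun k _ => continuous_list_prod _ fun j _ => ?_
    split_ifs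
    · exact (continuous_xr n j).comp (Complex.continuous_exp.comp
        ((continuous_tExt _ _).sub (continuous_tExt _ _)))
    · exact continuous_const
  have hd : Continuous fun T : Ztilde n => xDNat n (dWeight (tExt T)) := by
    refine continuous_list_prod _ fun k _ => continuous_list_prod _ fun j _ => ?_
    split_ifs
    · exact (continuous_xr n _).comp (Complex.continuous_exp.comp
        ((continuous_tExt _ _).sub (continuous_tExt _ _)))
    · exact continuous_const
  exact ((hc.mul ((continuous_expSL n).comp (continuous_gamma n))).mul continuous_const).mul hd

theorem continuous_phiMap (n : ℕ) : Continuous (phiMap (n := n)) := by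
  refine Continuous.subtype_mk ((continuous_gamma n).prodMk (Continuous.prodMk ?_
    (continuous_gammaR n))) _
  rw [show betaTilde (n := n) = fun T => toGd (betaSL T) from funext betaTilde_eq]
  exact continuous_toGd.comp (continuous_betaSL n)

/-! ### The comparison map is open -/

theorem toGd_eq_of_chartZB_eq {n : ℕ} {z z' : ZB n} (h : chartZB z = chartZB z') :
    z.1.2.1 = z'.1.2.1 := by
  obtain ⟨u₁, h₁, u₂, h₂, hb⟩ := exists_upper_factors z
  obtain ⟨u₁', h₁', u₂', h₂', hb'⟩ := exists_upper_factors z'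
  have h3 : z.1.1 = z'.1.1 := (Prod.ext_iff.mp h).1
  have h4 : toR z = toR z' := (Prod.ext_iff.mp h).2
  rw [toR_of_factor h₁ h₂ hb, toR_of_factor h₁' h₂' hb'] at h4
  have h5 : u₁ = u₁' := by rw [← unip_eq h₁, ← unip_eq h₁', h4]
  have h6 : u₂⁻¹ * u₂' = 1 := by
    refine eq_one_of_upper_lower (mul_mem (inv_mem_upperUnipotent h₂) h₂')
      (mat_lower_of_toGd_mem ?_)
    have h7 := mul_mem (inv_mem z.2.1) z'.2.1
    rw [hb, hb', ← map_inv, ← map_mul, ← h3, ← h5] at h7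
    convert h7 using 2
    group
  rw [hb, hb', h3, h5, inv_mul_eq_one.mp h6]

theorem exists_exp_eq_of_toGd_eq {n : ℕ} {z z' : ZB n} (h : z.1.2.1 = z'.1.2.1) :
    ∃ r : ℂ, ∀ i, Complex.exp (z.1.2.2.1 i - z'.1.2.2.1 i) = r := by
  obtain ⟨g, hg⟩ : ∃ g, toGd g = z.1.2.1 := QuotientGroup.mk'_surjective _ _
  have key : ∀ z : ZB n, toGd g = z.1.2.1 →
      ∃ s : ℂ, s ≠ 0 ∧ ∀ i, mat g i i = s * Complex.exp (z.1.2.2.1 i) := by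
    intro z hg
    obtain ⟨v, ⟨-, hv⟩, hv'⟩ := z.2.2.2
    rw [← hg, expT, ← map_mul] at hv'
    obtain ⟨s, hs, hs'⟩ := exists_mat_eq_smul_of_toGd_eq hv'.symm
    refine ⟨s, hs, fun i => ?_⟩
    have h1 := congrFun (congrFun hs' i) i
    rw [mat_mul, mat_expSL, Matrix.mul_diagonal, Matrix.smul_apply, smul_eq_mul] at h1
    change mat g i i * Complex.exp (-z.1.2.2.1 i) = s * v i i at h1
    rw [hv, mul_one, Complex.exp_neg] at h1
    rw [← h1, inv_mul_cancel_right₀ (Complex.exp_ne_zero _)]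
  obtain ⟨s, hs, h1⟩ := key z hg
  obtain ⟨s', hs', h2⟩ := key z' (hg.trans h)
  refine ⟨s' / s, fun i => ?_⟩
  rw [Complex.exp_sub, div_eq_div_iff (Complex.exp_ne_zero _) hs, mul_comm, ← h1, h2]

theorem eq_zero_of_exp_eq_one {w : ℂ} (h : Complex.exp w = 1) (hw : ‖w‖ < 4) : w = 0 := by
  obtain ⟨k, rfl⟩ := Complex.exp_eq_one_iff.mp h
  suffices k = 0 by rw [this, Int.cast_zero, zero_mul]
  by_contra hk
  have h1 : (1 : ℝ) ≤ |(k : ℝ)| := by exact_mod_cast Int.one_le_abs hk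
  have h2 : ‖(k : ℂ) * (2 * Real.pi * Complex.I)‖ = |(k : ℝ)| * (2 * Real.pi) := by
    rw [norm_mul, norm_mul, norm_mul, Complex.norm_I, Complex.norm_real, Complex.norm_intCast,
      Real.norm_of_nonneg Real.pi_pos.le]
    simp
  rw [h2] at hw
  nlinarith [Real.pi_gt_three]

theorem eq_of_chartZB_eq {n : ℕ} {z z' : ZB n} (h : chartZB z = chartZB z')
    (hR : ∀ i, ‖z.1.2.2.1 i - z'.1.2.2.1 i‖ < 2) : z = z' := by
  have hb := toGd_eq_of_chartZB_eq h
  obtain ⟨r, hr⟩ := exists_exp_eq_of_toGd_eq hb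
  have h1 : ∀ i, z.1.2.2.1 i - z'.1.2.2.1 i = z.1.2.2.1 0 - z'.1.2.2.1 0 := by
    intro i
    refine sub_eq_zero.mp (eq_zero_of_exp_eq_one ?_ ?_)
    · rw [Complex.exp_sub, hr, hr, div_self]
      rw [← hr 0]
      exact Complex.exp_ne_zero _
    · exact (norm_sub_le _ _).trans_lt (by linarith [hR i, hR 0])
  have h2 : ∑ i, (z.1.2.2.1 i - z'.1.2.2.1 i) = 0 := by
    have h3 : ∑ i, z.1.2.2.1 i = 0 := z.1.2.2.2
    have h4 : ∑ i, z'.1.2.2.1 i = 0 := z'.1.2.2.2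
    rw [Finset.sum_sub_distrib, h3, h4, sub_zero]
  rw [Finset.sum_congr rfl fun i _ => h1 i, Finset.sum_const, Finset.card_univ, Fintype.card_fin,
    nsmul_eq_mul] at h2
  have h3 := (mul_eq_zero.mp h2).resolve_left (Nat.cast_ne_zero.mpr n.succ_ne_zero)
  refine Subtype.ext (Prod.ext (Prod.ext_iff.mp h).1
    (Prod.ext hb (Subtype.ext (funext fun i => ?_))))
  exact sub_eq_zero.mp ((h1 i).trans h3)

theorem contDiff_chartZB_phiMap (n : ℕ) :
    ContDiff ℂ 1 fun T : Ztilde n => chartZB (phiMap T) := by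
  simp only [chartZB_phiMap]
  refine ContDiff.prodMk ?_ ((contDiff_chartList _).comp (contDiff_pi.mpr fun l => ?_))
  · exact contDiff_fst.comp (logEquiv n).contDiff
  · exact Complex.contDiff_exp.comp
      ((contDiff_apply ℂ ℂ l).comp (contDiff_snd.comp (logEquiv n).contDiff))

theorem isOpenMap_phiMap (n : ℕ) : IsOpenMap (phiMap (n := n)) := by
  refine IsOpenMap.of_nhds_le fun T₀ S hS => ?_
  have hE : ∀ i, Continuous fun h : Cartan n => h.1 i := fun i =>
    (continuous_apply i).comp continuous_subtype_val
  set U : Set (Ztilde n) := phiMap ⁻¹' S ∩ {T | ∀ i, ‖(gammaR T).1 i - (gammaR T₀).1 i‖ < 1} with hU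
  have hU' : U ∈ 𝓝 T₀ := by
    refine Filter.inter_mem hS (Filter.eventually_all.mpr fun i => ?_)
    have h1 : Continuous fun T : Ztilde n => ‖(gammaR T).1 i - (gammaR T₀).1 i‖ :=
      (((hE i).comp (continuous_gammaR n)).sub continuous_const).norm
    exact h1.continuousAt.eventually_lt continuousAt_const (by simp)
  obtain ⟨L, hL⟩ := exists_hasFDerivAt_chartZB T₀
  have hstrict := (contDiff_chartZB_phiMap n).contDiffAt.hasStrictFDerivAt' hL one_ne_zero
  have h2 := hstrict.map_nhds_eq_of_equiv
  have h3 : (fun T => chartZB (phiMap T)) '' U ∈ 𝓝 (chartZB (phiMap T₀)) := by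
    rw [← h2]
    exact Filter.image_mem_map hU'
  have h4 : ∀ᶠ z : ZB n in 𝓝 (phiMap T₀), ∀ i, ‖z.1.2.2.1 i - (gammaR T₀).1 i‖ < 1 := by
    refine Filter.eventually_all.mpr fun i => ?_
    have h1 : Continuous fun z : ZB n => ‖z.1.2.2.1 i - (gammaR T₀).1 i‖ :=
      (((hE i).comp (by fun_prop)).sub continuous_const).norm
    refine h1.continuousAt.eventually_lt continuousAt_const ?_
    change ‖(gammaR T₀).1 i - (gammaR T₀).1 i‖ < 1
    simp
  filter_upwards [continuous_chartZB.continuousAt.eventually_mem h3, h4] with z ⟨T, hT, hz⟩ hz'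
  have h5 : phiMap T = z := by
    refine eq_of_chartZB_eq hz fun i => ?_
    have h6 := norm_sub_le ((gammaR T).1 i - (gammaR T₀).1 i) (z.1.2.2.1 i - (gammaR T₀).1 i)
    rw [sub_sub_sub_cancel_right] at h6
    exact h6.trans_lt (by linarith [hT.2 i, hz' i])
  rw [← h5]
  exact hT.1

/-! ### The fibres of the comparison map -/

theorem stdCoord_eq_of_chartList_eq {n : ℕ} {t t' : Fin (nB n) → ℂ} (ht : ∀ l, t l ≠ 0)
    (h : chartList (List.ofFn (stdWord n)) t = chartList (List.ofFn (stdWord n)) t') (i : ℕ) :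
    ∀ j, i ≤ j → j < n → stdCoord t j (j - i) = stdCoord t' j (j - i) := by
  induction i using Nat.strong_induction_on with
  | _ i ih =>
    intro j
    induction j using Nat.strong_induction_on with
    | _ j ihj =>
      intro hij hj
      have hne : ∀ a b, b ≤ a → a < n → stdCoord t a b ≠ 0 := by
        intro a b hb ha
        rw [stdCoord, dif_pos ⟨ha, hb⟩]
        exact ht _
      have h1 := ent_lowLevels_sub (c := stdCoord t) (c' := stdCoord t') (i := i) hj
        (fun a b hb hab => ?_) (fun a ha haj => ihj a haj ha (by omega)) (j - i) i le_rfl (by omega)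
      · have h2 := congrFun h (triPos n ⟨(⟨j, hj⟩, ⟨j - i, by omega⟩), Nat.sub_le _ _⟩)
        rw [chartList_stdWord, chartList_stdWord] at h2
        simp only [Nat.sub_sub_self hij] at h2
        rw [← h2, sub_self] at h1
        rcases mul_eq_zero.mp h1.symm with h3 | h3
        · refine absurd h3 (Finset.prod_ne_zero_iff.mpr fun a ha => ?_)
          rw [Finset.mem_Ico] at ha
          exact hne _ _ (Nat.sub_le _ _) (by omega)
        · exact (sub_eq_zero.mp h3).symm
      · rcases lt_or_ge a n with ha | ha
        · have h3 := ih (a - b) hab a (Nat.sub_le _ _) ha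
          rwa [Nat.sub_sub_self hb] at h3
        · rw [stdCoord, stdCoord, dif_neg (by omega), dif_neg (by omega)]

theorem chartList_stdWord_inj {n : ℕ} {t t' : Fin (nB n) → ℂ} (ht : ∀ l, t l ≠ 0)
    (h : chartList (List.ofFn (stdWord n)) t = chartList (List.ofFn (stdWord n)) t') : t = t' := by
  funext l
  have hp := (stdEquiv n l).2
  rw [Fin.le_def] at hp
  have h1 := stdCoord_eq_of_chartList_eq ht h ((stdEquiv n l).1.1 - (stdEquiv n l).1.2 : ℕ)
    (stdEquiv n l).1.1 (Nat.sub_le _ _) (stdEquiv n l).1.1.2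
  rwa [Nat.sub_sub_self hp, stdCoord_stdEquiv, stdCoord_stdEquiv] at h1

theorem diagSum_add {n : ℕ} (S T : Ztilde n) (k : ℕ) :
    diagSum (S + T) k = diagSum S k + diagSum T k := by
  rw [diagSum, diagSum, diagSum, ← Finset.sum_add_distrib]
  refine Finset.sum_congr rfl fun v _ => ?_
  split_ifs
  · rfl
  · exact (add_zero 0).symm

/-- `gamma` and `gammaR` as one additive map. -/
def gammaHom (n : ℕ) : Ztilde n →+ Cartan n × Cartan n :=
  AddMonoidHom.mk' (fun T => (gamma T, gammaR T)) fun S T => by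
    refine Prod.ext rfl (Subtype.ext (funext fun m => ?_))
    change diagSum (S + T) m - diagSum (S + T) (m + 1) =
      diagSum S m - diagSum S (m + 1) + (diagSum T m - diagSum T (m + 1))
    rw [diagSum_add, diagSum_add]
    ring

/-- The deck transformations of the comparison map. -/
def deckLattice (n : ℕ) : AddSubgroup (Ztilde n) where
  carrier := {v | gammaHom n v = 0 ∧ ∀ l, Complex.exp (logCoord l v) = 1}
  zero_mem' := ⟨map_zero _, fun l => by rw [map_zero, Complex.exp_zero]⟩
  add_mem' := by
    rintro v w ⟨hv, hv'⟩ ⟨hw, hw'⟩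
    exact ⟨by rw [map_add, hv, hw, add_zero], fun l => by
      rw [map_add, Complex.exp_add, hv', hw', mul_one]⟩
  neg_mem' := by
    rintro v ⟨hv, hv'⟩
    exact ⟨by rw [map_neg, hv, neg_zero], fun l => by
      rw [map_neg, Complex.exp_neg, hv', inv_one]⟩

theorem phiMap_eq_iff {n : ℕ} {S T : Ztilde n} :
    phiMap S = phiMap T ↔ T + -S ∈ deckLattice n := by
  have h0 : T + -S ∈ deckLattice n ↔ gammaHom n S = gammaHom n T ∧
      ∀ l, Complex.exp (logCoord l S) = Complex.exp (logCoord l T) := by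
    change gammaHom n (T + -S) = 0 ∧ (∀ l, Complex.exp (logCoord l (T + -S)) = 1) ↔ _
    rw [map_add, map_neg, ← sub_eq_add_neg, sub_eq_zero, eq_comm (a := gammaHom n T)]
    refine and_congr_right fun _ => forall_congr' fun l => ?_
    rw [map_add, map_neg, ← sub_eq_add_neg, Complex.exp_sub, div_eq_one_iff_eq (Complex.exp_ne_zero _),
      eq_comm]
  rw [h0]
  constructor
  · intro h
    refine ⟨Prod.ext (congrArg (fun z : ZB n => z.1.1) h) (congrArg (fun z : ZB n => z.1.2.2) h), ?_⟩
    have h1 := congrArg toR h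
    rw [toR_phiMap, toR_phiMap] at h1
    exact congrFun (chartList_stdWord_inj (fun l => Complex.exp_ne_zero _) h1)
  · rintro ⟨h1, h2⟩
    have h3 : gamma S = gamma T := congrArg Prod.fst h1
    have h4 : gammaR S = gammaR T := congrArg Prod.snd h1
    refine Subtype.ext (Prod.ext h3 (Prod.ext (toGd_eq_of_chartZB_eq ?_) h4))
    refine Prod.ext h3 ?_
    change toR (phiMap S) = toR (phiMap T)
    rw [toR_phiMap, toR_phiMap, funext h2]

theorem isDiscrete_deckLattice (n : ℕ) : IsDiscrete (deckLattice n : Set (Ztilde n)) := by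
  refine ⟨?_⟩
  refine discreteTopology_of_isOpen_singleton_zero (G := deckLattice n) ?_
  have h1 : ({0} : Set (deckLattice n)) = {v | ∀ l, ‖logCoord l v.1‖ < 4} := by
    ext v
    refine ⟨?_, fun hv => Subtype.ext (eq_zero_of_logMap_eq_zero (Prod.ext ?_ (funext fun l => ?_)))⟩
    · rintro rfl l
      change ‖logCoord l 0‖ < 4
      rw [map_zero, norm_zero]
      norm_num
    · exact (Prod.ext_iff.mp v.2.1).1
    · exact eq_zero_of_exp_eq_one (v.2.2 l) (hv l)
  rw [h1, Set.ofPred_forall]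
  refine isOpen_iInter_of_finite fun l => isOpen_lt ?_ continuous_const
  exact ((logCoord l).continuous_of_finiteDimensional.comp continuous_subtype_val).norm

theorem isCoveringThenOpenEmbedding_phiMap (n : ℕ) :
    IsCoveringThenOpenEmbedding (phiMap (n := n)) := by
  have hopen := isOpenMap_phiMap n
  have hq : Topology.IsQuotientMap (Set.rangeFactorization (phiMap (n := n))) := by
    refine IsOpenMap.isQuotientMap (fun U hU => ?_) (continuous_phiMap n).rangeFactorization
      Set.rangeFactorization_surjective
    refine isOpen_induced_iff.mpr ⟨_, hopen U hU, ?_⟩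
    ext ⟨z, hz⟩
    simp [Set.rangeFactorization, Subtype.ext_iff]
  refine ⟨Set.range (phiMap (n := n)), inferInstance, Set.rangeFactorization phiMap, Subtype.val, ?_,
    Set.rangeFactorization_surjective, hopen.isOpen_range.isOpenEmbedding_subtypeVal, rfl⟩
  refine (hq.isAddQuotientCoveringMap_of_addSubgroup (deckLattice n) (isDiscrete_deckLattice n)
    fun {S T} => ?_).isCoveringMap
  rw [← phiMap_eq_iff, Subtype.ext_iff]
  rfl

end FlagMirror

end

theorem theorem8p5 (n : ℕ) (hn : 1 ≤ n) :
    ∃ Φ : Ztilde n → ZB n,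
      (∀ T, (Φ T).1 = (gamma T, betaTilde T, gammaR T)) ∧
      IsCoveringThenOpenEmbedding Φ ∧
      (∀ T : Ztilde n, ∃ L : Ztilde n ≃L[ℂ] Cartan n × (Pos n → ℂ),
        HasFDerivAt (fun S => chartZB (Φ S)) (L : Ztilde n →L[ℂ] Cartan n × (Pos n → ℂ)) T) ∧
      (∀ h : Cartan n, Set.MapsTo Φ (fiberZtilde h) (fiberZB h)) ∧
      (∀ i₀ : Fin (nB n) → Fin n, IsReducedW0 i₀ → ∀ e : Fin (nB n) ≃ LowerVertex n,
        ∃ ε : ℂ, (ε = 1 ∨ ε = -1) ∧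
          ∀ (T : Ztilde n) (v : Fin (nB n) → Ztilde n), (∀ m, IsVertical (v m)) →
            pullbackForm i₀ Φ T v = ε * Matrix.det (Matrix.of fun l m => (v m).1 (e l).1)) ∧
      (∀ (h : Cartan n) (T : Ztilde n),
        Complex.exp (phaseB (Φ T)) * phiTilde (Φ T) h = Complex.exp (phaseJK T h)) := by
  refine ⟨phiMap, fun T => rfl, isCoveringThenOpenEmbedding_phiMap n, exists_hasFDerivAt_chartZB, fun h T hT => ?_,
    fun i₀ h₀ e => exists_pullbackForm_eq h₀ e, fun h T => exp_phaseB_mul_phiTilde h T⟩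
  exact Subtype.ext (funext hT)
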